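/- **Setting.** Let $d\ge 1$, $\alpha\ge 1$, $t_{\rm fin}\in(0,\infty)$, $\chi_N>0$ ($N\ge 1$), and let $\mathbb{T}^d=(\mathbb{R}/\mathbb{Z})^d$ with Lebesgue measure. Equip $L^1_{\ge0}(\mathbb{T}^d)$ with the weak-$\star$ topology (tested against $C(\mathbb{T}^d)$), let $\mathbb{D}$ be the Skorokhod ($J_1$) space of càdlàg paths $[0,t_{\rm fin}]\to L^1_{\ge0}(\mathbb{T}^d)$ and $\mathcal{C}\subset\mathbb{D}$ the set of weak-$\star$ continuous paths. Let $\mathbb{T}^d_N=\{0,\frac1N,\dots,1-\frac1N\}^d$, let $(c^N_x)_{x\in\mathbb{T}^d_N}$ be the partition of $\mathbb{T}^d$ into translates of $[0,\frac1N)^d$ centred at $x$, let $X_N$ be the set of functions that are constant on each $c^N_x$ with values in $\chi_N\mathbb{N}_0$, and let $\mathbb{D}_N\subset\mathbb{D}$ be the paths with values in $X_N$. Let $p^N$ be the nearest-neighbour kernel on $\mathbb{T}^d_N$ (each of the $2d$ directions has probability $\frac1{2d}$). Put $\mathcal{H}(u)=\int_{\mathbb{T}^d}(u\log u-u+1)\,dx\in[0,\infty]$,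 $$\mathcal{D}_{\alpha,N}(\eta)=\frac{1}{\alpha N^{d-2}}\sum_{x,y\in\mathbb{T}^d_N}\big(\eta(x)^{\alpha/2}-\eta(y)^{\alpha/2}\big)^2\,d\,p^N(x,y),\qquad \mathcal{D}_\alpha(u)=\frac2\alpha\int_{\mathbb{T}^d}|\nabla(u^{\alpha/2})|^2dx,$$ with $\mathcal{D}_\alpha(u)=\infty$ if $u^{\alpha/2}\notin\dot H^1(\mathbb{T}^d)$, and $$\mathcal{F}_{\alpha,N}(\eta_\bullet)=\sup_{t\le t_{\rm fin}}\mathcal{H}(\eta_t)+\int_0^{t_{\rm fin}}\mathcal{D}_{\alpha,N}(\eta_s)\,ds,\qquad \mathcal{F}_\alpha(u_\bullet)=\sup_{t\le t_{\rm fin}}\mathcal{H}(u_t)+\frac12\int_0^{t_{\rm fin}}\mathcal{D}_\alpha(u_s)\,ds .$$ Let $\mathcal{R}=\{u_\bullet\in\mathcal{C}:\int_0^{t_{\rm fin}}\mathcal{D}_\alpha(u_s)ds<\infty\}$. **Lemma (Deterministic Weak-to-Strong Principle).** There is $\beta>\alpha$, depending only on $d$ and $\alpha$, such that the following hold. Let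 $z<\infty$ and let $\eta^N_\bullet\in\mathbb{D}_N$, $N\ge1$, satisfy $\mathcal{F}_{\alpha,N}(\eta^N_\bullet)\le z$ for all $N$ and converge in the topology of $\mathbb{D}$ to some $u_\bullet\in\mathcal{C}$. Then $u_\bullet$ and $\eta^N_\bullet$, $N\ge1$, are bounded in $L^\beta([0,t_{\rm fin}]\times\mathbb{T}^d)$, $\eta^N_\bullet\to u_\bullet$ strongly in $L^\alpha([0,t_{\rm fin}]\times\mathbb{T}^d)$, and $\mathcal{F}_\alpha(u_\bullet)\le z$. Moreover, for any $u_\bullet\in\mathcal{C}$, $$\inf\Big\{\liminf_N\mathcal{F}_{\alpha,N}(\eta^N_\bullet):\ \eta^N_\bullet\in\mathbb{D}_N,\ \eta^N_\bullet\to u_\bullet\text{ in }\mathbb{D}\Big\}\ge\mathcal{F}_\alpha(u_\bullet).$$ Furthermore: (i) If $u_\bullet\in\mathcal{R}$ and $\lambda<\infty$, then for every open neighbourhood $\mathcal{V}$ of $u_\bullet$ in $L^\alpha([0,t_{\rm fin}]\times\mathbb{T}^d)$ there is a $\mathbb{D}$-open $\mathcal{U}\ni u_\bullet$ such that, for all sufficiently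 large $N$, $\{\eta^N_\bullet\in\mathbb{D}_N:\mathcal{F}_{\alpha,N}(\eta^N_\bullet)\le\lambda\}\cap\mathcal{U}\subset\mathcal{V}$. (ii) If $u_\bullet\in\mathbb{D}$ and $\mathcal{F}_\alpha(u_\bullet)=\infty$, then for every $\lambda<\infty$ there is a $\mathbb{D}$-open $\mathcal{U}\ni u_\bullet$ such that, for all sufficiently large $N$, $\mathcal{U}\cap\mathbb{D}_N\subset\{\eta^N_\bullet\in\mathbb{D}_N:\mathcal{F}_{\alpha,N}(\eta^N_\bullet)>\lambda\}$. -/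

import Mathlib

open MeasureTheory Filter Topology Set
open scoped ENNReal NNReal ContDiff

noncomputable section

namespace ZeroRange

/-! ### The torus and nonnegative integrable functions -/

/-- The torus `𝕋ᵈ = (ℝ/ℤ)ᵈ`; its `volume` is the product of the Haar probability measures. -/
abbrev Torus (d : ℕ) : Type := Fin d → UnitAddCircle

/-- `L¹_{≥0}(𝕋ᵈ)`, as a set of almost-everywhere classes. -/
def L1Pos (d : ℕ) : Type :=
  {f : Lp ℝ 1 (volume : Measure (Torus d)) // 0 ≤ f}

instance (d : ℕ) : CoeFun (L1Pos d) (fun _ => Torus d → ℝ) := ⟨fun f => (f.1 : Torus d → ℝ)⟩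

/-- The pairing `⟨φ, u⟩ = ∫ φ(x) u(x) dx` with a continuous function. -/
def pairing {d : ℕ} (u : L1Pos d) (φ : C(Torus d, ℝ)) : ℝ :=
  ∫ x, φ x * u x

/-- The weak-⋆ uniform structure (and hence topology) of `L¹_{≥0}(𝕋ᵈ)`: the coarsest one for which
all the maps `u ↦ ⟨φ, u⟩`, with `φ` continuous, are uniformly continuous. -/
instance (d : ℕ) : UniformSpace (L1Pos d) :=
  UniformSpace.comap (pairing : L1Pos d → (C(Torus d, ℝ) → ℝ)) inferInstance

/-! ### Skorokhod space -/

/-- Right-continuous paths on `[0, T]` with left limits. -/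
def IsCadlag {T : ℝ} {E : Type*} [TopologicalSpace E] (u : Icc (0 : ℝ) T → E) : Prop :=
  ∀ t, ContinuousWithinAt u (Ici t) t ∧ ∃ l, Tendsto u (𝓝[<] t) (𝓝 l)

/-- The space of càdlàg paths `[0, T] → E`. -/
def Skorokhod (T : ℝ) (E : Type*) [TopologicalSpace E] : Type _ :=
  {u : Icc (0 : ℝ) T → E // IsCadlag u}

instance (T : ℝ) (E : Type*) [TopologicalSpace E] :
    CoeFun (Skorokhod T E) (fun _ => Icc (0 : ℝ) T → E) := ⟨Subtype.val⟩

/-- The paths `v` for which some time change `σ` (an increasing bijection of `[0, T]`) is uniformly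
`ε`-close to the identity, with `u(t)` and `v(σ(t))` uniformly `V`-close. -/
def skorokhodBall {T : ℝ} {E : Type*} [TopologicalSpace E] (u : Skorokhod T E)
    (V : Set (E × E)) (ε : ℝ) : Set (Skorokhod T E) :=
  {v | ∃ σ : Icc (0 : ℝ) T ≃o Icc (0 : ℝ) T,
    (∀ t, |(σ t : ℝ) - (t : ℝ)| < ε) ∧ ∀ t, (u t, v (σ t)) ∈ V}

/-- Skorokhod's `J₁` topology. Since the range of a càdlàg path is relatively compact, it depends
only on the topology of `E`, and for metrizable `E` it is the one given by any metric of `E`. -/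
instance (T : ℝ) (E : Type*) [UniformSpace E] : TopologicalSpace (Skorokhod T E) where
  IsOpen U := ∀ u ∈ U, ∃ V ∈ uniformity E, ∃ ε > 0, skorokhodBall u V ε ⊆ U
  isOpen_univ := fun _ _ => ⟨univ, univ_mem, 1, one_pos, subset_univ _⟩
  isOpen_inter := by
    rintro A B hA hB u ⟨huA, huB⟩
    obtain ⟨V, hV, ε, hε, h⟩ := hA u huA
    obtain ⟨V', hV', ε', hε', h'⟩ := hB u huB
    refine ⟨V ∩ V', inter_mem hV hV', min ε ε', lt_min hε hε', ?_⟩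
    rintro v ⟨σ, h1, h2⟩
    exact ⟨h ⟨σ, fun t => (h1 t).trans_le (min_le_left _ _), fun t => (h2 t).1⟩,
      h' ⟨σ, fun t => (h1 t).trans_le (min_le_right _ _), fun t => (h2 t).2⟩⟩
  isOpen_sUnion := by
    rintro S hS u ⟨A, hA, hu⟩
    obtain ⟨V, hV, ε, hε, h⟩ := hS A hA u hu
    exact ⟨V, hV, ε, hε, h.trans (subset_sUnion_of_mem hA)⟩

/-- The path space `𝔻 = 𝔻([0, T], L¹_{≥0}(𝕋ᵈ))`. -/
abbrev PathSpace (d : ℕ) (T : ℝ) : Type := Skorokhod T (L1Pos d)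

/-- The set `𝒞 ⊆ 𝔻` of weak-⋆ continuous paths. -/
def continuousPaths (d : ℕ) (T : ℝ) : Set (PathSpace d T) := {u | Continuous u.1}

/-! ### The lattice -/

/-- The lattice `𝕋ᵈ_N`; the index `x` stands for the point `x / N`. -/
abbrev Lattice (d : ℕ) (N : ℕ+) : Type := Fin d → ZMod N

/-- The box `c^N_x`, a translate of `[0, 1/N)ᵈ` centred at the lattice point `x / N`. -/
def cube {d : ℕ} (N : ℕ+) (x : Lattice d N) : Set (Torus d) :=
  {z | ∀ i, ∃ s ∈ Ico (-(1 / (2 * (N : ℝ)))) (1 / (2 * (N : ℝ))),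
    z i = ((((x i).val : ℝ) / (N : ℝ) + s : ℝ) : UnitAddCircle)}

/-- The nearest-neighbour kernel: one of the `2d` directions is chosen uniformly. -/
def kernel {d : ℕ} (N : ℕ+) (x y : Lattice d N) : ℝ :=
  1 / (2 * (d : ℝ)) * ∑ i, ((if y = x + Pi.single i 1 then 1 else 0)
    + (if y = x - Pi.single i 1 then 1 else 0))

/-- The state space `X_N`: functions constant on each box, with values in `χ ℕ`. -/
def configurations (d : ℕ) (χ : ℝ) (N : ℕ+) : Set (L1Pos d) :=
  {f | ∃ k : Lattice d N → ℕ, ∀ x, ∀ᵐ z, z ∈ cube N x → f z = χ * k x}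

/-- The set `𝔻_N ⊆ 𝔻` of paths with values in `X_N`. -/
def latticePaths (d : ℕ) (T χ : ℝ) (N : ℕ+) : Set (PathSpace d T) :=
  {η | ∀ t, η t ∈ configurations d χ N}

/-- The value at the site `x` of a function that is constant on boxes, read off as the mean over
the box (whose volume is `N⁻ᵈ`). -/
def siteValue {d : ℕ} (N : ℕ+) (f : L1Pos d) (x : Lattice d N) : ℝ :=
  (N : ℝ) ^ d * ∫ z in cube N x, f z

/-! ### Entropy and entropy dissipation -/

/-- The Boltzmann entropy `ℋ(u) = ∫ (u log u - u + 1) dx ∈ [0, ∞]`. -/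
def entropy {d : ℕ} (u : L1Pos d) : ℝ≥0∞ :=
  ∫⁻ x, ENNReal.ofReal (u x * Real.log (u x) - u x + 1)

/-- The discrete dissipation
`𝒟_{α,N}(η) = (α N^{d-2})⁻¹ ∑_{x,y} (η(x)^{α/2} - η(y)^{α/2})² d p^N(x,y)`. -/
def discreteDissipation {d : ℕ} (α : ℝ) (N : ℕ+) (f : L1Pos d) : ℝ :=
  1 / (α * (N : ℝ) ^ ((d : ℤ) - 2)) * ∑ x : Lattice d N, ∑ y : Lattice d N,
    (siteValue N f x ^ (α / 2) - siteValue N f y ^ (α / 2)) ^ 2 * ((d : ℝ) * kernel N x y)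

/-- Smooth functions on the torus are those with a smooth periodic lift to `ℝᵈ`. -/
def IsSmooth {d : ℕ} (φ : Torus d → ℝ) : Prop :=
  ContDiff ℝ ∞ (fun y : Fin d → ℝ => φ (fun i => (y i : UnitAddCircle)))

/-- The partial derivative `∂_i φ` on the torus. -/
def partialDeriv {d : ℕ} (i : Fin d) (φ : Torus d → ℝ) (x : Torus d) : ℝ :=
  deriv (fun s : ℝ => φ (x + Pi.single i (s : UnitAddCircle))) 0

/-- `v` is in `Ḣ¹(𝕋ᵈ)` with weak gradient `g ∈ L²(𝕋ᵈ, ℝᵈ)`. -/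
def IsWeakGradient {d : ℕ} (v : Torus d → ℝ) (g : Torus d → EuclideanSpace ℝ (Fin d)) : Prop :=
  Integrable v ∧ MemLp g 2 ∧ ∀ φ : Torus d → ℝ, IsSmooth φ → ∀ i,
    ∫ x, v x * partialDeriv i φ x = -∫ x, g x i * φ x

/-- The entropy dissipation `𝒟_α(u) = (2/α) ∫ |∇(u^{α/2})|² dx`, with the value `∞` if
`u^{α/2} ∉ Ḣ¹(𝕋ᵈ)`. The weak gradient is unique up to null sets, so that the infimum is over
at most one value. -/
def dissipation {d : ℕ} (α : ℝ) (u : L1Pos d) : ℝ≥0∞ :=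
  ⨅ (g : Torus d → EuclideanSpace ℝ (Fin d)) (_ : IsWeakGradient (fun x => u x ^ (α / 2)) g),
    ENNReal.ofReal (2 / α) * ∫⁻ x, ‖g x‖ₑ ^ 2

/-- Lebesgue measure on `[0, T]`. -/
def timeMeasure (T : ℝ) : Measure (Icc (0 : ℝ) T) := Measure.comap Subtype.val volume

/-- `ℱ_{α,N}(η) = sup_t ℋ(η_t) + ∫₀ᵀ 𝒟_{α,N}(η_s) ds`. -/
def discreteF {d : ℕ} {T : ℝ} (α : ℝ) (N : ℕ+) (η : PathSpace d T) : ℝ≥0∞ :=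
  (⨆ t, entropy (η t)) + ∫⁻ t, ENNReal.ofReal (discreteDissipation α N (η t)) ∂timeMeasure T

/-- `ℱ_α(u) = sup_t ℋ(u_t) + ½ ∫₀ᵀ 𝒟_α(u_s) ds`, that is, the time integral is that of
`(1/α) ∫ |∇(u_s^{α/2})|² dx`, which is the limit of the discrete dissipations `𝒟_{α,N}`: as the
kernel has mass `1`, the double sum in `𝒟_{α,N}` counts every edge with total weight `1`. -/
def continuumF {d : ℕ} {T : ℝ} (α : ℝ) (u : PathSpace d T) : ℝ≥0∞ :=
  (⨆ t, entropy (u t)) + 2⁻¹ * ∫⁻ t, dissipation α (u t) ∂timeMeasure T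

/-- The energy class `ℛ`: weak-⋆ continuous paths with `∫₀ᵀ 𝒟_α(u_s) ds < ∞`. -/
def energyClass (d : ℕ) (T α : ℝ) : Set (PathSpace d T) :=
  {u | u ∈ continuousPaths d T ∧ ∫⁻ t, dissipation α (u t) ∂timeMeasure T < ⊤}

/-! ### Space-time Lebesgue spaces -/

/-- Lebesgue measure on `[0, T] × 𝕋ᵈ`. -/
def spaceTime (d : ℕ) (T : ℝ) : Measure (Icc (0 : ℝ) T × Torus d) :=
  (timeMeasure T).prod volume

instance (α : ℝ) [h : Fact (1 ≤ α)] : Fact (1 ≤ ENNReal.ofReal α) :=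
  ⟨ENNReal.one_le_ofReal.2 h.out⟩

/-- `L^α([0, T] × 𝕋ᵈ)`. -/
abbrev SpaceTimeLp (d : ℕ) (T α : ℝ) : Type :=
  Lp ℝ (ENNReal.ofReal α) (spaceTime d T)

/-- The space-time function `w` is the path `u`: `w(t, ·) = u_t` for almost every `t`. -/
def IsVersion {d : ℕ} {T α : ℝ} (w : SpaceTimeLp d T α) (u : PathSpace d T) : Prop :=
  ∀ᵐ t ∂timeMeasure T, ∀ᵐ x, w (t, x) = u t x

end ZeroRange

end

noncomputable section

namespace ZeroRange

/-! ### Boxes and lattice points -/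

/-! The entropy bound controls the mass at every time, and the dissipation bound is a discrete H¹
bound on η^{α/2}. Since a² - b² = (a - b)(a + b), the latter becomes a discrete BV bound on η^α.
Applied to η^α, the Gagliardo inequality gives L^{1+1/d}, and Hölder's inequality against the mass
raises the exponent to β = α + 1/(d+1). The lower-order term ∫η^α is absorbed by interpolating
between exponents 1 and β. The outcome, `exists_static_bound`, is linear in the Dirichlet sum at
each fixed time, so it can be integrated in time.

The BV bound on η^α also controls spatial translations. With |a - b|^α ≤ |a^α - b^α| it shows that η
is within (ε + 1/N) times the BV sum of its mollification at scale ε, in the α-th power of L^α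
(`IsMollifier.integral_abs_sub_rpow_le`). For a fixed mollifier, convergence in the Skorokhod
topology makes the mollified paths converge at almost every time, hence in L^α by dominated
convergence. So the lattice paths are Cauchy in L^α (`cauchySeq_of_testedConvergence`), and pairing
with continuous functions identifies the limit as u.

For the functional, the entropy is a supremum of weak-⋆ continuous functionals by Legendre duality,
and this passes to the limit at every time, whatever the time changes. For the dissipation, strong
convergence gives almost-everywhere convergence along subsequences. The discrete gradients then have
a weak L² limit, which summation by parts identifies as the weak gradient
(`dissipation_le_of_tendsto_ae`), and Fatou's lemma integrates in time. Both bounds are combined in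
`continuumF_le_of_testedConvergence`.

The whole argument uses only `TestedConvergence`, where the time change may depend on the test
function. A càdlàg limit suffices, because each pairing has only countably many discontinuities. On
paths of bounded mass this convergence is captured by countably many neighbourhoods, so the two
neighbourhood statements follow by contradiction from the sequential ones
(`exists_isOpen_eventually`). -/

/-- The index of the arc of length `1 / N`, centred at a multiple of `1 / N`, that contains `z`. -/
def circleIndex (N : ℕ+) (z : UnitAddCircle) : ZMod N :=
  ((⌊(N : ℝ) * (AddCircle.equivIco 1 0 z : ℝ) + 1 / 2⌋ : ℤ) : ZMod N)

/-- Changing the real representative by an integer n changes the floor by N n, which vanishes modulo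
N. -/
lemma circleIndex_coe (N : ℕ+) (y : ℝ) :
    circleIndex N (y : UnitAddCircle) = ((⌊(N : ℝ) * y + 1 / 2⌋ : ℤ) : ZMod N) := by
  unfold circleIndex
  have h : ((AddCircle.equivIco 1 0 (y : UnitAddCircle) : ℝ) : UnitAddCircle) = y :=
    AddCircle.coe_equivIco
  obtain ⟨n, hn⟩ := (AddCircle.coe_eq_zero_iff (p := (1 : ℝ))
    (x := y - (AddCircle.equivIco 1 0 (y : UnitAddCircle) : ℝ))).1
    (by rw [AddCircle.coe_sub]; exact sub_eq_zero.2 h.symm)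
  have hy : y = (AddCircle.equivIco 1 0 (y : UnitAddCircle) : ℝ) + n := by
    simp only [zsmul_eq_mul, mul_one] at hn
    linarith
  have : (N : ℝ) * y + 1 / 2 =
      (N : ℝ) * (AddCircle.equivIco 1 0 (y : UnitAddCircle) : ℝ) + 1 / 2 + ((N * n : ℤ) : ℝ) := by
    push_cast
    linear_combination (N : ℝ) * hy
  rw [this, Int.floor_add_intCast]
  simp

lemma measurable_circleIndex (N : ℕ+) : Measurable (circleIndex N) := by
  have h1 : Measurable (fun z : UnitAddCircle => (AddCircle.equivIco 1 0 z : ℝ)) :=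
    measurable_subtype_coe.comp (AddCircle.measurableEquivIco (1 : ℝ) 0).measurable
  have h2 : Measurable (fun k : ℤ => (k : ZMod N)) := measurable_from_top
  exact h2.comp (Int.measurable_floor.comp ((h1.const_mul _).add_const _))

lemma circleIndex_add_coe (N : ℕ+) (z : UnitAddCircle) (k : ℤ) :
    circleIndex N (z + (((k : ℝ) / (N : ℝ) : ℝ) : UnitAddCircle)) = circleIndex N z + k := by
  induction z using QuotientAddGroup.induction_on with
  | H y =>
    have hN : (N : ℝ) ≠ 0 := by exact_mod_cast N.ne_zero
    change circleIndex N ((y : UnitAddCircle) + _) = circleIndex N (y : UnitAddCircle) + _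
    rw [← AddCircle.coe_add, circleIndex_coe, circleIndex_coe]
    have : (N : ℝ) * (y + k / N) + 1 / 2 = (N : ℝ) * y + 1 / 2 + k := by
      field_simp
      ring
    rw [this, Int.floor_add_intCast]
    simp

lemma exists_circleIndex_add (N : ℕ+) (z h : UnitAddCircle) :
    ∃ k : ℤ, circleIndex N (z + h) = circleIndex N z + k ∧ |(k : ℝ)| ≤ N * ‖h‖ + 1 := by
  induction z using QuotientAddGroup.induction_on with
  | H y =>
  induction h using QuotientAddGroup.induction_on with
  | H s =>
    change ∃ k : ℤ, circleIndex N ((y : UnitAddCircle) + (s : UnitAddCircle)) =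
      circleIndex N (y : UnitAddCircle) + k ∧ |(k : ℝ)| ≤ N * ‖(s : UnitAddCircle)‖ + 1
    -- The representative nearest to zero is used because its absolute value is the norm on the
    -- circle.
    have hs : (s : UnitAddCircle) = ((s - round s : ℝ) : UnitAddCircle) := by
      rw [AddCircle.coe_sub, eq_comm, sub_eq_self, AddCircle.coe_eq_zero_iff]
      exact ⟨round s, by simp⟩
    rw [UnitAddCircle.norm_eq, hs]
    generalize s - round s = r
    refine ⟨⌊(N : ℝ) * (y + r) + 1 / 2⌋ - ⌊(N : ℝ) * y + 1 / 2⌋, ?_, ?_⟩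
    · rw [← AddCircle.coe_add, circleIndex_coe, circleIndex_coe]
      push_cast
      ring
    · have hN : (0 : ℝ) < N := by exact_mod_cast N.pos
      have hr : |(N : ℝ) * r| = N * |r| := by rw [abs_mul, abs_of_pos hN]
      have h1 := Int.floor_le ((N : ℝ) * (y + r) + 1 / 2)
      have h2 := Int.lt_floor_add_one ((N : ℝ) * (y + r) + 1 / 2)
      have h3 := Int.floor_le ((N : ℝ) * y + 1 / 2)
      have h4 := Int.lt_floor_add_one ((N : ℝ) * y + 1 / 2)
      have h5 := le_abs_self ((N : ℝ) * r)
      have h6 := neg_abs_le ((N : ℝ) * r)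
      push_cast
      rw [abs_le]
      constructor <;> nlinarith

lemma exists_mem_Ico_iff_circleIndex_eq (N : ℕ+) (x : ZMod N) (z : UnitAddCircle) :
    (∃ s ∈ Ico (-(1 / (2 * (N : ℝ)))) (1 / (2 * (N : ℝ))),
      z = ((((x.val : ℝ) / (N : ℝ) + s : ℝ)) : UnitAddCircle)) ↔ circleIndex N z = x := by
  have hN : (0 : ℝ) < N := by exact_mod_cast N.pos
  constructor
  · rintro ⟨s, hs, rfl⟩
    rw [circleIndex_coe]
    have : (N : ℝ) * ((x.val : ℝ) / N + s) + 1 / 2 = (N * s + 1 / 2) + ((x.val : ℤ) : ℝ) := by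
      push_cast
      field_simp
      ring
    rw [this, Int.floor_add_intCast]
    have h1 : -(1 / 2) ≤ (N : ℝ) * s := by
      have := mul_le_mul_of_nonneg_left hs.1 hN.le
      have h : (N : ℝ) * -(1 / (2 * (N : ℝ))) = -(1 / 2) := by field_simp
      linarith
    have h2 : (N : ℝ) * s < 1 / 2 := by
      have := mul_lt_mul_of_pos_left hs.2 hN
      have h : (N : ℝ) * (1 / (2 * (N : ℝ))) = 1 / 2 := by field_simp
      linarith
    have h3 : ⌊(N : ℝ) * s + 1 / 2⌋ = 0 := by
      rw [Int.floor_eq_zero_iff]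
      constructor <;> linarith
    rw [h3]
    simp
  · intro h
    induction z using QuotientAddGroup.induction_on with
    | H y =>
    change circleIndex N (y : UnitAddCircle) = x at h
    rw [circleIndex_coe] at h
    set m := ⌊(N : ℝ) * y + 1 / 2⌋ with hm
    have h' : ((m : ℤ) : ZMod N) = ((x.val : ℤ) : ZMod N) := by simp [h]
    rw [ZMod.intCast_eq_intCast_iff_dvd_sub] at h'
    obtain ⟨c, hc⟩ := h'
    have hc' : (x.val : ℝ) - m = N * c := by exact_mod_cast hc
    have h1 := Int.floor_le ((N : ℝ) * y + 1 / 2)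
    have h2 := Int.lt_floor_add_one ((N : ℝ) * y + 1 / 2)
    rw [← hm] at h1 h2
    refine ⟨y - m / N, ⟨?_, ?_⟩, ?_⟩
    · have : y - m / N - -(1 / (2 * (N : ℝ))) = ((N : ℝ) * y + 1 / 2 - m) / N := by field_simp; ring
      have h3 : 0 ≤ ((N : ℝ) * y + 1 / 2 - m) / N := div_nonneg (by linarith) hN.le
      linarith
    · have : 1 / (2 * (N : ℝ)) - (y - m / N) = (m + 1 - ((N : ℝ) * y + 1 / 2)) / N := by
        field_simp; ring
      have h3 : 0 < (m + 1 - ((N : ℝ) * y + 1 / 2)) / N := div_pos (by linarith) hN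
      linarith
    · have : (x.val : ℝ) / N + (y - m / N) = y + c := by
        have : (x.val : ℝ) = m + N * c := by linarith
        rw [this]
        field_simp
        ring
      rw [this, AddCircle.coe_add, eq_comm]
      change (y : UnitAddCircle) + _ = (y : UnitAddCircle)
      rw [add_eq_left, AddCircle.coe_eq_zero_iff]
      exact ⟨c, by simp⟩

variable {d : ℕ}

instance : IsProbabilityMeasure (volume : Measure UnitAddCircle) := ⟨by simp⟩

instance : IsProbabilityMeasure (volume : Measure (Torus d)) :=
  inferInstanceAs (IsProbabilityMeasure (Measure.pi fun _ => volume))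

/-- The index of the box that contains `z`. -/
def index (N : ℕ+) (z : Torus d) : Lattice d N := fun i => circleIndex N (z i)

/-- The point `x / N` of the torus. -/
def latticePoint (N : ℕ+) (x : Lattice d N) : Torus d :=
  fun i => ((((x i).val : ℝ) / (N : ℝ) : ℝ) : UnitAddCircle)

lemma measurable_index (N : ℕ+) : Measurable (index N : Torus d → Lattice d N) :=
  measurable_pi_lambda _ fun i => (measurable_circleIndex N).comp (measurable_pi_apply i)

lemma mem_cube_iff (N : ℕ+) (x : Lattice d N) (z : Torus d) : z ∈ cube N x ↔ index N z = x := by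
  simp only [cube, mem_ofPred_eq, index, funext_iff]
  exact forall_congr' fun i => exists_mem_Ico_iff_circleIndex_eq N (x i) (z i)

lemma index_add_latticePoint (N : ℕ+) (z : Torus d) (x : Lattice d N) :
    index N (z + latticePoint N x) = index N z + x := by
  funext i
  have := circleIndex_add_coe N (z i) ((x i).val : ℤ)
  simpa [index, latticePoint] using this

lemma exists_index_add (N : ℕ+) (z h : Torus d) :
    ∃ k : Fin d → ℤ, index N (z + h) = index N z + (fun i => (k i : ZMod N)) ∧
      ∀ i, |(k i : ℝ)| ≤ N * ‖h i‖ + 1 := by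
  choose k hk using fun i => exists_circleIndex_add N (z i) (h i)
  exact ⟨k, funext fun i => (hk i).1, fun i => (hk i).2⟩

lemma measurable_comp_index {β : Type*} [MeasurableSpace β] (N : ℕ+) (G : Lattice d N → β) :
    Measurable fun z : Torus d => G (index N z) :=
  (measurable_of_finite G).comp (measurable_index N)

lemma integrable_comp_index (N : ℕ+) (G : Lattice d N → ℝ) :
    Integrable fun z : Torus d => G (index N z) := by
  refine Integrable.of_bound (measurable_comp_index N G).aestronglyMeasurable
    (∑ x, ‖G x‖) (Eventually.of_forall fun z => ?_)
  exact Finset.single_le_sum (f := fun x => ‖G x‖) (fun x _ => norm_nonneg _)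
    (Finset.mem_univ (index N z))

/-- Translation by a lattice point preserves the integral and shifts the index. Summed over all
lattice translates, the integrand becomes constant, so the volumes of the boxes need not be
computed. -/
lemma integral_comp_index (N : ℕ+) (G : Lattice d N → ℝ) :
    ∫ z : Torus d, G (index N z) = ((N : ℝ) ^ d)⁻¹ * ∑ x, G x := by
  have key : ∀ x : Lattice d N,
      ∫ z : Torus d, G (index N z) = ∫ z : Torus d, G (index N z + x) := by
    intro x
    rw [← integral_add_right_eq_self _ (latticePoint N x)]
    simp_rw [index_add_latticePoint]
  have hsum : (N : ℝ) ^ d * ∫ z : Torus d, G (index N z) = ∑ x, G x := by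
    calc (N : ℝ) ^ d * ∫ z : Torus d, G (index N z)
        = ∑ x : Lattice d N, ∫ z : Torus d, G (index N z) := by
          simp [Finset.sum_const, nsmul_eq_mul, ZMod.card]
      _ = ∑ x : Lattice d N, ∫ z : Torus d, G (index N z + x) := Finset.sum_congr rfl fun x _ => key x
      _ = ∫ z : Torus d, ∑ x : Lattice d N, G (index N z + x) := by
          rw [integral_finsetSum]
          intro x _
          exact integrable_comp_index N fun y => G (y + x)
      _ = ∫ z : Torus d, ∑ x : Lattice d N, G x := by
          refine integral_congr_ae (Eventually.of_forall fun z => ?_)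
          exact Fintype.sum_equiv (Equiv.addLeft (index N z)) _ _ fun x => rfl
      _ = ∑ x, G x := by simp
  have h0 : (N : ℝ) ^ d ≠ 0 := pow_ne_zero _ (by exact_mod_cast N.ne_zero)
  rw [← hsum, ← mul_assoc, inv_mul_cancel₀ h0, one_mul]

/-! ### Configurations -/

lemma measurableSet_cube (N : ℕ+) (x : Lattice d N) : MeasurableSet (cube N x) := by
  have : cube N x = index N ⁻¹' {x} := by
    ext z
    simp [mem_cube_iff]
  rw [this]
  exact measurable_index N (measurableSet_singleton x)

lemma coe_nonneg (f : L1Pos d) : ∀ᵐ z, 0 ≤ f z := by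
  have := (Lp.coeFn_nonneg f.1).2 f.2
  filter_upwards [this] with z hz using hz

lemma integrable_coe (f : L1Pos d) : Integrable f := L1.integrable_coeFn f.1

lemma siteValue_nonneg (N : ℕ+) (f : L1Pos d) (x : Lattice d N) : 0 ≤ siteValue N f x :=
  mul_nonneg (by positivity) (integral_nonneg_of_ae (ae_restrict_of_ae (coe_nonneg f)))

lemma ae_eq_siteValue {χ : ℝ} {N : ℕ+} {f : L1Pos d} (hf : f ∈ configurations d χ N) :
    f =ᵐ[volume] fun z => siteValue N f (index N z) := by
  obtain ⟨k, hk⟩ := hf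
  have hae : f =ᵐ[volume] fun z => χ * k (index N z) := by
    filter_upwards [ae_all_iff.2 hk] with z hz
    exact hz _ ((mem_cube_iff N _ z).2 rfl)
  have hv : ∀ x, siteValue N f x = χ * k x := by
    intro x
    have h1 : ∫ z in cube N x, f z =
        ∫ z : Torus d, (fun y : Lattice d N => if y = x then χ * k x else 0) (index N z) := by
      rw [← integral_indicator (measurableSet_cube N x)]
      refine integral_congr_ae ?_
      filter_upwards [hae] with z hz
      by_cases h : index N z = x
      · rw [indicator_of_mem ((mem_cube_iff N x z).2 h), hz]
        simp [h]
      · rw [indicator_of_notMem (fun h' => h ((mem_cube_iff N x z).1 h'))]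
        simp [h]
    have hN : (N : ℝ) ^ d ≠ 0 := pow_ne_zero _ (by exact_mod_cast N.ne_zero)
    rw [siteValue, h1, integral_comp_index N fun y => if y = x then χ * k x else 0]
    simp [hN]
  filter_upwards [hae] with z hz
  rw [hz, hv]

/-- The sum of the squared increments `N² (V(x + e_i) - V(x))²`, averaged over the lattice. -/
def dirichletSum (N : ℕ+) (V : Lattice d N → ℝ) : ℝ :=
  ((N : ℝ) ^ d)⁻¹ * ∑ x, ∑ i, ((N : ℝ) * (V (x + Pi.single i 1) - V x)) ^ 2

/-- The factor d times the kernel gives each direction weight 1/2, and every edge is seen from both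
its ends; the power N^{-(d-2)} splits into the averaging factor N^{-d} and the N² of the squared
difference quotients. -/
lemma discreteDissipation_eq [NeZero d] (α : ℝ) (N : ℕ+) (f : L1Pos d) :
    discreteDissipation α N f = α⁻¹ * dirichletSum N (fun x => siteValue N f x ^ (α / 2)) := by
  have hd : (d : ℝ) ≠ 0 := by exact_mod_cast NeZero.ne d
  have hN : (N : ℝ) ≠ 0 := by exact_mod_cast N.ne_zero
  unfold discreteDissipation dirichletSum kernel
  generalize hV : (fun x => siteValue N f x ^ (α / 2)) = V
  have hV' : ∀ x, siteValue N f x ^ (α / 2) = V x := fun x => congrFun hV x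
  simp_rw [hV']
  have h1 : ∀ x y : Lattice d N, (V x - V y) ^ 2 * ((d : ℝ) * (1 / (2 * (d : ℝ)) *
      ∑ i, ((if y = x + Pi.single i 1 then 1 else 0) + (if y = x - Pi.single i 1 then 1 else 0)))) =
      2⁻¹ * ∑ i, ((if y = x + Pi.single i 1 then (V x - V y) ^ 2 else 0)
        + (if y = x - Pi.single i 1 then (V x - V y) ^ 2 else 0)) := by
    intro x y
    have : ∀ s : ℝ, (V x - V y) ^ 2 * ((d : ℝ) * (1 / (2 * (d : ℝ)) * s)) =
        2⁻¹ * ((V x - V y) ^ 2 * s) := by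
      intro s
      field_simp
    rw [this, Finset.mul_sum]
    congr 1
    refine Finset.sum_congr rfl fun i _ => ?_
    rw [mul_add, mul_ite, mul_ite, mul_one, mul_zero]
  have h2 : ∀ x : Lattice d N, ∑ y : Lattice d N, 2⁻¹ * ∑ i,
      ((if y = x + Pi.single i 1 then (V x - V y) ^ 2 else 0)
        + (if y = x - Pi.single i 1 then (V x - V y) ^ 2 else 0)) =
      2⁻¹ * ∑ i, ((V x - V (x + Pi.single i 1)) ^ 2 + (V x - V (x - Pi.single i 1)) ^ 2) := by
    intro x
    rw [← Finset.mul_sum, Finset.sum_comm]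
    congr 1
    refine Finset.sum_congr rfl fun i _ => ?_
    rw [Finset.sum_add_distrib]
    simp
  have h3 : ∀ i : Fin d, ∑ x : Lattice d N, (V x - V (x - Pi.single i 1)) ^ 2 =
      ∑ x : Lattice d N, (V (x + Pi.single i 1) - V x) ^ 2 := fun i =>
    Fintype.sum_equiv (Equiv.subRight (Pi.single i 1)) _ _ fun x => by simp
  have h4 : ∑ x : Lattice d N, 2⁻¹ * ∑ i, ((V x - V (x + Pi.single i 1)) ^ 2
      + (V x - V (x - Pi.single i 1)) ^ 2) =
      ∑ x : Lattice d N, ∑ i, (V (x + Pi.single i 1) - V x) ^ 2 := by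
    rw [← Finset.mul_sum, Finset.sum_comm, Finset.mul_sum]
    conv_rhs => rw [Finset.sum_comm]
    refine Finset.sum_congr rfl fun i _ => ?_
    have h5 : ∑ x : Lattice d N, (V x - V (x + Pi.single i 1)) ^ 2 =
        ∑ x : Lattice d N, (V (x + Pi.single i 1) - V x) ^ 2 :=
      Finset.sum_congr rfl fun x _ => sub_sq_comm _ _
    rw [Finset.sum_add_distrib, h3, h5]
    ring
  simp_rw [h1, h2, h4, mul_pow, ← Finset.mul_sum]
  rw [zpow_sub₀ hN, zpow_natCast]
  norm_cast
  field_simp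

/-! ### Discrete Sobolev inequality -/

lemma lintegral_comp_circleIndex (N : ℕ+) (G : ZMod N → ℝ≥0∞) :
    ∫⁻ s : UnitAddCircle, G (circleIndex N s) = (N : ℝ≥0∞)⁻¹ * ∑ k, G k := by
  have hm : ∀ G : ZMod N → ℝ≥0∞, Measurable fun s => G (circleIndex N s) := fun G =>
    (measurable_of_finite G).comp (measurable_circleIndex N)
  have key : ∀ k : ZMod N, ∫⁻ s : UnitAddCircle, G (circleIndex N s) =
      ∫⁻ s : UnitAddCircle, G (circleIndex N s + k) := by
    intro k
    rw [← lintegral_add_right_eq_self _ ((((k.val : ℤ) : ℝ) / (N : ℝ) : ℝ) : UnitAddCircle)]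
    simp_rw [circleIndex_add_coe]
    simp
  have hsum : (N : ℝ≥0∞) * ∫⁻ s : UnitAddCircle, G (circleIndex N s) = ∑ k, G k := by
    calc (N : ℝ≥0∞) * ∫⁻ s : UnitAddCircle, G (circleIndex N s)
        = ∑ k : ZMod N, ∫⁻ s : UnitAddCircle, G (circleIndex N s) := by
          simp [Finset.sum_const, nsmul_eq_mul, ZMod.card]
      _ = ∑ k : ZMod N, ∫⁻ s : UnitAddCircle, G (circleIndex N s + k) :=
          Finset.sum_congr rfl fun k _ => key k
      _ = ∫⁻ s : UnitAddCircle, ∑ k : ZMod N, G (circleIndex N s + k) := by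
          rw [lintegral_finsetSum]
          intro k _
          exact hm fun y => G (y + k)
      _ = ∫⁻ s : UnitAddCircle, ∑ k : ZMod N, G k := by
          refine lintegral_congr fun s => ?_
          exact Fintype.sum_equiv (Equiv.addLeft (circleIndex N s)) _ _ fun x => rfl
      _ = ∑ k, G k := by simp
  have h0 : (N : ℝ≥0∞) ≠ 0 := by exact_mod_cast N.ne_zero
  rw [← hsum, ← mul_assoc, ENNReal.inv_mul_cancel h0 (ENNReal.natCast_ne_top _), one_mul]

/-- Telescoping along b, b + 1, …, a: this path has fewer than N steps, so it uses each edge of the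
cycle at most once. -/
lemma le_add_sum_abs_sub (N : ℕ+) (g : ZMod N → ℝ) (a b : ZMod N) :
    g a ≤ g b + ∑ k, |g (k + 1) - g k| := by
  set n := (a - b).val with hn
  have hnN : n < N := ZMod.val_lt _
  have ha : b + (n : ZMod N) = a := by simp [hn]
  have h1 : g a - g b = ∑ j ∈ Finset.range n, (g (b + ((j + 1 : ℕ) : ZMod N)) - g (b + (j : ZMod N))) := by
    rw [Finset.sum_range_sub (fun j : ℕ => g (b + (j : ZMod N)))]
    simp [ha]
  have hinj : Set.InjOn (fun j : ℕ => b + (j : ZMod N)) (Finset.range n : Finset ℕ) := by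
    intro i hi j hj hij
    simp only [Finset.coe_range, mem_Iio] at hi hj
    have h2 : (i : ZMod N) = j := add_left_cancel hij
    have h3 := congrArg ZMod.val h2
    rwa [ZMod.val_cast_of_lt (hi.trans hnN), ZMod.val_cast_of_lt (hj.trans hnN)] at h3
  have h2 : ∑ j ∈ Finset.range n, |g (b + ((j + 1 : ℕ) : ZMod N)) - g (b + (j : ZMod N))| ≤
      ∑ k, |g (k + 1) - g k| := by
    have := Finset.sum_image (s := Finset.range n) (g := fun j : ℕ => b + (j : ZMod N))
      (f := fun k => |g (k + 1) - g k|) hinj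
    calc ∑ j ∈ Finset.range n, |g (b + ((j + 1 : ℕ) : ZMod N)) - g (b + (j : ZMod N))|
        = ∑ k ∈ (Finset.range n).image (fun j : ℕ => b + (j : ZMod N)), |g (k + 1) - g k| := by
          rw [this]
          simp [add_assoc]
      _ ≤ _ := Finset.sum_le_sum_of_subset_of_nonneg (Finset.subset_univ _)
          fun _ _ _ => abs_nonneg _
  have h3 := Finset.sum_le_sum (s := Finset.range n) fun j _ =>
    le_abs_self (g (b + ((j + 1 : ℕ) : ZMod N)) - g (b + (j : ZMod N)))
  linarith

/-- The sum of the increments `N |W(x + e_i) - W(x)|`, averaged over the lattice. -/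
def bvSum (N : ℕ+) (W : Lattice d N → ℝ) : ℝ :=
  ((N : ℝ) ^ d)⁻¹ * ∑ x, ∑ i, (N : ℝ) * |W (x + Pi.single i 1) - W x|

lemma bvSum_nonneg (N : ℕ+) (W : Lattice d N → ℝ) : 0 ≤ bvSum N W := by
  unfold bvSum
  positivity

lemma dirichletSum_nonneg (N : ℕ+) (V : Lattice d N → ℝ) : 0 ≤ dirichletSum N V := by
  unfold dirichletSum
  positivity

/-- On a line in direction i, a value is at most the mean plus the total variation: average
`le_add_sum_abs_sub` over the base point. The integrand contains the increments in all directions,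
although only the i-th is needed, so that one function serves every direction in the Gagliardo
argument. -/
lemma ofReal_le_lintegral_update (N : ℕ+) (W : Lattice d N → ℝ) (hW : ∀ x, 0 ≤ W x)
    (z : Torus d) (i : Fin d) :
    ENNReal.ofReal (W (index N z)) ≤ ∫⁻ s : UnitAddCircle,
      ENNReal.ofReal ((fun x => W x + ∑ j, (N : ℝ) * |W (x + Pi.single j 1) - W x|)
        (index N (Function.update z i s))) := by
  set g : ZMod N → ℝ := fun k => W (Function.update (index N z) i k) with hg
  have hN : (0 : ℝ) < N := by exact_mod_cast N.pos
  have hidx : ∀ s, index N (Function.update z i s) =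
      Function.update (index N z) i (circleIndex N s) := by
    intro s
    funext j
    by_cases h : j = i
    · subst h
      simp [index]
    · simp [index, h]
  have hge : ∀ s, ENNReal.ofReal (g (circleIndex N s) +
      N * |g (circleIndex N s + 1) - g (circleIndex N s)|) ≤
      ENNReal.ofReal ((fun x => W x + ∑ j, (N : ℝ) * |W (x + Pi.single j 1) - W x|)
        (index N (Function.update z i s))) := by
    intro s
    refine ENNReal.ofReal_le_ofReal ?_
    rw [hidx]
    have h1 : g (circleIndex N s + 1) =
        W (Function.update (index N z) i (circleIndex N s) + Pi.single i 1) := by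
      simp only [hg]
      congr 1
      funext j
      by_cases h : j = i
      · subst h
        simp
      · simp [h]
    rw [h1]
    have := Finset.single_le_sum (s := Finset.univ) (f := fun j => (N : ℝ) *
      |W (Function.update (index N z) i (circleIndex N s) + Pi.single j 1) -
        W (Function.update (index N z) i (circleIndex N s))|)
      (fun j _ => by positivity) (Finset.mem_univ i)
    simp only [hg]
    linarith
  refine le_trans ?_ (lintegral_mono hge)
  rw [lintegral_comp_circleIndex N fun k => ENNReal.ofReal (g k + N * |g (k + 1) - g k|),
    ← ENNReal.ofReal_sum_of_nonneg fun k _ => add_nonneg (hW _) (by positivity)]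
  have h2 : (N : ℝ≥0∞)⁻¹ = ENNReal.ofReal ((N : ℝ)⁻¹) := by
    rw [ENNReal.ofReal_inv_of_pos hN]
    simp
  rw [h2, ← ENNReal.ofReal_mul (by positivity)]
  refine ENNReal.ofReal_le_ofReal ?_
  rw [inv_mul_eq_div, le_div_iff₀ hN, Finset.sum_add_distrib, ← Finset.mul_sum]
  have h3 : W (index N z) = g (index N z i) := by simp [hg]
  have h4 := Finset.sum_le_sum (s := Finset.univ) fun b (_ : b ∈ Finset.univ) =>
    le_add_sum_abs_sub N g (index N z i) b
  rw [Finset.sum_add_distrib] at h4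
  simp only [Finset.sum_const, Finset.card_univ, ZMod.card, nsmul_eq_mul] at h4
  rw [h3]
  linarith

/-- The Gagliardo–Nirenberg argument on lines parallel to the axes. The parameter p = 1/d, in place
of the optimal 1/(d-1), covers d = 1 as well. It leaves a factor with exponent 1 - (d-1)/d = 1/d,
which is bounded pointwise, next to the d factors bounded by line integrals. -/
lemma lintegral_rpow_le_bvSum [NeZero d] (N : ℕ+) (W : Lattice d N → ℝ) (hW : ∀ x, 0 ≤ W x) :
    ∫⁻ z : Torus d, ENNReal.ofReal (W (index N z)) ^ (1 + 1 / (d : ℝ)) ≤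
      ENNReal.ofReal ((∫ z : Torus d, W (index N z)) + bvSum N W) ^ (1 + 1 / (d : ℝ)) := by
  have hd : (0 : ℝ) < d := by exact_mod_cast Nat.pos_of_ne_zero (NeZero.ne d)
  set G : Lattice d N → ℝ := fun x => W x + ∑ j, (N : ℝ) * |W (x + Pi.single j 1) - W x| with hG
  have hG0 : ∀ x, 0 ≤ G x := fun x => add_nonneg (hW x) (by positivity)
  have hint : ∫⁻ z : Torus d, ENNReal.ofReal (G (index N z)) =
      ENNReal.ofReal ((∫ z : Torus d, W (index N z)) + bvSum N W) := by
    rw [← ofReal_integral_eq_lintegral_ofReal (integrable_comp_index N G)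
      (Eventually.of_forall fun z => hG0 _), integral_comp_index N G, integral_comp_index, bvSum,
      ← mul_add, ← Finset.sum_add_distrib]
  rw [← hint]
  have hp : ((Fintype.card (Fin d) : ℝ) - 1) * (1 / (d : ℝ)) ≤ 1 := by
    rw [Fintype.card_fin, mul_one_div, div_le_one hd]
    linarith
  have key := lintegral_mul_prod_lintegral_pow_le (fun _ : Fin d => (volume : Measure UnitAddCircle))
    (p := 1 / (d : ℝ)) (by positivity) hp
    (f := fun z => ENNReal.ofReal (G (index N z)))
    (measurable_comp_index N fun x => ENNReal.ofReal (G x))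
  refine le_trans (lintegral_mono fun z => ?_) key
  have h1 : (0 : ℝ) ≤ 1 - ((Fintype.card (Fin d) : ℝ) - 1) * (1 / (d : ℝ)) := by linarith
  calc ENNReal.ofReal (W (index N z)) ^ (1 + 1 / (d : ℝ))
      = ENNReal.ofReal (W (index N z)) ^ (1 - ((Fintype.card (Fin d) : ℝ) - 1) * (1 / (d : ℝ))) *
        ∏ _i : Fin d, ENNReal.ofReal (W (index N z)) ^ (1 / (d : ℝ)) := by
        rw [Finset.prod_const, ← ENNReal.rpow_natCast, ← ENNReal.rpow_mul,
          ← ENNReal.rpow_add_of_nonneg _ _ h1 (by positivity)]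
        congr 1
        simp only [Finset.card_univ, Fintype.card_fin]
        field_simp
        ring
    _ ≤ _ := by
        refine mul_le_mul' (ENNReal.rpow_le_rpow (ENNReal.ofReal_le_ofReal ?_) h1)
          (Finset.prod_le_prod' fun i _ => ENNReal.rpow_le_rpow ?_ (by positivity))
        · simp only [hG]
          have : 0 ≤ ∑ j, (N : ℝ) * |W (index N z + Pi.single j 1) - W (index N z)| := by positivity
          linarith
        · exact ofReal_le_lintegral_update N W hW z i

lemma bvSum_rpow_le (N : ℕ+) (F : Lattice d N → ℝ) (hF : ∀ x, 0 ≤ F x) (α : ℝ) :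
    bvSum N (fun x => F x ^ α) ≤ 2⁻¹ * dirichletSum N (fun x => F x ^ (α / 2)) +
      2 * d * ∫ z : Torus d, F (index N z) ^ α := by
  have hsq : ∀ x, F x ^ α = (F x ^ (α / 2)) ^ 2 := by
    intro x
    rw [← Real.rpow_natCast, ← Real.rpow_mul (hF x)]
    congr 1
    push_cast
    ring
  rw [integral_comp_index N fun x => F x ^ α]
  simp_rw [hsq]
  set V : Lattice d N → ℝ := fun x => F x ^ (α / 2)
  unfold bvSum dirichletSum
  -- Young's inequality for the product of N(a - b) and a + b, followed by (a + b)²/2 ≤ a² + b².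
  have hpt : ∀ x i, (N : ℝ) * |V (x + Pi.single i 1) ^ 2 - V x ^ 2| ≤
      2⁻¹ * ((N : ℝ) * (V (x + Pi.single i 1) - V x)) ^ 2 +
        (V (x + Pi.single i 1) ^ 2 + V x ^ 2) := by
    intro x i
    generalize V (x + Pi.single i 1) = a
    generalize V x = b
    have hN : (0 : ℝ) ≤ N := by positivity
    rw [show (N : ℝ) * |a ^ 2 - b ^ 2| = |(N * (a - b)) * (a + b)| by
      rw [← abs_of_nonneg hN, ← abs_mul, abs_of_nonneg hN]; ring_nf]
    rw [abs_le]
    constructor <;> nlinarith [sq_nonneg (N * (a - b) - (a + b)), sq_nonneg (N * (a - b) + (a + b)),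
      sq_nonneg (a - b)]
  have hs : ∑ x : Lattice d N, ∑ i : Fin d, (V (x + Pi.single i 1) ^ 2 + V x ^ 2) =
      2 * d * ∑ x, V x ^ 2 := by
    rw [Finset.sum_comm]
    have : ∀ i : Fin d, ∑ x : Lattice d N, V (x + Pi.single i 1) ^ 2 = ∑ x, V x ^ 2 := fun i =>
      Fintype.sum_equiv (Equiv.addRight (Pi.single i 1)) _ _ fun x => rfl
    simp_rw [Finset.sum_add_distrib, this]
    simp
    ring
  have hsum : ∑ x : Lattice d N, ∑ i : Fin d, (N : ℝ) * |V (x + Pi.single i 1) ^ 2 - V x ^ 2| ≤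
      2⁻¹ * (∑ x : Lattice d N, ∑ i : Fin d, ((N : ℝ) * (V (x + Pi.single i 1) - V x)) ^ 2) +
        2 * d * ∑ x, V x ^ 2 := by
    rw [← hs, Finset.mul_sum, ← Finset.sum_add_distrib]
    refine Finset.sum_le_sum fun x _ => ?_
    rw [Finset.mul_sum, ← Finset.sum_add_distrib]
    exact Finset.sum_le_sum fun i _ => hpt x i
  have hc : (0 : ℝ) ≤ ((N : ℝ) ^ d)⁻¹ := by positivity
  have := mul_le_mul_of_nonneg_left hsum hc
  linarith

/-! ### Integrability gain and absorption -/

/-- The integrability exponent gained from the dissipation bound. -/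
def gainExponent (d : ℕ) (α : ℝ) : ℝ := α + 1 / ((d : ℝ) + 1)

/-- Hölder's inequality with weights 1/(d+1) and d/(d+1) between F and F^{α(1+1/d)}. The second
weight cancels the exponent 1 + 1/d, so the Sobolev bound enters linearly. -/
lemma integral_rpow_gainExponent_le [NeZero d] (N : ℕ+) (F : Lattice d N → ℝ) (hF : ∀ x, 0 ≤ F x)
    {α : ℝ} (hα : 1 ≤ α) :
    ∫ z : Torus d, F (index N z) ^ gainExponent d α ≤
      (∫ z : Torus d, F (index N z)) ^ (1 / ((d : ℝ) + 1)) *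
        ((∫ z : Torus d, F (index N z) ^ α) + bvSum N fun x => F x ^ α) := by
  have hd : (0 : ℝ) < d := by exact_mod_cast Nat.pos_of_ne_zero (NeZero.ne d)
  have hWα : ∀ x, 0 ≤ F x ^ α := fun x => Real.rpow_nonneg (hF x) _
  have hA : 0 ≤ (∫ z : Torus d, F (index N z) ^ α) + bvSum N fun x => F x ^ α :=
    add_nonneg (integral_nonneg fun z => hWα _) (bvSum_nonneg _ _)
  have hm : 0 ≤ ∫ z : Torus d, F (index N z) := integral_nonneg fun z => hF _
  have key := ENNReal.lintegral_mul_norm_pow_le (μ := (volume : Measure (Torus d)))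
    (f := fun z => ENNReal.ofReal (F (index N z)))
    (g := fun z => ENNReal.ofReal (F (index N z) ^ α) ^ (1 + 1 / (d : ℝ)))
    (p := 1 / ((d : ℝ) + 1)) (q := d / ((d : ℝ) + 1))
    (measurable_comp_index N fun x => ENNReal.ofReal (F x)).aemeasurable
    (measurable_comp_index N fun x => ENNReal.ofReal (F x ^ α) ^ (1 + 1 / (d : ℝ))).aemeasurable
    (by positivity) (by positivity) (by field_simp; ring)
  have hq : (1 + 1 / (d : ℝ)) * (d / ((d : ℝ) + 1)) = 1 := by field_simp
  have hsob := ENNReal.rpow_le_rpow (lintegral_rpow_le_bvSum N (fun x => F x ^ α) hWα)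
    (show 0 ≤ d / ((d : ℝ) + 1) by positivity)
  rw [← ENNReal.rpow_mul, hq, ENNReal.rpow_one] at hsob
  rw [← ENNReal.ofReal_le_ofReal_iff (by positivity), ENNReal.ofReal_mul (by positivity),
    ← ENNReal.ofReal_rpow_of_nonneg hm (by positivity),
    ofReal_integral_eq_lintegral_ofReal (integrable_comp_index N fun x => F x ^ gainExponent d α)
      (Eventually.of_forall fun z => Real.rpow_nonneg (hF _) _)]
  calc ∫⁻ z : Torus d, ENNReal.ofReal (F (index N z) ^ gainExponent d α)
      = ∫⁻ z : Torus d, ENNReal.ofReal (F (index N z)) ^ (1 / ((d : ℝ) + 1)) *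
        (ENNReal.ofReal (F (index N z) ^ α) ^ (1 + 1 / (d : ℝ))) ^ (d / ((d : ℝ) + 1)) := by
        refine lintegral_congr fun z => ?_
        rw [← ENNReal.rpow_mul, hq, ENNReal.rpow_one,
          ENNReal.ofReal_rpow_of_nonneg (hF _) (by positivity),
          ← ENNReal.ofReal_mul (Real.rpow_nonneg (hF _) _),
          ← Real.rpow_add_of_nonneg (hF _) (by positivity) (by linarith), gainExponent, add_comm]
    _ ≤ _ := key
    _ ≤ _ := by
        rw [ofReal_integral_eq_lintegral_ofReal (integrable_comp_index N F)
          (Eventually.of_forall fun z => hF _)]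
        gcongr

lemma rpow_le_mul_rpow_add (d : ℕ) {α δ x : ℝ} (hα : 1 ≤ α) (hδ : 0 < δ) (hx : 0 ≤ x) :
    x ^ α ≤ δ * x ^ gainExponent d α + (δ⁻¹ ^ ((d : ℝ) + 1)) ^ (α - 1) * x := by
  have hd : (0 : ℝ) < (d : ℝ) + 1 := by positivity
  -- At this threshold x^{1/(d+1)} equals δ⁻¹: above it the gained power absorbs x^α, below it
  -- x^{α-1} is bounded.
  set R : ℝ := δ⁻¹ ^ ((d : ℝ) + 1) with hR
  have hR0 : 0 < R := by positivity
  rcases le_total R x with h | h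
  · have hx0 : 0 < x := hR0.trans_le h
    have h1 : δ⁻¹ ≤ x ^ (1 / ((d : ℝ) + 1)) := by
      have := Real.rpow_le_rpow hR0.le h (show 0 ≤ 1 / ((d : ℝ) + 1) by positivity)
      rwa [hR, ← Real.rpow_mul (by positivity), mul_one_div_cancel hd.ne', Real.rpow_one] at this
    have h2 : 1 ≤ δ * x ^ (1 / ((d : ℝ) + 1)) := by
      have := mul_le_mul_of_nonneg_left h1 hδ.le
      rwa [mul_inv_cancel₀ hδ.ne'] at this
    have h3 : 0 ≤ R ^ (α - 1) * x := by positivity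
    rw [gainExponent, Real.rpow_add hx0]
    nlinarith [Real.rpow_nonneg hx α]
  · have h1 : x ^ α = x ^ (α - 1) * x := by
      conv_lhs => rw [show α = (α - 1) + 1 by ring]
      rw [Real.rpow_add_of_nonneg hx (by linarith) zero_le_one, Real.rpow_one]
    have h2 : x ^ (α - 1) ≤ R ^ (α - 1) := Real.rpow_le_rpow hx h (by linarith)
    have h3 : 0 ≤ δ * x ^ gainExponent d α := by positivity
    rw [h1]
    nlinarith

/-- The integrability gain bounds the β-integral by the α-integral and the Dirichlet sum, and
interpolation with the mass bounds the α-integral by a small multiple of the β-integral plus a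
constant. Substituting the second bound into the first closes the estimate. -/
lemma exists_static_bound (d : ℕ) [NeZero d] {α : ℝ} (hα : 1 ≤ α) (M : ℝ) :
    ∃ C : ℝ, 0 ≤ C ∧ ∀ (N : ℕ+) (F : Lattice d N → ℝ), (∀ x, 0 ≤ F x) →
      ∫ z : Torus d, F (index N z) ≤ M →
      ∫ z : Torus d, F (index N z) ^ gainExponent d α ≤
          C * (1 + dirichletSum N fun x => F x ^ (α / 2)) ∧
        ∫ z : Torus d, F (index N z) ^ α ≤ C * (1 + dirichletSum N fun x => F x ^ (α / 2)) ∧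
        bvSum N (fun x => F x ^ α) ≤ C * (1 + dirichletSum N fun x => F x ^ (α / 2)) := by
  set A : ℝ := |M| ^ (1 / ((d : ℝ) + 1)) with hA
  have hA0 : 0 ≤ A := by positivity
  -- Small enough that A(1 + 2d)δ ≤ 1/2, so half of the β-integral can be absorbed. The added 1
  -- keeps δ positive and at most 1 even when A = 0.
  set δ : ℝ := (2 * (A * (1 + 2 * d) + 1))⁻¹ with hδ
  have hδ0 : 0 < δ := by positivity
  have hδ1 : A * (1 + 2 * d) * δ ≤ 2⁻¹ := by
    rw [hδ, ← div_eq_mul_inv, div_le_iff₀ (by positivity)]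
    nlinarith
  have hδ2 : δ ≤ 1 := by
    rw [hδ]
    refine inv_le_one_of_one_le₀ ?_
    nlinarith [show 0 ≤ A * (1 + 2 * d) by positivity]
  set K : ℝ := (δ⁻¹ ^ ((d : ℝ) + 1)) ^ (α - 1) * |M| with hK
  have hK0 : 0 ≤ K := by positivity
  set B : ℝ := 2 * (A * (1 + 2 * d) * K + A) with hB
  have hB0 : 0 ≤ B := by positivity
  refine ⟨(1 + 2 * d) * (B + K) + 1, by positivity, fun N F hF hM => ?_⟩
  set D := dirichletSum N fun x => F x ^ (α / 2)
  have hD : 0 ≤ D := dirichletSum_nonneg _ _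
  set Iα := ∫ z : Torus d, F (index N z) ^ α with hIα
  set Iβ := ∫ z : Torus d, F (index N z) ^ gainExponent d α with hIβ
  have hm : 0 ≤ ∫ z : Torus d, F (index N z) := integral_nonneg fun z => hF _
  have hIβ0 : 0 ≤ Iβ := integral_nonneg fun z => Real.rpow_nonneg (hF _) _
  have hIα0 : 0 ≤ Iα := integral_nonneg fun z => Real.rpow_nonneg (hF _) _
  have h1 := integral_rpow_gainExponent_le N F hF hα
  have h2 := bvSum_rpow_le N F hF α
  have h3 : Iα ≤ δ * Iβ + K := by
    have h4 : Iα ≤ ∫ z : Torus d, (δ * F (index N z) ^ gainExponent d α +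
        (δ⁻¹ ^ ((d : ℝ) + 1)) ^ (α - 1) * F (index N z)) :=
      integral_mono (integrable_comp_index N fun x => F x ^ α)
        (((integrable_comp_index N fun x => F x ^ gainExponent d α).const_mul _).add
          ((integrable_comp_index N F).const_mul _))
        fun z => rpow_le_mul_rpow_add d hα hδ0 (hF _)
    rw [integral_add ((integrable_comp_index N fun x => F x ^ gainExponent d α).const_mul _)
      ((integrable_comp_index N F).const_mul _), integral_const_mul, integral_const_mul] at h4
    refine h4.trans (add_le_add le_rfl ?_)
    exact mul_le_mul_of_nonneg_left (hM.trans (le_abs_self M)) (by positivity)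
  have h5 : (∫ z : Torus d, F (index N z)) ^ (1 / ((d : ℝ) + 1)) ≤ A :=
    Real.rpow_le_rpow hm (hM.trans (le_abs_self M)) (by positivity)
  have hbv0 := bvSum_nonneg N fun x => F x ^ α
  have h6 : Iβ ≤ A * ((1 + 2 * d) * Iα + 2⁻¹ * D) := by
    refine h1.trans (mul_le_mul h5 ?_ (add_nonneg hIα0 hbv0) hA0)
    linarith
  have h7 : Iβ ≤ B * (1 + D) := by
    have h8 : A * ((1 + 2 * d) * Iα + 2⁻¹ * D) ≤
        A * ((1 + 2 * d) * (δ * Iβ + K) + 2⁻¹ * D) := by gcongr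
    have h9 : A * (1 + 2 * d) * δ * Iβ ≤ 2⁻¹ * Iβ := mul_le_mul_of_nonneg_right hδ1 hIβ0
    have h10 : 0 ≤ A * (1 + 2 * d) * K * D := by positivity
    have h11 : 0 ≤ A * D := by positivity
    nlinarith
  have h8 : Iα ≤ (B + K) * (1 + D) := by
    have : δ * Iβ ≤ Iβ := by nlinarith
    nlinarith [mul_nonneg hK0 hD]
  have hdd : (0 : ℝ) ≤ d := by positivity
  refine ⟨?_, ?_, ?_⟩
  · have : B ≤ (1 + 2 * d) * (B + K) + 1 := by nlinarith [mul_nonneg hdd (add_nonneg hB0 hK0)]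
    exact h7.trans (by gcongr)
  · have : B + K ≤ (1 + 2 * d) * (B + K) + 1 := by nlinarith [mul_nonneg hdd (add_nonneg hB0 hK0)]
    exact h8.trans (by gcongr)
  · have h9 := mul_le_mul_of_nonneg_left h8 hdd
    nlinarith [mul_nonneg (add_nonneg hB0 hK0) (add_nonneg zero_le_one hD)]

/-! ### Translations and mollification -/

/-- The L¹ modulus of continuity, as a function of the shift, is even and subadditive on the lattice
group, and every shift is an integer combination of unit vectors. -/
lemma sum_abs_shift_le (N : ℕ+) (W : Lattice d N → ℝ) (k : Fin d → ℤ) :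
    ∑ x : Lattice d N, |W (x + fun i => (k i : ZMod N)) - W x| ≤
      ∑ i, |(k i : ℝ)| * ∑ x : Lattice d N, |W (x + Pi.single i 1) - W x| := by
  set S : Lattice d N → ℝ := fun y => ∑ x : Lattice d N, |W (x + y) - W x| with hS
  have hS0 : S 0 = 0 := by simp [hS]
  have hadd : ∀ y y', S (y + y') ≤ S y + S y' := by
    intro y y'
    have h1 : S y' = ∑ x : Lattice d N, |W (x + y + y') - W (x + y)| :=
      (Fintype.sum_equiv (Equiv.addRight y) _ _ fun x => rfl).symm
    rw [h1]
    simp only [hS]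
    rw [← Finset.sum_add_distrib]
    refine Finset.sum_le_sum fun x _ => ?_
    have := abs_sub_le (W (x + y + y')) (W (x + y)) (W x)
    rw [← add_assoc]
    linarith
  have hneg : ∀ y, S (-y) = S y := by
    intro y
    refine Fintype.sum_equiv (Equiv.subRight y) _ _ fun x => ?_
    simp only [Equiv.subRight_apply, sub_add_cancel, ← sub_eq_add_neg]
    exact abs_sub_comm _ _
  have hnsmul : ∀ (n : ℕ) y, S (n • y) ≤ n * S y := by
    intro n y
    induction n with
    | zero => simp [hS0]
    | succ n ih =>
      rw [succ_nsmul]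
      push_cast
      linarith [hadd (n • y) y]
  have hzsmul : ∀ (n : ℤ) y, S (n • y) ≤ |(n : ℝ)| * S y := by
    intro n y
    obtain ⟨m, rfl | rfl⟩ := n.eq_nat_or_neg
    · simpa using hnsmul m y
    · simpa [hneg] using hnsmul m y
  have hk : (fun i => (k i : ZMod N)) = ∑ i, k i • (Pi.single i 1 : Lattice d N) := by
    funext j
    simp [Finset.sum_apply, Pi.single_apply]
  change S _ ≤ ∑ i, |(k i : ℝ)| * S (Pi.single i 1)
  rw [hk]
  refine (Finset.le_sum_of_subadditive S hS0.le hadd _ _).trans ?_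
  exact Finset.sum_le_sum fun i _ => hzsmul _ _

/-- Translation by h moves the index by an amount that depends on the point z. After averaging over
lattice translates, z is fixed while the lattice sum is taken, so the discrete shift is constant
there and `sum_abs_shift_le` applies. -/
lemma integral_abs_translate_sub_le (N : ℕ+) (W : Lattice d N → ℝ) (h : Torus d) :
    ∫ z : Torus d, |W (index N (z + h)) - W (index N z)| ≤ (‖h‖ + 1 / N) * bvSum N W := by
  have hN : (0 : ℝ) < N := by exact_mod_cast N.pos
  have hmeas : ∀ x : Lattice d N, Integrable
      fun z : Torus d => |W (index N (z + h) + x) - W (index N z + x)| := by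
    intro x
    have h1 := (integrable_comp_index N fun y => W (y + x))
    exact ((h1.comp_add_right h).sub h1).abs
  have key : ∀ x : Lattice d N, ∫ z : Torus d, |W (index N (z + h)) - W (index N z)| =
      ∫ z : Torus d, |W (index N (z + h) + x) - W (index N z + x)| := by
    intro x
    rw [← integral_add_right_eq_self _ (latticePoint N x)]
    refine integral_congr_ae (Eventually.of_forall fun z => ?_)
    simp only
    rw [add_right_comm, index_add_latticePoint, index_add_latticePoint]
  have hsum : (N : ℝ) ^ d * ∫ z : Torus d, |W (index N (z + h)) - W (index N z)| =
      ∫ z : Torus d, ∑ x : Lattice d N, |W (index N (z + h) + x) - W (index N z + x)| := by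
    rw [integral_finsetSum _ fun x _ => hmeas x, ← Finset.sum_congr rfl fun x _ => key x]
    simp [Finset.sum_const, nsmul_eq_mul, ZMod.card]
  have hbound : ∫ z : Torus d, ∑ x : Lattice d N, |W (index N (z + h) + x) - W (index N z + x)| ≤
      (N * ‖h‖ + 1) * ∑ i, ∑ x : Lattice d N, |W (x + Pi.single i 1) - W x| := by
    have : ∀ z : Torus d, ∑ x : Lattice d N, |W (index N (z + h) + x) - W (index N z + x)| ≤
        (N * ‖h‖ + 1) * ∑ i, ∑ x : Lattice d N, |W (x + Pi.single i 1) - W x| := by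
      intro z
      obtain ⟨k, hk, hk'⟩ := exists_index_add N z h
      have h1 : ∑ x : Lattice d N, |W (index N (z + h) + x) - W (index N z + x)| =
          ∑ x : Lattice d N, |W (x + fun i => (k i : ZMod N)) - W x| := by
        refine Fintype.sum_equiv (Equiv.addLeft (index N z)) _ _ fun x => ?_
        rw [hk]
        simp [add_right_comm]
      rw [h1, Finset.mul_sum]
      refine (sum_abs_shift_le N W k).trans (Finset.sum_le_sum fun i _ => ?_)
      refine mul_le_mul_of_nonneg_right ((hk' i).trans ?_) (by positivity)
      gcongr
      exact norm_le_pi_norm h i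
    calc _ ≤ ∫ _ : Torus d, (N * ‖h‖ + 1) * ∑ i, ∑ x : Lattice d N, |W (x + Pi.single i 1) - W x| :=
          integral_mono (integrable_finsetSum _ fun x _ => hmeas x) (integrable_const _) this
      _ = _ := by simp
  have hND : (0 : ℝ) < (N : ℝ) ^ d := by positivity
  have hfin : (‖h‖ + 1 / N) * bvSum N W = ((N : ℝ) ^ d)⁻¹ *
      ((N * ‖h‖ + 1) * ∑ i, ∑ x : Lattice d N, |W (x + Pi.single i 1) - W x|) := by
    rw [bvSum, Finset.sum_comm]
    simp_rw [← Finset.mul_sum]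
    field_simp
  rw [hfin, le_inv_mul_iff₀ hND, hsum]
  exact hbound

lemma abs_sub_rpow_le_abs_rpow_sub {a b p : ℝ} (ha : 0 ≤ a) (hb : 0 ≤ b) (hp : 1 ≤ p) :
    |a - b| ^ p ≤ |a ^ p - b ^ p| := by
  wlog h : b ≤ a generalizing a b
  · rw [abs_sub_comm, abs_sub_comm (a ^ p)]
    exact this hb ha (le_of_not_ge h)
  have h1 := Real.add_rpow_le_rpow_add (sub_nonneg.2 h) hb hp
  rw [sub_add_cancel] at h1
  rw [abs_of_nonneg (sub_nonneg.2 h)]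
  exact le_trans (by linarith) (le_abs_self _)

/-- A continuous probability density on the torus that vanishes outside the ball of radius `ε`. -/
structure IsMollifier (ρ : C(Torus d, ℝ)) (ε : ℝ) : Prop where
  nonneg : ∀ h, 0 ≤ ρ h
  integral_eq_one : ∫ h, ρ h = 1
  norm_le : ∀ h, ρ h ≠ 0 → ‖h‖ ≤ ε

lemma integrable_continuousMap (φ : C(Torus d, ℝ)) : Integrable φ :=
  φ.continuous.integrable_of_hasCompactSupport (HasCompactSupport.of_compactSpace φ)

lemma exists_isMollifier (d : ℕ) {ε : ℝ} (hε : 0 < ε) : ∃ ρ : C(Torus d, ℝ), IsMollifier ρ ε := by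
  let τ : C(Torus d, ℝ) := ⟨fun h => max 0 (ε - ‖h‖), by fun_prop⟩
  have hτ0 : ∀ h, 0 ≤ τ h := fun h => le_max_left _ _
  have hpos : 0 < ∫ h, τ h :=
    τ.continuous.integral_pos_of_hasCompactSupport_nonneg_nonzero
      (HasCompactSupport.of_compactSpace _) hτ0 (x := 0) (by simp [τ, hε.ne', hε.le])
  refine ⟨(∫ h, τ h)⁻¹ • τ, ⟨fun h => ?_, ?_, fun h hh => ?_⟩⟩
  · exact mul_nonneg (inv_nonneg.2 hpos.le) (hτ0 h)
  · simp only [ContinuousMap.smul_apply, smul_eq_mul]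
    rw [integral_const_mul, inv_mul_cancel₀ hpos.ne']
  · by_contra hlt
    refine hh ?_
    have : τ h = 0 := max_eq_left (by linarith [not_le.1 hlt])
    simp [this]

/-- The test function `y ↦ ρ (z - y)`. -/
def shiftTest (ρ : C(Torus d, ℝ)) (z : Torus d) : C(Torus d, ℝ) :=
  ⟨fun y => ρ (z - y), by fun_prop⟩

lemma exists_abs_le_of_finite {ι : Type*} [Finite ι] (G : ι → ℝ) : ∃ B, ∀ x, |G x| ≤ B := by
  have := Fintype.ofFinite ι
  exact ⟨∑ x, |G x|, fun x => Finset.single_le_sum (f := fun x => |G x|)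
    (fun x _ => abs_nonneg _) (Finset.mem_univ x)⟩

/-- Jensen's inequality for the probability measure with density ρ. -/
lemma IsMollifier.integral_mul_rpow_le {ρ : C(Torus d, ℝ)} {ε : ℝ} (hρ : IsMollifier ρ ε)
    {g : Torus d → ℝ} (hg : Measurable g) (hg0 : ∀ h, 0 ≤ g h) {B : ℝ} (hB : ∀ h, g h ≤ B)
    {α : ℝ} (hα : 1 ≤ α) : (∫ h, ρ h * g h) ^ α ≤ ∫ h, ρ h * g h ^ α := by
  have hρm : Measurable fun h => (ρ h).toNNReal := ρ.continuous.measurable.real_toNNReal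
  set μ : Measure (Torus d) := volume.withDensity fun h => ((ρ h).toNNReal : ℝ≥0∞) with hμ
  have hint : ∀ g : Torus d → ℝ, ∫ h, g h ∂μ = ∫ h, ρ h * g h := by
    intro g
    rw [hμ, integral_withDensity_eq_integral_smul hρm]
    refine integral_congr_ae (Eventually.of_forall fun h => ?_)
    simp [NNReal.smul_def, hρ.nonneg h]
  have : IsProbabilityMeasure μ := by
    refine ⟨?_⟩
    rw [hμ, withDensity_apply _ MeasurableSet.univ, Measure.restrict_univ]
    change ∫⁻ h, ENNReal.ofReal (ρ h) = 1
    rw [← ofReal_integral_eq_lintegral_ofReal (integrable_continuousMap ρ)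
      (Eventually.of_forall hρ.nonneg), hρ.integral_eq_one, ENNReal.ofReal_one]
  have h1 : Integrable g μ := Integrable.of_bound hg.aestronglyMeasurable B
    (Eventually.of_forall fun h => by simpa [abs_of_nonneg (hg0 h)] using hB h)
  have h2 : Integrable ((fun x : ℝ => x ^ α) ∘ g) μ :=
    Integrable.of_bound (hg.pow_const α).aestronglyMeasurable (B ^ α)
      (Eventually.of_forall fun h => by
        simp only [Function.comp_apply, Real.norm_eq_abs, abs_of_nonneg (Real.rpow_nonneg (hg0 h) α)]
        exact Real.rpow_le_rpow (hg0 h) (hB h) (by linarith))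
  have := (convexOn_rpow hα).map_integral_le (μ := μ) (f := g)
    (Real.continuous_rpow_const (by linarith)).continuousOn isClosed_Ici
    (Eventually.of_forall hg0) h1 h2
  rwa [hint, hint] at this

instance : (volume : Measure UnitAddCircle).IsNegInvariant :=
  Measure.IsAddHaarMeasure.isNegInvariant_of_regular _

instance : (volume : Measure (Torus d)).IsNegInvariant :=
  inferInstanceAs ((Measure.pi fun _ : Fin d => (volume : Measure UnitAddCircle)).IsNegInvariant)

/-- Jensen moves the power α inside the mollification. There |a - b|^α ≤ |a^α - b^α| replaces the
L^α modulus of F by the L¹ modulus of F^α, which the BV sum controls on the support of ρ. -/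
lemma IsMollifier.integral_abs_sub_rpow_le {ρ : C(Torus d, ℝ)} {ε : ℝ} (hρ : IsMollifier ρ ε)
    (N : ℕ+) (F : Lattice d N → ℝ) (hF : ∀ x, 0 ≤ F x) {α : ℝ} (hα : 1 ≤ α) :
    ∫ z : Torus d, |F (index N z) - ∫ y, shiftTest ρ z y * F (index N y)| ^ α ≤
      (ε + 1 / N) * bvSum N fun x => F x ^ α := by
  obtain ⟨B, hB⟩ := exists_abs_le_of_finite F
  obtain ⟨B', hB'⟩ := exists_abs_le_of_finite fun x => F x ^ α
  obtain ⟨R, hR⟩ := (isCompact_range ρ.continuous).isBounded.exists_norm_le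
  have hR : ∀ h, |ρ h| ≤ R := fun h => hR _ (mem_range_self h)
  have hmz : Measurable fun p : Torus d × Torus d => index N p.1 :=
    (measurable_index N).comp measurable_fst
  have hmzh : Measurable fun p : Torus d × Torus d => index N (p.1 - p.2) :=
    (measurable_index N).comp (measurable_fst.sub measurable_snd)
  have hconv : ∀ z : Torus d, ∫ y, shiftTest ρ z y * F (index N y) =
      ∫ h, ρ h * F (index N (z - h)) := by
    intro z
    rw [← integral_sub_left_eq_self _ volume z]
    simp [shiftTest]
  set Q : Torus d × Torus d → ℝ :=
    fun p => ρ p.2 * |F (index N p.1) ^ α - F (index N (p.1 - p.2)) ^ α| with hQ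
  have hQm : Measurable Q := by
    have h1 : Measurable fun p : Torus d × Torus d => F (index N p.1) ^ α :=
      (measurable_of_finite fun x => F x ^ α).comp hmz
    have h2 : Measurable fun p : Torus d × Torus d => F (index N (p.1 - p.2)) ^ α :=
      (measurable_of_finite fun x => F x ^ α).comp hmzh
    have h3 : Measurable fun p : Torus d × Torus d => ρ p.2 :=
      ρ.continuous.measurable.comp measurable_snd
    exact h3.mul (continuous_abs.measurable.comp (h1.sub h2))
  have hQi : Integrable Q (volume.prod volume) := by
    refine Integrable.of_bound hQm.aestronglyMeasurable (R * (B' + B'))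
      (Eventually.of_forall fun p => ?_)
    simp only [hQ, Real.norm_eq_abs, abs_mul, abs_abs]
    refine mul_le_mul (hR _) ((abs_sub _ _).trans (add_le_add (hB' _) (hB' _))) (abs_nonneg _)
      ((abs_nonneg _).trans (hR 0))
  have hpt : ∀ z : Torus d, |F (index N z) - ∫ y, shiftTest ρ z y * F (index N y)| ^ α ≤
      ∫ h, Q (z, h) := by
    intro z
    have hm : Measurable fun h : Torus d => F (index N (z - h)) :=
      (measurable_of_finite F).comp ((measurable_index N).comp (measurable_const.sub measurable_id))
    have hi : Integrable fun h : Torus d => ρ h * F (index N (z - h)) :=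
      Integrable.of_bound (ρ.continuous.measurable.mul hm).aestronglyMeasurable (R * B)
        (Eventually.of_forall fun h => by
          rw [Real.norm_eq_abs, abs_mul]
          exact mul_le_mul (hR _) (hB _) (abs_nonneg _) ((abs_nonneg _).trans (hR 0)))
    have h1 : F (index N z) - ∫ y, shiftTest ρ z y * F (index N y) =
        ∫ h, ρ h * (F (index N z) - F (index N (z - h))) := by
      rw [hconv]
      simp_rw [mul_sub]
      rw [integral_sub ((integrable_continuousMap ρ).mul_const _) hi, integral_mul_const,
        hρ.integral_eq_one, one_mul]
    have hm' : Measurable fun h : Torus d => |F (index N z) - F (index N (z - h))| :=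
      continuous_abs.measurable.comp (measurable_const.sub hm)
    have hb' : ∀ h : Torus d, |F (index N z) - F (index N (z - h))| ≤ B + B := fun h =>
      (abs_sub _ _).trans (add_le_add (hB _) (hB _))
    have h2 : |∫ h, ρ h * (F (index N z) - F (index N (z - h)))| ≤
        ∫ h, ρ h * |F (index N z) - F (index N (z - h))| := by
      refine (abs_integral_le_integral_abs).trans_eq ?_
      refine integral_congr_ae (Eventually.of_forall fun h => ?_)
      simp [abs_mul, abs_of_nonneg (hρ.nonneg h)]
    rw [h1]
    calc _ ≤ (∫ h, ρ h * |F (index N z) - F (index N (z - h))|) ^ α :=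
          Real.rpow_le_rpow (abs_nonneg _) h2 (by linarith)
      _ ≤ ∫ h, ρ h * |F (index N z) - F (index N (z - h))| ^ α :=
          hρ.integral_mul_rpow_le hm' (fun _ => abs_nonneg _) hb' hα
      _ ≤ ∫ h, Q (z, h) := by
          refine integral_mono_of_nonneg (Eventually.of_forall fun h =>
            mul_nonneg (hρ.nonneg h) (Real.rpow_nonneg (abs_nonneg _) _)) ?_
            (Eventually.of_forall fun h => mul_le_mul_of_nonneg_left
              (abs_sub_rpow_le_abs_rpow_sub (hF _) (hF _) hα) (hρ.nonneg h))
          refine Integrable.of_bound (hQm.comp measurable_prodMk_left).aestronglyMeasurable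
            (R * (B' + B')) (Eventually.of_forall fun h => ?_)
          simp only [hQ, Real.norm_eq_abs, abs_mul, abs_abs]
          exact mul_le_mul (hR _) ((abs_sub _ _).trans (add_le_add (hB' _) (hB' _))) (abs_nonneg _)
            ((abs_nonneg _).trans (hR 0))
  have hbv := bvSum_nonneg N fun x => F x ^ α
  calc _ ≤ ∫ z, ∫ h, Q (z, h) :=
        integral_mono_of_nonneg (Eventually.of_forall fun z => Real.rpow_nonneg (abs_nonneg _) _)
          hQi.integral_prod_left (Eventually.of_forall hpt)
    _ = ∫ h, ∫ z, Q (z, h) := integral_integral_swap hQi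
    _ ≤ ∫ h, ρ h * ((ε + 1 / N) * bvSum N fun x => F x ^ α) := by
        refine integral_mono hQi.integral_prod_right
          ((integrable_continuousMap ρ).mul_const _) fun h => ?_
        simp only [hQ]
        rw [integral_const_mul]
        by_cases h0 : ρ h = 0
        · simp [h0]
        refine mul_le_mul_of_nonneg_left ?_ (hρ.nonneg h)
        have h1 := integral_abs_translate_sub_le N (fun x => F x ^ α) (-h)
        simp_rw [← sub_eq_add_neg, abs_sub_comm (F (index N (_ - h)) ^ α), norm_neg] at h1
        refine h1.trans (mul_le_mul_of_nonneg_right ?_ hbv)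
        linarith [hρ.norm_le h h0]
    _ = _ := by rw [integral_mul_const, hρ.integral_eq_one, one_mul]

/-! ### Continuous test functions -/

/-- Approximate in L¹ by continuous functions, pass to an almost everywhere convergent subsequence,
and clip at ±R, which does not affect the limit. -/
lemma exists_continuousMap_tendsto_ae {g : Torus d → ℝ} (hg : Measurable g) {R : ℝ}
    (hR : ∀ x, |g x| ≤ R) :
    ∃ φ : ℕ → C(Torus d, ℝ), (∀ n x, |φ n x| ≤ R) ∧
      ∀ᵐ x, Tendsto (fun n => φ n x) atTop (𝓝 (g x)) := by
  have hg1 : MemLp g 1 (volume : Measure (Torus d)) :=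
    MemLp.of_bound hg.aestronglyMeasurable R (Eventually.of_forall hR)
  choose ψ hψ hψm using fun n : ℕ => hg1.exists_boundedContinuous_eLpNorm_sub_le ENNReal.one_ne_top
    (ε := ENNReal.ofReal (1 / ((n : ℝ) + 1))) (by simp; positivity)
  have h0 : Tendsto (fun n => eLpNorm (fun x => ψ n x - g x) 1 volume) atTop (𝓝 0) := by
    refine tendsto_of_tendsto_of_tendsto_of_le_of_le tendsto_const_nhds ?_ (fun n => zero_le)
      (fun n => (eLpNorm_sub_comm _ _ _ _).trans_le (hψ n))
    simpa using ENNReal.tendsto_ofReal tendsto_one_div_add_atTop_nhds_zero_nat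
  have h1 := tendstoInMeasure_of_tendsto_eLpNorm one_ne_zero
    (fun n => (ψ n).continuous.aestronglyMeasurable) hg.aestronglyMeasurable h0
  obtain ⟨ns, -, hns⟩ := h1.exists_seq_tendsto_ae
  have hR0 : 0 ≤ R := (abs_nonneg _).trans (hR 0)
  refine ⟨fun n => ⟨fun x => max (-R) (min R (ψ (ns n) x)), by fun_prop⟩, fun n x => ?_, ?_⟩
  · exact abs_le.2 ⟨le_max_left _ _, max_le (by linarith) (min_le_left _ _)⟩
  · filter_upwards [hns] with x hx
    have h2 : max (-R) (min R (g x)) = g x := by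
      rw [min_eq_right (abs_le.1 (hR x)).2, max_eq_right (abs_le.1 (hR x)).1]
    conv => rw [← h2]
    exact tendsto_const_nhds.max (tendsto_const_nhds.min hx)

lemma tendsto_integral_continuousMap_mul {g : Torus d → ℝ} {R : ℝ}
    {φ : ℕ → C(Torus d, ℝ)} (hφ : ∀ n x, |φ n x| ≤ R)
    (hlim : ∀ᵐ x, Tendsto (fun n => φ n x) atTop (𝓝 (g x))) {f : Torus d → ℝ}
    (hf : Integrable f) :
    Tendsto (fun n => ∫ x, φ n x * f x) atTop (𝓝 (∫ x, g x * f x)) := by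
  refine tendsto_integral_of_dominated_convergence (fun x => R * ‖f x‖)
    (fun n => (φ n).continuous.aestronglyMeasurable.mul hf.1) (hf.norm.const_mul R)
    (fun n => Eventually.of_forall fun x => ?_) ?_
  · rw [norm_mul]
    exact mul_le_mul_of_nonneg_right (hφ n x) (norm_nonneg _)
  · filter_upwards [hlim] with x hx using hx.mul_const _

/-- Bounded continuous approximations of the sign of f - f' turn the hypothesis into ∫|f - f'| = 0.
-/
lemma ae_eq_of_forall_integral_continuousMap_mul_eq {f f' : Torus d → ℝ} (hf : Integrable f)
    (hf' : Integrable f') (h : ∀ φ : C(Torus d, ℝ), ∫ x, φ x * f x = ∫ x, φ x * f' x) :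
    f =ᵐ[volume] f' := by
  have hk : Integrable (fun x => f x - f' x) := hf.sub hf'
  set k := hk.1.mk _ with hkd
  have hkm : Measurable k := hk.1.stronglyMeasurable_mk.measurable
  have hkae : (fun x => f x - f' x) =ᵐ[volume] k := hk.1.ae_eq_mk
  have hki : Integrable k := hk.congr hkae
  have hsm : Measurable fun x => if 0 ≤ k x then (1 : ℝ) else -1 :=
    Measurable.ite (hkm measurableSet_Ici) measurable_const measurable_const
  obtain ⟨φ, hφ, hlim⟩ := exists_continuousMap_tendsto_ae hsm (R := 1) fun x => by
    split_ifs <;> simp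
  have h1 := tendsto_integral_continuousMap_mul hφ hlim hki
  have h2 : ∀ n, ∫ x, φ n x * k x = 0 := by
    intro n
    have hb : ∀ {u : Torus d → ℝ}, Integrable u → Integrable fun x => φ n x * u x := fun hu =>
      hu.bdd_mul (φ n).continuous.aestronglyMeasurable (Eventually.of_forall (hφ n))
    rw [← integral_congr_ae (f := fun x => φ n x * f x - φ n x * f' x)
      (by filter_upwards [hkae] with x hx; rw [← hx]; ring),
      integral_sub (hb hf) (hb hf'), h (φ n), sub_self]
  simp_rw [h2] at h1
  have h3 : ∫ x, |k x| = 0 := by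
    rw [tendsto_nhds_unique tendsto_const_nhds h1]
    refine integral_congr_ae (Eventually.of_forall fun x => ?_)
    dsimp only
    split_ifs with h
    · rw [abs_of_nonneg h, one_mul]
    · rw [abs_of_neg (not_le.1 h)]; ring
  have h4 := (integral_eq_zero_iff_of_nonneg (fun x => abs_nonneg _) hki.abs).1 h3
  filter_upwards [h4, hkae] with x hx hx'
  have : k x = 0 := abs_eq_zero.1 hx
  rw [this] at hx'
  linarith

/-! ### Entropy -/

/-- The Fenchel–Young inequality for the entropy density, whose convex conjugate is e^a - 1. It is 1
+ t ≤ e^t at t = a - log x. -/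
lemma mul_sub_exp_add_one_le {x : ℝ} (hx : 0 ≤ x) (a : ℝ) :
    a * x - Real.exp a + 1 ≤ x * Real.log x - x + 1 := by
  rcases hx.eq_or_lt with rfl | hx
  · simp [Real.exp_nonneg]
  · have h1 := Real.add_one_le_exp (a - Real.log x)
    have h2 : Real.exp a = x * Real.exp (a - Real.log x) := by
      rw [Real.exp_sub, Real.exp_log hx]
      field_simp
    rw [h2]
    nlinarith

lemma entropyDensity_nonneg {x : ℝ} (hx : 0 ≤ x) : 0 ≤ x * Real.log x - x + 1 := by
  simpa using mul_sub_exp_add_one_le hx 0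

lemma le_entropyDensity_add_two {x : ℝ} (hx : 0 ≤ x) : x ≤ x * Real.log x - x + 1 + 2 := by
  have h := mul_sub_exp_add_one_le hx 1
  have := Real.exp_one_lt_d9
  linarith

lemma aemeasurable_entropyDensity (f : L1Pos d) :
    AEMeasurable (fun x => f x * Real.log (f x) - f x + 1) (volume : Measure (Torus d)) := by
  have hm : AEMeasurable f (volume : Measure (Torus d)) := (integrable_coe f).1.aemeasurable
  exact ((hm.mul (Real.measurable_log.comp_aemeasurable hm)).sub hm).add_const 1

lemma integrable_entropyDensity {f : L1Pos d} (h : entropy f ≠ ⊤) :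
    Integrable fun x => f x * Real.log (f x) - f x + 1 := by
  refine ⟨(aemeasurable_entropyDensity f).aestronglyMeasurable, ?_⟩
  rw [hasFiniteIntegral_iff_ofReal]
  · exact h.lt_top
  · filter_upwards [coe_nonneg f] with x hx using entropyDensity_nonneg hx

lemma integral_entropyDensity_le {f : L1Pos d} {z : ℝ≥0} (h : entropy f ≤ z) :
    ∫ x, (f x * Real.log (f x) - f x + 1) ≤ z := by
  rw [integral_eq_lintegral_of_nonneg_ae
    (by filter_upwards [coe_nonneg f] with x hx using entropyDensity_nonneg hx)
    (aemeasurable_entropyDensity f).aestronglyMeasurable]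
  exact ENNReal.toReal_le_coe_of_le_coe h

lemma integral_le_of_entropy_le {f : L1Pos d} {z : ℝ≥0} (h : entropy f ≤ z) :
    ∫ x, f x ≤ z + 2 := by
  have hi := integrable_entropyDensity (ne_top_of_le_ne_top ENNReal.coe_ne_top h)
  have h1 : ∫ x, f x ≤ ∫ x, (f x * Real.log (f x) - f x + 1 + 2) := by
    refine integral_mono_ae (integrable_coe f) (hi.add (integrable_const _)) ?_
    filter_upwards [coe_nonneg f] with x hx using le_entropyDensity_add_two hx
  rw [integral_add hi (integrable_const _)] at h1
  have h2 := integral_entropyDensity_le h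
  simp at h1
  linarith

lemma integrable_continuousMap_mul (φ : C(Torus d, ℝ)) {f : Torus d → ℝ} (hf : Integrable f) :
    Integrable fun x => φ x * f x := by
  obtain ⟨R, hR⟩ := (isCompact_range φ.continuous).isBounded.exists_norm_le
  exact hf.bdd_mul φ.continuous.aestronglyMeasurable
    (Eventually.of_forall fun x => hR _ (mem_range_self x))

lemma integrable_exp_sub_one (φ : C(Torus d, ℝ)) :
    Integrable fun x => Real.exp (φ x) - 1 :=
  integrable_continuousMap ⟨fun x => Real.exp (φ x) - 1, by fun_prop⟩

lemma pairing_sub_integral_exp_le {f : L1Pos d} {z : ℝ≥0} (h : entropy f ≤ z)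
    (φ : C(Torus d, ℝ)) : pairing f φ - ∫ x, (Real.exp (φ x) - 1) ≤ z := by
  have hi := integrable_entropyDensity (ne_top_of_le_ne_top ENNReal.coe_ne_top h)
  refine le_trans ?_ (integral_entropyDensity_le h)
  have hφ := integrable_continuousMap_mul φ (integrable_coe f)
  rw [pairing, ← integral_sub hφ (integrable_exp_sub_one φ)]
  refine integral_mono_ae (hφ.sub (integrable_exp_sub_one φ)) hi ?_
  filter_upwards [coe_nonneg f] with x hx
  linarith [mul_sub_exp_add_one_le hx (φ x)]

/-- The dual integrand at the logarithm of a clipped x stays nonnegative, which is what Fatou's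
lemma requires in `entropy_le_of_forall_pairing_le`. -/
lemma entropyDensity_truncation_nonneg {x R : ℝ} (hx : 0 ≤ x) (hR : 1 ≤ R) :
    0 ≤ Real.log (max R⁻¹ (min R x)) * x - max R⁻¹ (min R x) + 1 := by
  have hR0 : 0 < R := by linarith
  have hRi : R⁻¹ ≤ 1 := inv_le_one_of_one_le₀ hR
  have hlog : 0 ≤ Real.log R := Real.log_nonneg hR
  rcases le_total R x with h | h
  · rw [min_eq_left h, max_eq_right (by linarith)]
    have := entropyDensity_nonneg hR0.le
    nlinarith
  · rw [min_eq_right h]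
    rcases le_total R⁻¹ x with h' | h'
    · rw [max_eq_right h']
      linarith [entropyDensity_nonneg hx]
    · rw [max_eq_left h', Real.log_inv]
      have := entropyDensity_nonneg (inv_pos.2 hR0).le
      rw [Real.log_inv] at this
      nlinarith

lemma tendsto_entropyDensity_truncation {x : ℝ} (hx : 0 ≤ x) :
    Tendsto (fun n : ℕ => Real.log (max ((n : ℝ) + 1)⁻¹ (min ((n : ℝ) + 1) x)) * x -
      max ((n : ℝ) + 1)⁻¹ (min ((n : ℝ) + 1) x) + 1) atTop
      (𝓝 (x * Real.log x - x + 1)) := by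
  have hinv : Tendsto (fun n : ℕ => ((n : ℝ) + 1)⁻¹) atTop (𝓝 0) := by
    simpa using tendsto_one_div_add_atTop_nhds_zero_nat (𝕜 := ℝ)
  have hev : ∀ᶠ n : ℕ in atTop, min ((n : ℝ) + 1) x = x := by
    obtain ⟨m, hm⟩ := exists_nat_ge x
    filter_upwards [eventually_ge_atTop m] with n hn
    refine min_eq_right ?_
    have : (m : ℝ) ≤ n := by exact_mod_cast hn
    linarith
  rcases hx.eq_or_lt with rfl | hx
  · simp only [mul_zero, zero_sub, zero_mul, zero_add, sub_zero]
    have h1 : Tendsto (fun n : ℕ => -((n : ℝ) + 1)⁻¹ + 1) atTop (𝓝 (-0 + 1)) :=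
      hinv.neg.add_const 1
    rw [neg_zero, zero_add] at h1
    refine h1.congr' ?_
    filter_upwards [hev] with n hn
    rw [hn, max_eq_left (by positivity)]
  · refine tendsto_const_nhds.congr' ?_
    filter_upwards [hev, hinv.eventually (gt_mem_nhds hx)] with n hn hn'
    rw [hn, max_eq_right hn'.le]
    ring

/-- The converse half of the duality. The bound extends from continuous to bounded measurable dual
variables. The optimal one, log f, is approached by the logarithm of f clipped to [1/(n+1), n+1],
and Fatou's lemma removes the clipping. -/
lemma entropy_le_of_forall_pairing_le {f : L1Pos d} {L : ℝ}
    (h : ∀ φ : C(Torus d, ℝ), pairing f φ - ∫ x, (Real.exp (φ x) - 1) ≤ L) :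
    entropy f ≤ ENNReal.ofReal L := by
  have hfi := integrable_coe f
  set k := hfi.1.mk _ with hk
  have hkm : Measurable k := hfi.1.stronglyMeasurable_mk.measurable
  have hkae : f =ᵐ[volume] k := hfi.1.ae_eq_mk
  have hbd : ∀ {g : Torus d → ℝ} {R : ℝ}, Measurable g → (∀ x, |g x| ≤ R) →
      ∫ x, (g x * f x - Real.exp (g x) + 1) ≤ L := by
    intro g R hg hR
    obtain ⟨φ, hφ, hlim⟩ := exists_continuousMap_tendsto_ae hg hR
    have h1 := tendsto_integral_continuousMap_mul hφ hlim hfi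
    have h2 : Tendsto (fun n => ∫ x, (Real.exp (φ n x) - 1)) atTop
        (𝓝 (∫ x, (Real.exp (g x) - 1))) := by
      refine tendsto_integral_of_dominated_convergence (fun _ => Real.exp R + 1)
        (fun n => (integrable_exp_sub_one (φ n)).1) (integrable_const _)
        (fun n => Eventually.of_forall fun x => ?_) ?_
      · refine (norm_sub_le _ _).trans ?_
        simp only [Real.norm_eq_abs, Real.abs_exp, abs_one]
        gcongr
        exact (le_abs_self _).trans (hφ n x)
      · filter_upwards [hlim] with x hx
        exact ((Real.continuous_exp.tendsto _).comp hx).sub_const 1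
    have hgf : Integrable fun x => g x * f x :=
      hfi.bdd_mul hg.aestronglyMeasurable (Eventually.of_forall hR)
    have hge : Integrable fun x => Real.exp (g x) - 1 := by
      refine Integrable.of_bound
        ((Real.measurable_exp.comp hg).sub_const 1).aestronglyMeasurable (Real.exp R + 1)
        (Eventually.of_forall fun x => ?_)
      refine (norm_sub_le _ _).trans ?_
      simp only [Real.norm_eq_abs, Real.abs_exp, abs_one]
      gcongr
      exact (le_abs_self _).trans (hR x)
    have h3 := le_of_tendsto (h1.sub h2) (Eventually.of_forall fun n => h (φ n))
    rw [← integral_sub hgf hge] at h3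
    refine le_of_eq_of_le (integral_congr_ae (Eventually.of_forall fun x => ?_)) h3
    ring
  have hcl : ∀ n : ℕ, Measurable fun x => max ((n : ℝ) + 1)⁻¹ (min ((n : ℝ) + 1) (k x)) := fun n =>
    measurable_const.max (measurable_const.min hkm)
  have hpos : ∀ (n : ℕ) x, 0 < max ((n : ℝ) + 1)⁻¹ (min ((n : ℝ) + 1) (k x)) := fun n x =>
    lt_max_of_lt_left (by positivity)
  set Φ : ℕ → Torus d → ℝ := fun n x =>
    Real.log (max ((n : ℝ) + 1)⁻¹ (min ((n : ℝ) + 1) (k x))) * f x -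
      max ((n : ℝ) + 1)⁻¹ (min ((n : ℝ) + 1) (k x)) + 1 with hΦ
  have hΦm : ∀ n, AEMeasurable (Φ n) volume := fun n =>
    (((Real.measurable_log.comp (hcl n)).aemeasurable.mul hfi.1.aemeasurable).sub
      (hcl n).aemeasurable).add_const 1
  have hΦ0 : ∀ n, ∀ᵐ x, 0 ≤ Φ n x := by
    intro n
    filter_upwards [coe_nonneg f, hkae] with x hx hx'
    simp only [hΦ, ← hx']
    exact entropyDensity_truncation_nonneg hx (by linarith [Nat.cast_nonneg (α := ℝ) n])
  have hlogb : ∀ (n : ℕ) x, |Real.log (max ((n : ℝ) + 1)⁻¹ (min ((n : ℝ) + 1) (k x)))| ≤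
      Real.log ((n : ℝ) + 1) := by
    intro n x
    have hn : (1 : ℝ) ≤ (n : ℝ) + 1 := by linarith [Nat.cast_nonneg (α := ℝ) n]
    rw [abs_le, ← Real.log_inv]
    refine ⟨Real.log_le_log (by positivity) (le_max_left _ _), Real.log_le_log (hpos n x) ?_⟩
    exact max_le ((inv_le_one_of_one_le₀ hn).trans hn) (min_le_left _ _)
  have hΦi : ∀ n, Integrable (Φ n) := by
    intro n
    refine ((hfi.bdd_mul (Real.measurable_log.comp (hcl n)).aestronglyMeasurable
      (Eventually.of_forall (hlogb n))).sub ?_).add (integrable_const 1)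
    refine Integrable.of_bound (hcl n).aestronglyMeasurable ((n : ℝ) + 1)
      (Eventually.of_forall fun x => ?_)
    have hn : (1 : ℝ) ≤ (n : ℝ) + 1 := by linarith [Nat.cast_nonneg (α := ℝ) n]
    rw [Real.norm_eq_abs, abs_of_pos (hpos n x)]
    exact max_le ((inv_le_one_of_one_le₀ hn).trans hn) (min_le_left _ _)
  have hΦL : ∀ n, ∫⁻ x, ENNReal.ofReal (Φ n x) ≤ ENNReal.ofReal L := by
    intro n
    rw [← ofReal_integral_eq_lintegral_ofReal (hΦi n) (hΦ0 n)]
    refine ENNReal.ofReal_le_ofReal ?_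
    have h1 := hbd (Real.measurable_log.comp (hcl n)) (hlogb n)
    refine le_of_eq_of_le (integral_congr_ae (Eventually.of_forall fun x => ?_)) h1
    simp only [hΦ, Function.comp_apply]
    rw [Real.exp_log (hpos n x)]
  calc entropy f = ∫⁻ x, liminf (fun n => ENNReal.ofReal (Φ n x)) atTop := by
        refine lintegral_congr_ae ?_
        filter_upwards [coe_nonneg f, hkae] with x hx hx'
        refine (Tendsto.liminf_eq ?_).symm
        simp only [hΦ, ← hx']
        exact ENNReal.tendsto_ofReal (tendsto_entropyDensity_truncation hx)
    _ ≤ liminf (fun n => ∫⁻ x, ENNReal.ofReal (Φ n x)) atTop :=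
        lintegral_liminf_le' fun n => (hΦm n).ennreal_ofReal
    _ ≤ ENNReal.ofReal L :=
        liminf_le_of_le (by isBoundedDefault) fun b hb => by
          obtain ⟨n, hn⟩ := hb.exists
          exact hn.trans (hΦL n)

/-! ### Difference quotients of test functions -/

/-- The displacement by `1 / N` in the direction `i`. -/
def latticeStep (N : ℕ+) (i : Fin d) : Torus d := Pi.single i (((1 / (N : ℝ) : ℝ)) : UnitAddCircle)

lemma index_add_latticeStep (N : ℕ+) (z : Torus d) (i : Fin d) :
    index N (z + latticeStep N i) = index N z + Pi.single i 1 := by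
  funext j
  by_cases h : j = i
  · subst h
    simpa [index, latticeStep] using circleIndex_add_coe N (z j) 1
  · simp [index, latticeStep, h]

/-- The projection of `ℝᵈ` onto the torus. -/
def toTorus (y : Fin d → ℝ) : Torus d := fun i => (y i : UnitAddCircle)

lemma exists_toTorus_eq (z : Torus d) : ∃ y : Fin d → ℝ, (∀ i, y i ∈ Ico (0 : ℝ) 1) ∧ toTorus y = z := by
  choose y hy hy' using fun i => AddCircle.eq_coe_Ico (p := (1 : ℝ)) (z i)
  exact ⟨y, hy, funext hy'⟩

lemma toTorus_add_single (y : Fin d → ℝ) (i : Fin d) (s : ℝ) :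
    toTorus y + Pi.single i (s : UnitAddCircle) = toTorus (y + Pi.single i s) := by
  funext j
  by_cases h : j = i
  · subst h
    simp [toTorus]
  · simp [toTorus, h]

lemma IsSmooth.continuous {φ : Torus d → ℝ} (hφ : IsSmooth φ) : Continuous φ := by
  have hq : IsOpenQuotientMap (Pi.map fun (_ : Fin d) (y : ℝ) => (y : UnitAddCircle)) :=
    IsOpenQuotientMap.piMap fun _ => QuotientAddGroup.isOpenQuotientMap_mk
  exact hq.isQuotientMap.continuous_iff.2 (ContDiff.continuous hφ)

/-- The backward difference quotient of `φ`. -/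
def backwardDiff (N : ℕ+) (i : Fin d) (φ : Torus d → ℝ) (z : Torus d) : ℝ :=
  (N : ℝ) * (φ z - φ (z - latticeStep N i))

lemma latticeStep_neg (N : ℕ+) (i : Fin d) :
    -latticeStep N i = Pi.single i (((-(1 / (N : ℝ)) : ℝ)) : UnitAddCircle) := by
  rw [latticeStep, ← Pi.single_neg, AddCircle.coe_neg]

lemma IsSmooth.exists_abs_backwardDiff_le {φ : Torus d → ℝ} (hφ : IsSmooth φ) :
    ∃ K : ℝ, ∀ (N : ℕ+) (i : Fin d) (z : Torus d), |backwardDiff N i φ z| ≤ K := by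
  -- This cube contains the representative of z in [0, 1)ᵈ and its backward shift by 1/N ≤ 1, so one
  -- Lipschitz constant of the periodic lift serves all N and z.
  have hc : Convex ℝ (Icc (fun _ => -1 : Fin d → ℝ) (fun _ => 1)) := convex_Icc _ _
  obtain ⟨K, hK⟩ := (ContDiff.contDiffOn (s := Icc (fun _ => -1 : Fin d → ℝ) (fun _ => 1))
    hφ).exists_lipschitzOnWith (by simp) hc isCompact_Icc
  refine ⟨K, fun N i z => ?_⟩
  have hN : (0 : ℝ) < N := by exact_mod_cast N.pos
  have hN1 : 1 / (N : ℝ) ≤ 1 := by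
    rw [div_le_one hN]
    exact_mod_cast N.pos
  have hN0 : 0 < 1 / (N : ℝ) := by positivity
  obtain ⟨y, hy, rfl⟩ := exists_toTorus_eq z
  have h1 : y ∈ Icc (fun _ => -1 : Fin d → ℝ) (fun _ => 1) :=
    ⟨fun j => by linarith [(hy j).1], fun j => (hy j).2.le⟩
  have h2 : y + Pi.single i (-(1 / (N : ℝ))) ∈ Icc (fun _ => -1 : Fin d → ℝ) (fun _ => 1) := by
    constructor <;> intro j <;> by_cases h : j = i
    · subst h
      simp only [Pi.add_apply, Pi.single_eq_same]
      linarith [(hy j).1]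
    · simp only [Pi.add_apply, Pi.single_eq_of_ne h]
      linarith [(hy j).1]
    · subst h
      simp only [Pi.add_apply, Pi.single_eq_same]
      linarith [(hy j).2]
    · simp only [Pi.add_apply, Pi.single_eq_of_ne h]
      linarith [(hy j).2]
  have h3 := hK.dist_le_mul _ h1 _ h2
  rw [backwardDiff, sub_eq_add_neg (toTorus y), latticeStep_neg, toTorus_add_single, abs_mul,
    abs_of_pos hN]
  rw [dist_self_add_right, Pi.norm_single, Real.dist_eq, Real.norm_eq_abs, abs_neg,
    abs_of_pos hN0] at h3
  change |φ (toTorus y) - φ (toTorus (y + Pi.single i (-(1 / (N : ℝ)))))| ≤ _ at h3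
  calc (N : ℝ) * |φ (toTorus y) - φ (toTorus (y + Pi.single i (-(1 / (N : ℝ)))))|
      ≤ N * (K * (1 / (N : ℝ))) := mul_le_mul_of_nonneg_left h3 hN.le
    _ = K := by field_simp

lemma IsSmooth.tendsto_backwardDiff {φ : Torus d → ℝ} (hφ : IsSmooth φ) (i : Fin d) (z : Torus d) :
    Tendsto (fun N : ℕ+ => backwardDiff N i φ z) atTop (𝓝 (partialDeriv i φ z)) := by
  obtain ⟨y, -, rfl⟩ := exists_toTorus_eq z
  have hd : DifferentiableAt ℝ
      (fun s : ℝ => φ (toTorus y + Pi.single i (s : UnitAddCircle))) 0 := by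
    simp_rw [toTorus_add_single]
    have h1 : Differentiable ℝ (fun y : Fin d → ℝ => φ (toTorus y)) :=
      ContDiff.differentiable hφ (by simp)
    have h2 : Differentiable ℝ (fun s : ℝ => y + (Pi.single i s : Fin d → ℝ)) :=
      (differentiable_const y).add (ContinuousLinearMap.single ℝ (fun _ : Fin d => ℝ) i).differentiable
    exact (h1.comp h2) 0
  have hslope := hd.hasDerivAt.tendsto_slope_zero
  have hlim : Tendsto (fun N : ℕ+ => -(1 / (N : ℝ))) atTop (𝓝[≠] 0) := by
    refine tendsto_nhdsWithin_iff.2 ⟨?_, Eventually.of_forall fun N => ?_⟩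
    · have h1 : Tendsto (fun N : ℕ+ => (N : ℝ)) atTop atTop :=
        tendsto_natCast_atTop_atTop.comp tendsto_PNat_val_atTop_atTop
      simpa using h1.inv_tendsto_atTop.neg
    · simp
  refine (hslope.comp hlim).congr fun N => ?_
  have hN : (N : ℝ) ≠ 0 := by exact_mod_cast N.ne_zero
  simp only [Function.comp_apply, zero_add, smul_eq_mul, backwardDiff]
  rw [sub_eq_add_neg (toTorus y), latticeStep_neg]
  simp only [AddCircle.coe_zero, Pi.single_zero, add_zero]
  field_simp
  ring

/-- Summation by parts: translation by one lattice step preserves the integral and moves the index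
by the i-th unit vector. -/
lemma integral_mul_backwardDiff (N : ℕ+) (V : Lattice d N → ℝ) (i : Fin d) {φ : Torus d → ℝ}
    (hφ : Continuous φ) :
    ∫ z, V (index N z) * backwardDiff N i φ z =
      -∫ z, (N : ℝ) * (V (index N z + Pi.single i 1) - V (index N z)) * φ z := by
  have hi : ∀ (G : Lattice d N → ℝ) {ψ : Torus d → ℝ}, Continuous ψ →
      Integrable fun z => G (index N z) * ψ z := fun G ψ hψ => by
    simpa [mul_comm] using integrable_continuousMap_mul ⟨ψ, hψ⟩ (integrable_comp_index N G)
  have h1 : ∫ z, V (index N z) * φ (z - latticeStep N i) =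
      ∫ z, V (index N z + Pi.single i 1) * φ z := by
    rw [← integral_add_right_eq_self _ (latticeStep N i)]
    simp_rw [add_sub_cancel_right, index_add_latticeStep]
  have h2 : ∫ z, V (index N z) * backwardDiff N i φ z =
      N * ((∫ z, V (index N z) * φ z) - ∫ z, V (index N z) * φ (z - latticeStep N i)) := by
    rw [← integral_sub (hi V hφ) (hi V (by fun_prop)), ← integral_const_mul]
    refine integral_congr_ae (Eventually.of_forall fun z => ?_)
    simp only [backwardDiff]
    ring
  have h3 : ∫ z, (N : ℝ) * (V (index N z + Pi.single i 1) - V (index N z)) * φ z =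
      N * ((∫ z, V (index N z + Pi.single i 1) * φ z) - ∫ z, V (index N z) * φ z) := by
    have h4 : Integrable fun z => V (index N z + Pi.single i 1) * φ z :=
      hi (fun x => V (x + Pi.single i 1)) hφ
    rw [← integral_sub h4 (hi V hφ), ← integral_const_mul]
    refine integral_congr_ae (Eventually.of_forall fun z => ?_)
    ring
  rw [h2, h3, h1]
  ring

/-! ### Weak limits -/

/-- Banach–Alaoglu along an ultrafilter finer than `atTop`, which spares the extraction of a
subsequence: wherever an ordinary limit exists, the ultrafilter limit agrees with it. -/
lemma exists_weak_limit {H : Type*} [NormedAddCommGroup H] [InnerProductSpace ℝ H] [CompleteSpace H]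
    (G : ℕ → H) {r : ℝ} (hG : ∀ k, ‖G k‖ ≤ r) :
    ∃ g : H, ‖g‖ ≤ r ∧ ∀ (ψ : H) (l : ℝ),
      Tendsto (fun k => inner ℝ (G k) ψ) atTop (𝓝 l) → inner ℝ g ψ = l := by
  let 𝒰 : Ultrafilter ℕ := Ultrafilter.of atTop
  have h𝒰 : (𝒰 : Filter ℕ) ≤ atTop := Ultrafilter.of_le atTop
  let T : ℕ → WeakDual ℝ H := fun k => StrongDual.toWeakDual (InnerProductSpace.toDual ℝ H (G k))
  have hc := WeakDual.isCompact_closedBall (𝕜 := ℝ) (E := H) 0 r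
  have hT : ∀ k, T k ∈ WeakDual.toStrongDual ⁻¹' Metric.closedBall (0 : StrongDual ℝ H) r := by
    intro k
    simp only [T, mem_preimage, mem_closedBall_zero_iff]
    change ‖InnerProductSpace.toDual ℝ H (G k)‖ ≤ r
    simpa using hG k
  obtain ⟨x, hx, hxl⟩ := hc.ultrafilter_le_nhds (𝒰.map T)
    (le_principal_iff.2 (mem_map.2 (univ_mem' hT)))
  refine ⟨(InnerProductSpace.toDual ℝ H).symm (WeakDual.toStrongDual x), ?_, fun ψ l hl => ?_⟩
  · simpa using hx
  · rw [InnerProductSpace.toDual_symm_apply]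
    have h1 : Tendsto (fun k => T k ψ) 𝒰 (𝓝 (x ψ)) :=
      ((WeakDual.eval_continuous ψ).tendsto x).comp hxl
    exact tendsto_nhds_unique h1 (hl.mono_left h𝒰)

/-! ### Lower semicontinuity of the dissipation -/

/-- Bounded second moments give uniform integrability. Truncation at R costs at most a²/R, and the
truncated functions converge by dominated convergence. -/
lemma tendsto_integral_abs_sub_of_sq_bound {v : ℕ → Torus d → ℝ} {w : Torus d → ℝ} {C : ℝ}
    (hv : ∀ k, Integrable (v k)) (hv2 : ∀ k, Integrable fun x => v k x ^ 2)
    (hw : Integrable w) (hw2 : Integrable fun x => w x ^ 2)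
    (hv0 : ∀ k, ∀ᵐ x, 0 ≤ v k x) (hw0 : ∀ᵐ x, 0 ≤ w x)
    (hvC : ∀ k, ∫ x, v k x ^ 2 ≤ C) (hwC : ∫ x, w x ^ 2 ≤ C)
    (hlim : ∀ᵐ x, Tendsto (fun k => v k x) atTop (𝓝 (w x))) :
    Tendsto (fun k => ∫ x, |v k x - w x|) atTop (𝓝 0) := by
  have hC : 0 ≤ C := (integral_nonneg fun x => sq_nonneg _).trans hwC
  rw [Metric.tendsto_atTop]
  intro ε hε
  -- The two truncation errors, at most 2C/R together, then stay below 3ε/4 and leave ε/4 for the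
  -- truncated part; the added 1 covers C = 0.
  set R : ℝ := 4 * C / ε + 1 with hR
  have hR0 : 0 < R := by positivity
  have hCR : 2 * C / R < ε / 2 + ε / 4 := by
    rw [div_lt_iff₀ hR0, hR]
    have : (ε / 2 + ε / 4) * (4 * C / ε + 1) = 3 * C + (ε / 2 + ε / 4) := by field_simp; ring
    rw [this]
    linarith
  have hmin : Tendsto (fun k => ∫ x, |min (v k x) R - min (w x) R|) atTop (𝓝 0) := by
    have : (0 : ℝ) = ∫ x : Torus d, (0 : ℝ) := by simp
    rw [this]
    refine tendsto_integral_of_dominated_convergence (fun _ => R) (fun k => ?_)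
      (integrable_const _) (fun k => ?_) ?_
    · exact (((hv k).1.inf aestronglyMeasurable_const).sub
        (hw.1.inf aestronglyMeasurable_const)).norm
    · filter_upwards [hv0 k, hw0] with x hx hx'
      rw [Real.norm_eq_abs, abs_abs, abs_le]
      have h1 : 0 ≤ min (v k x) R := le_min hx hR0.le
      have h2 : 0 ≤ min (w x) R := le_min hx' hR0.le
      have h3 := min_le_right (v k x) R
      have h4 := min_le_right (w x) R
      constructor <;> linarith
    · filter_upwards [hlim] with x hx
      have := ((hx.min (tendsto_const_nhds (x := R))).sub_const (min (w x) R)).abs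
      simpa using this
  obtain ⟨K, hK⟩ := Metric.tendsto_atTop.1 hmin (ε / 4) (by positivity)
  refine ⟨K, fun k hk => ?_⟩
  have h1 := hK k hk
  rw [Real.dist_eq, sub_zero, abs_of_nonneg (integral_nonneg fun x => abs_nonneg _)] at h1 ⊢
  have hcut : ∀ a : ℝ, 0 ≤ a → |a - min a R| ≤ a ^ 2 / R := by
    intro a ha
    rcases le_total a R with h | h
    · rw [min_eq_left h, sub_self, abs_zero]
      positivity
    · rw [min_eq_right h, abs_of_nonneg (sub_nonneg.2 h), le_div_iff₀ hR0]
      nlinarith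
  have hmi : Integrable fun x => |min (v k x) R - min (w x) R| :=
    (((hv k).inf (integrable_const R)).sub (hw.inf (integrable_const R))).abs
  have h2 : ∫ x, |v k x - w x| ≤
      ∫ x, (|min (v k x) R - min (w x) R| + (v k x ^ 2 / R + w x ^ 2 / R)) := by
    refine integral_mono_ae ((hv k).sub hw).abs
      (hmi.add (((hv2 k).div_const R).add (hw2.div_const R))) ?_
    filter_upwards [hv0 k, hw0] with x hx hx'
    have e1 := hcut _ hx
    have e2 := hcut _ hx'
    have e3 : v k x - w x = (min (v k x) R - min (w x) R) + ((v k x - min (v k x) R) -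
      (w x - min (w x) R)) := by ring
    rw [e3]
    refine (abs_add_le _ _).trans (add_le_add le_rfl ((abs_sub _ _).trans (add_le_add e1 e2)))
  have hsi : Integrable fun x => v k x ^ 2 / R + w x ^ 2 / R :=
    ((hv2 k).div_const R).add (hw2.div_const R)
  rw [integral_add hmi hsi,
    integral_add ((hv2 k).div_const R) (hw2.div_const R), integral_div, integral_div] at h2
  have h3 : (∫ x, v k x ^ 2) / R + (∫ x, w x ^ 2) / R ≤ 2 * C / R := by
    rw [← add_div]
    gcongr
    linarith [hvC k]
  linarith

/-- The discrete gradient of `V`. -/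
def discreteGrad (N : ℕ+) (V : Lattice d N → ℝ) (x : Lattice d N) : EuclideanSpace ℝ (Fin d) :=
  WithLp.toLp 2 fun i => (N : ℝ) * (V (x + Pi.single i 1) - V x)

lemma memLp_comp_index {E : Type*} [NormedAddCommGroup E] [MeasurableSpace E]
    [BorelSpace E] [SecondCountableTopology E] (N : ℕ+) (G : Lattice d N → E) (p : ℝ≥0∞) :
    MemLp (fun z : Torus d => G (index N z)) p volume := by
  obtain ⟨B, hB⟩ := exists_abs_le_of_finite fun x => ‖G x‖
  exact MemLp.of_bound (measurable_comp_index N G).aestronglyMeasurable B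
    (Eventually.of_forall fun z => (le_abs_self _).trans (hB _))

lemma lintegral_discreteGrad (N : ℕ+) (V : Lattice d N → ℝ) :
    ∫⁻ z : Torus d, ‖discreteGrad N V (index N z)‖ₑ ^ 2 = ENNReal.ofReal (dirichletSum N V) := by
  have h1 : ∀ x, ‖discreteGrad N V x‖ₑ ^ 2 =
      ENNReal.ofReal (∑ i, ((N : ℝ) * (V (x + Pi.single i 1) - V x)) ^ 2) := by
    intro x
    rw [← ofReal_norm, ← ENNReal.ofReal_pow (norm_nonneg _), EuclideanSpace.norm_sq_eq]
    simp [discreteGrad, mul_pow]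
  have h2 := ofReal_integral_eq_lintegral_ofReal
    (integrable_comp_index N fun x => ∑ i, ((N : ℝ) * (V (x + Pi.single i 1) - V x)) ^ 2)
    (Eventually.of_forall fun z => by positivity)
  simp_rw [h1]
  rw [← h2]
  exact congrArg ENNReal.ofReal (integral_comp_index N
    fun x => ∑ i, ((N : ℝ) * (V (x + Pi.single i 1) - V x)) ^ 2)

lemma enorm_Lp_two_sq {E : Type*} [NormedAddCommGroup E] {Ω : Type*} [MeasurableSpace Ω]
    {μ : Measure Ω} (g : Lp E 2 μ) : ∫⁻ x, ‖g x‖ₑ ^ 2 ∂μ = ENNReal.ofReal (‖g‖ ^ 2) := by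
  rw [Lp.norm_def, ENNReal.ofReal_pow ENNReal.toReal_nonneg, ENNReal.ofReal_toReal (Lp.eLpNorm_ne_top g),
    eLpNorm_eq_lintegral_rpow_enorm_toReal two_ne_zero ENNReal.ofNat_ne_top]
  rw [← ENNReal.rpow_natCast, ← ENNReal.rpow_mul, ENNReal.toReal_ofNat]
  norm_num

lemma norm_toLp_discreteGrad_le (N : ℕ+) (V : Lattice d N → ℝ) :
    ‖(memLp_comp_index N (discreteGrad N V) 2).toLp‖ ≤ √(dirichletSum N V) := by
  refine Real.le_sqrt_of_sq_le ?_
  rw [← ENNReal.ofReal_le_ofReal_iff (dirichletSum_nonneg N V), ← enorm_Lp_two_sq,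
    ← lintegral_discreteGrad]
  refine le_of_eq (lintegral_congr_ae ?_)
  filter_upwards [(memLp_comp_index N (discreteGrad N V) 2).coeFn_toLp] with z hz
  rw [hz]

/-- The powers V = f^{α/2} are bounded in L² by the static estimate, so they converge in L¹ to
u^{α/2}. Their discrete gradients have L² norm at most √(αc) and a weak limit of no larger norm.
Pairing them with a smooth φ becomes, after summation by parts, V against uniformly bounded
difference quotients of φ, whose limit is the weak-gradient identity. -/
lemma dissipation_le_of_tendsto_ae [NeZero d] {α : ℝ} (hα : 1 ≤ α) {N : ℕ → ℕ+}
    (hN : Tendsto N atTop atTop) {χ : ℕ → ℝ} {f : ℕ → L1Pos d} {u : L1Pos d}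
    (hf : ∀ k, f k ∈ configurations d (χ k) (N k)) {M : ℝ} (hM : ∀ k, ∫ x, f k x ≤ M)
    (hlim : ∀ᵐ x, Tendsto (fun k => f k x) atTop (𝓝 (u x))) {c : ℝ}
    (hc : ∀ k, discreteDissipation α (N k) (f k) ≤ c) :
    dissipation α u ≤ ENNReal.ofReal (2 * c) := by
  have hα0 : 0 < α := by linarith
  obtain ⟨C, hC0, hC⟩ := exists_static_bound d hα M
  set V : ∀ k, Lattice d (N k) → ℝ := fun k x => siteValue (N k) (f k) x ^ (α / 2) with hV
  have hV0 : ∀ k x, 0 ≤ V k x := fun k x => Real.rpow_nonneg (siteValue_nonneg _ _ _) _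
  have hD : ∀ k, dirichletSum (N k) (V k) ≤ α * c := by
    intro k
    have h1 := hc k
    rw [discreteDissipation_eq, inv_mul_le_iff₀ hα0] at h1
    exact h1
  have hc0 : 0 ≤ c := by
    have h1 := (dirichletSum_nonneg (N 0) (V 0)).trans (hD 0)
    exact nonneg_of_mul_nonneg_right h1 hα0
  set C' : ℝ := C * (1 + α * c) with hC'
  have hC'0 : 0 ≤ C' := by positivity
  have hVsq : ∀ k, ∫ z : Torus d, V k (index (N k) z) ^ 2 ≤ C' := by
    intro k
    have hm : ∫ z : Torus d, siteValue (N k) (f k) (index (N k) z) ≤ M := by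
      rw [← integral_congr_ae (ae_eq_siteValue (hf k))]
      exact hM k
    have h1 := (hC (N k) (siteValue (N k) (f k)) (siteValue_nonneg _ _) hm).2.1
    have h2 : ∀ z, V k (index (N k) z) ^ 2 = siteValue (N k) (f k) (index (N k) z) ^ α := by
      intro z
      simp only [hV]
      rw [← Real.rpow_natCast, ← Real.rpow_mul (siteValue_nonneg _ _ _)]
      congr 1
      push_cast
      ring
    simp_rw [h2]
    exact h1.trans (mul_le_mul_of_nonneg_left (add_le_add le_rfl (hD k)) hC0)
  set v : Torus d → ℝ := fun x => u x ^ (α / 2) with hv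
  have hvm : AEStronglyMeasurable v volume :=
    ((integrable_coe u).1.aemeasurable.pow_const _).aestronglyMeasurable
  have hv0 : ∀ᵐ x, 0 ≤ v x := by
    filter_upwards [coe_nonneg u] with x hx using Real.rpow_nonneg hx _
  have hvlim : ∀ᵐ x, Tendsto (fun k => V k (index (N k) x)) atTop (𝓝 (v x)) := by
    filter_upwards [hlim, ae_all_iff.2 fun k => ae_eq_siteValue (hf k)] with x hx hx'
    simp only [hV]
    simp_rw [← hx']
    exact (Real.continuousAt_rpow_const _ _ (Or.inr (by positivity))).tendsto.comp hx
  have hvsq : ∫⁻ x, ENNReal.ofReal (v x ^ 2) ≤ ENNReal.ofReal C' := by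
    calc ∫⁻ x, ENNReal.ofReal (v x ^ 2)
        = ∫⁻ x, liminf (fun k => ENNReal.ofReal (V k (index (N k) x) ^ 2)) atTop := by
          refine lintegral_congr_ae ?_
          filter_upwards [hvlim] with x hx
          exact (Tendsto.liminf_eq (ENNReal.tendsto_ofReal (hx.pow 2))).symm
      _ ≤ liminf (fun k => ∫⁻ x : Torus d, ENNReal.ofReal (V k (index (N k) x) ^ 2)) atTop :=
          lintegral_liminf_le fun k =>
            measurable_comp_index (N k) fun x => ENNReal.ofReal (V k x ^ 2)
      _ ≤ ENNReal.ofReal C' :=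
          liminf_le_of_le (by isBoundedDefault) fun b hb => by
            obtain ⟨k, hk⟩ := hb.exists
            refine hk.trans ?_
            rw [← ofReal_integral_eq_lintegral_ofReal
              (integrable_comp_index (N k) fun x => V k x ^ 2)
              (Eventually.of_forall fun z => by positivity)]
            exact ENNReal.ofReal_le_ofReal (hVsq k)
  have hv2i : Integrable fun x => v x ^ 2 := by
    refine ⟨hvm.pow 2, ?_⟩
    rw [hasFiniteIntegral_iff_ofReal (Eventually.of_forall fun x => sq_nonneg _)]
    exact hvsq.trans_lt ENNReal.ofReal_lt_top
  have hv2C : ∫ x, v x ^ 2 ≤ C' := by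
    rwa [← ENNReal.ofReal_le_ofReal_iff hC'0,
      ofReal_integral_eq_lintegral_ofReal hv2i (Eventually.of_forall fun x => sq_nonneg _)]
  have hvi : Integrable v := ((memLp_two_iff_integrable_sq hvm).2 hv2i).integrable one_le_two
  have hL1 := tendsto_integral_abs_sub_of_sq_bound
    (fun k => integrable_comp_index (N k) (V k))
    (fun k => integrable_comp_index (N k) fun x => V k x ^ 2) hvi hv2i
    (fun k => Eventually.of_forall fun z => hV0 k _) hv0 hVsq hv2C hvlim
  set G : ℕ → Lp (EuclideanSpace ℝ (Fin d)) 2 (volume : Measure (Torus d)) := fun k =>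
    (memLp_comp_index (N k) (discreteGrad (N k) (V k)) 2).toLp with hG
  obtain ⟨g, hg, hgw⟩ := exists_weak_limit G (r := √(α * c)) fun k =>
    (norm_toLp_discreteGrad_le _ _).trans (Real.sqrt_le_sqrt (hD k))
  have hweak : IsWeakGradient v g := by
    refine ⟨hvi, Lp.memLp g, fun φ hφ i => ?_⟩
    have hφc := hφ.continuous
    obtain ⟨K, hK⟩ := hφ.exists_abs_backwardDiff_le
    set ψ : C(Torus d, EuclideanSpace ℝ (Fin d)) :=
      ⟨fun x => φ x • EuclideanSpace.single i 1, by fun_prop⟩ with hψ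
    set Ψ := ContinuousMap.toLp 2 (volume : Measure (Torus d)) ℝ ψ with hΨ
    have hin : ∀ w : Lp (EuclideanSpace ℝ (Fin d)) 2 (volume : Measure (Torus d)),
        inner ℝ w Ψ = ∫ x, w x i * φ x := by
      intro w
      rw [L2.inner_def]
      refine integral_congr_ae ?_
      filter_upwards [ContinuousMap.coeFn_toLp (𝕜 := ℝ) (p := 2) volume ψ] with x hx
      rw [hx]
      simp [hψ, real_inner_smul_right, EuclideanSpace.inner_single_right, mul_comm]
    have hGin : ∀ k, inner ℝ (G k) Ψ =
        -∫ z, V k (index (N k) z) * backwardDiff (N k) i φ z := by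
      intro k
      rw [hin, integral_mul_backwardDiff _ _ _ hφc, neg_neg]
      refine integral_congr_ae ?_
      filter_upwards [(memLp_comp_index (N k) (discreteGrad (N k) (V k)) 2).coeFn_toLp] with z hz
      simp only [hG]
      rw [hz]
      simp [discreteGrad]
    have hbm : ∀ k, AEStronglyMeasurable (backwardDiff (N k) i φ) volume := fun k => by
      have : Continuous (backwardDiff (N k) i φ) := by
        unfold backwardDiff
        fun_prop
      exact this.aestronglyMeasurable
    have hconv : Tendsto (fun k => ∫ z, V k (index (N k) z) * backwardDiff (N k) i φ z) atTop
        (𝓝 (∫ z, v z * partialDeriv i φ z)) := by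
      have h1 : Tendsto (fun k => ∫ z, v z * backwardDiff (N k) i φ z) atTop
          (𝓝 (∫ z, v z * partialDeriv i φ z)) := by
        refine tendsto_integral_of_dominated_convergence (fun z => ‖v z‖ * K)
          (fun k => hvm.mul (hbm k)) (hvi.norm.mul_const K)
          (fun k => Eventually.of_forall fun z => ?_) (Eventually.of_forall fun z => ?_)
        · rw [norm_mul]
          exact mul_le_mul_of_nonneg_left (hK _ _ _) (norm_nonneg _)
        · exact tendsto_const_nhds.mul ((hφ.tendsto_backwardDiff i z).comp hN)
      have h2 : Tendsto (fun k => (∫ z, V k (index (N k) z) * backwardDiff (N k) i φ z) -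
          ∫ z, v z * backwardDiff (N k) i φ z) atTop (𝓝 0) := by
        refine squeeze_zero_norm (a := fun k => K * ∫ z, |V k (index (N k) z) - v z|)
          (fun k => ?_) (by simpa using hL1.const_mul K)
        have e1 : Integrable fun z => V k (index (N k) z) * backwardDiff (N k) i φ z := by
          simpa only [mul_comm] using (integrable_comp_index (N k) (V k)).bdd_mul (hbm k)
            (Eventually.of_forall fun z => hK (N k) i z)
        have e2 : Integrable fun z => v z * backwardDiff (N k) i φ z := by
          simpa only [mul_comm] using hvi.bdd_mul (hbm k)
            (Eventually.of_forall fun z => hK (N k) i z)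
        rw [← integral_sub e1 e2, ← integral_const_mul]
        refine norm_integral_le_of_norm_le
          (((integrable_comp_index (N k) (V k)).sub hvi).abs.const_mul K)
          (Eventually.of_forall fun z => ?_)
        rw [← sub_mul, norm_mul, mul_comm]
        exact mul_le_mul_of_nonneg_right (hK _ _ _) (norm_nonneg _)
      simpa using h2.add h1
    have h3 := hgw Ψ (-∫ z, v z * partialDeriv i φ z) (by
      simp_rw [hGin]
      exact hconv.neg)
    rw [hin] at h3
    linarith
  calc dissipation α u ≤ ENNReal.ofReal (2 / α) * ∫⁻ x, ‖g x‖ₑ ^ 2 := iInf₂_le (g : Torus d → _) hweak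
    _ ≤ ENNReal.ofReal (2 / α) * ENNReal.ofReal (α * c) := by
        rw [enorm_Lp_two_sq]
        gcongr
        calc ‖g‖ ^ 2 ≤ √(α * c) ^ 2 := by gcongr
          _ = α * c := Real.sq_sqrt (by positivity)
    _ = ENNReal.ofReal (2 * c) := by
        rw [← ENNReal.ofReal_mul (by positivity)]
        congr 1
        field_simp

/-- For c above the liminf, one subsequence has dissipation below c and L¹ distance to u below 1,
which bounds the masses; a further one converges almost everywhere. -/
lemma half_dissipation_le_liminf [NeZero d] {α : ℝ} (hα : 1 ≤ α) {N : ℕ → ℕ+}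
    (hN : Tendsto N atTop atTop) {χ : ℕ → ℝ} {f : ℕ → L1Pos d} {u : L1Pos d}
    (hf : ∀ k, f k ∈ configurations d (χ k) (N k))
    (hlim : Tendsto (fun k => ∫⁻ x, ‖f k x - u x‖ₑ) atTop (𝓝 0)) :
    2⁻¹ * dissipation α u ≤
      liminf (fun k => ENNReal.ofReal (discreteDissipation α (N k) (f k))) atTop := by
  refine le_of_forall_gt_imp_ge_of_dense fun c hc => ?_
  rcases eq_or_ne c ⊤ with rfl | hct
  · exact le_top
  have hfr := (frequently_lt_of_liminf_lt (by isBoundedDefault) hc).and_eventually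
    (hlim.eventually (gt_mem_nhds zero_lt_one))
  obtain ⟨ns, hns, hns'⟩ := extraction_of_frequently_atTop hfr
  have hm : TendstoInMeasure volume (fun k => (f (ns k) : Torus d → ℝ)) atTop u := by
    refine tendstoInMeasure_of_tendsto_eLpNorm one_ne_zero
      (fun k => (integrable_coe (f (ns k))).1) (integrable_coe u).1 ?_
    simp_rw [eLpNorm_one_eq_lintegral_enorm]
    exact hlim.comp hns.tendsto_atTop
  obtain ⟨ms, hms, hae⟩ := hm.exists_seq_tendsto_ae
  have key := dissipation_le_of_tendsto_ae hα (N := fun k => N (ns (ms k)))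
    (hN.comp (hns.tendsto_atTop.comp hms.tendsto_atTop)) (χ := fun k => χ (ns (ms k)))
    (f := fun k => f (ns (ms k))) (u := u) (fun k => hf _) (M := (∫ x, u x) + 1) (fun k => ?_) hae
    (c := c.toReal) (fun k => ?_)
  · calc 2⁻¹ * dissipation α u ≤ 2⁻¹ * ENNReal.ofReal (2 * c.toReal) := by gcongr
      _ = c := by
        rw [ENNReal.ofReal_mul zero_le_two, ENNReal.ofReal_toReal hct, ENNReal.ofReal_ofNat,
          ← mul_assoc, ENNReal.inv_mul_cancel two_ne_zero ENNReal.ofNat_ne_top, one_mul]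
  · have h1 := (hns' (ms k)).2
    have h2 : ∫ x, (f (ns (ms k)) x - u x) ≤ 1 := by
      refine (Real.le_norm_self _).trans ((norm_integral_le_lintegral_norm _).trans ?_)
      refine ENNReal.toReal_le_of_le_ofReal zero_le_one ?_
      simp_rw [ofReal_norm]
      simpa using h1.le
    rw [integral_sub (integrable_coe _) (integrable_coe u)] at h2
    linarith
  · exact (ENNReal.ofReal_le_iff_le_toReal hct).1 (hns' (ms k)).1.le

/-! ### Skorokhod topology -/

/-- The centres of balls contained in the given ball form an open set: halve the entourage and the
time tolerance, and compose the time changes. -/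
lemma skorokhodBall_mem_nhds {T : ℝ} {E : Type*} [UniformSpace E] (u : Skorokhod T E)
    {V : Set (E × E)} (hV : V ∈ uniformity E) {ε : ℝ} (hε : 0 < ε) :
    skorokhodBall u V ε ∈ 𝓝 u := by
  set W : Set (Skorokhod T E) :=
    {v | ∃ V' ∈ uniformity E, ∃ ε' > 0, skorokhodBall v V' ε' ⊆ skorokhodBall u V ε} with hW
  have hself : ∀ (v : Skorokhod T E) (V' : Set (E × E)) (ε' : ℝ), V' ∈ uniformity E → 0 < ε' →
      v ∈ skorokhodBall v V' ε' := fun v V' ε' hV' hε' =>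
    ⟨OrderIso.refl _, fun t => by simpa using hε', fun t => refl_mem_uniformity hV'⟩
  have hopen : IsOpen W := by
    rintro v ⟨V', hV', ε', hε', hsub⟩
    obtain ⟨V'', hV'', hcomp⟩ := comp_mem_uniformity_sets hV'
    refine ⟨V'', hV'', ε' / 2, by positivity, ?_⟩
    rintro w ⟨σ, hσ, hσ'⟩
    refine ⟨V'', hV'', ε' / 2, by positivity, ?_⟩
    rintro x ⟨τ, hτ, hτ'⟩
    refine hsub ⟨σ.trans τ, fun t => ?_, fun t => hcomp ⟨w (σ t), hσ' t, hτ' (σ t)⟩⟩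
    have h1 := hσ t
    have h2 := hτ (σ t)
    calc |((σ.trans τ) t : ℝ) - t| ≤ |(τ (σ t) : ℝ) - σ t| + |(σ t : ℝ) - t| := abs_sub_le _ _ _
      _ < ε' := by linarith
  refine mem_nhds_iff.2 ⟨W, ?_, hopen, ⟨V, hV, ε, hε, Subset.rfl⟩⟩
  rintro v ⟨V', hV', ε', hε', hsub⟩
  exact hsub (hself v V' ε' hV' hε')

variable {T : ℝ}

lemma uniformContinuous_pairing (φ : C(Torus d, ℝ)) :
    UniformContinuous fun u : L1Pos d => pairing u φ := by
  have h : UniformContinuous (pairing : L1Pos d → (C(Torus d, ℝ) → ℝ)) := uniformContinuous_comap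
  exact (Pi.uniformContinuous_proj (fun _ : C(Torus d, ℝ) => ℝ) φ).comp h

lemma pairing_entourage_mem (φ : C(Torus d, ℝ)) {ε : ℝ} (hε : 0 < ε) :
    {p : L1Pos d × L1Pos d | |pairing p.1 φ - pairing p.2 φ| < ε} ∈ uniformity (L1Pos d) :=
  uniformContinuous_pairing φ (Metric.dist_mem_uniformity hε)

/-- Convergence of paths in the Skorokhod sense, tested with one continuous function at a time. -/
def TestedConvergence (η : ℕ → PathSpace d T) (u : PathSpace d T) : Prop :=
  ∀ (φ : C(Torus d, ℝ)) (ε : ℝ), 0 < ε → ∀ᶠ k in atTop,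
    ∃ σ : Icc (0 : ℝ) T ≃o Icc (0 : ℝ) T, (∀ t, |(σ t : ℝ) - (t : ℝ)| < ε) ∧
      ∀ t, |pairing (u t) φ - pairing (η k (σ t)) φ| < ε

lemma TestedConvergence.of_tendsto {η : ℕ → PathSpace d T} {u : PathSpace d T}
    (h : Tendsto η atTop (𝓝 u)) : TestedConvergence η u := fun φ _ε hε =>
  h.eventually (skorokhodBall_mem_nhds u (pairing_entourage_mem φ hε) hε)

/-! ### Càdlàg paths -/

lemma continuousWithinAt_pairing (u : PathSpace d T) (φ : C(Torus d, ℝ)) (t : Icc (0 : ℝ) T) :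
    ContinuousWithinAt (fun s => pairing (u s) φ) (Ici t) t :=
  (uniformContinuous_pairing φ).continuous.continuousAt.comp_continuousWithinAt (u.2 t).1

lemma exists_tendsto_pairing_left (u : PathSpace d T) (φ : C(Torus d, ℝ)) (t : Icc (0 : ℝ) T) :
    ∃ l, Tendsto (fun s => pairing (u s) φ) (𝓝[<] t) (𝓝 l) := by
  obtain ⟨l, hl⟩ := (u.2 t).2
  exact ⟨pairing l φ, ((uniformContinuous_pairing φ).continuous.tendsto l).comp hl⟩

/-- Each time is approximated from the right by the next grid point of mesh 1/(n+1), capped at T.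
The approximating functions depend on t only through an integer, and right continuity gives the
pointwise limit. -/
lemma measurable_of_continuousWithinAt_Ici {g : Icc (0 : ℝ) T → ℝ}
    (hg : ∀ t, ContinuousWithinAt g (Ici t) t) : Measurable g := by
  rcases lt_or_ge T 0 with hT | hT
  · have : IsEmpty (Icc (0 : ℝ) T) := isEmpty_coe_sort.2 (Icc_eq_empty (not_le.2 hT))
    exact measurable_of_empty g
  let r : ℕ → Icc (0 : ℝ) T → Icc (0 : ℝ) T := fun n t =>
    projIcc 0 T hT ((⌊((n : ℝ) + 1) * t⌋ + 1) / ((n : ℝ) + 1))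
  have hge : ∀ (n : ℕ) (t : Icc (0 : ℝ) T),
      (t : ℝ) ≤ (⌊((n : ℝ) + 1) * t⌋ + 1) / ((n : ℝ) + 1) := by
    intro n t
    rw [le_div_iff₀ (by positivity), mul_comm]
    exact (Int.lt_floor_add_one _).le
  have hle : ∀ (n : ℕ) (t : Icc (0 : ℝ) T),
      (⌊((n : ℝ) + 1) * t⌋ + 1) / ((n : ℝ) + 1) ≤ (t : ℝ) + 1 / ((n : ℝ) + 1) := by
    intro n t
    rw [add_div]
    gcongr
    rw [div_le_iff₀ (by positivity), mul_comm]
    exact Int.floor_le _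
  have hr : ∀ t, Tendsto (fun n => r n t) atTop (𝓝[≥] t) := by
    intro t
    refine tendsto_nhdsWithin_iff.2 ⟨?_, Eventually.of_forall fun n => ?_⟩
    · have h1 : Tendsto (fun n : ℕ => ((⌊((n : ℝ) + 1) * t⌋ + 1) / ((n : ℝ) + 1) : ℝ)) atTop
          (𝓝 (t : ℝ)) := by
        refine tendsto_of_tendsto_of_tendsto_of_le_of_le tendsto_const_nhds ?_
          (fun n => hge n t) (fun n => hle n t)
        simpa using (tendsto_const_nhds (x := (t : ℝ))).add
          (tendsto_one_div_add_atTop_nhds_zero_nat (𝕜 := ℝ))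
      have h2 := ((continuous_projIcc (h := hT)).tendsto (t : ℝ)).comp h1
      rwa [projIcc_val] at h2
    · have h1 := monotone_projIcc hT (hge n t)
      rwa [projIcc_val] at h1
  refine measurable_of_tendsto_metrizable (f := fun n t => g (r n t)) (fun n => ?_) ?_
  · have h1 : Measurable fun k : ℤ => g (projIcc 0 T hT (((k : ℝ) + 1) / ((n : ℝ) + 1))) :=
      measurable_from_top
    exact h1.comp (Int.measurable_floor.comp (measurable_subtype_coe.const_mul _))
  · exact tendsto_pi_nhds.2 fun t => (hg t).tendsto.comp (hr t)

lemma measurable_pairing (u : PathSpace d T) (φ : C(Torus d, ℝ)) :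
    Measurable fun t => pairing (u t) φ :=
  measurable_of_continuousWithinAt_Ici (continuousWithinAt_pairing u φ)

lemma eventually_nhdsNE_oscillation_lt {g : Icc (0 : ℝ) T → ℝ} (x : Icc (0 : ℝ) T)
    (hr : ContinuousWithinAt g (Ici x) x) (hl : ∃ l, Tendsto g (𝓝[<] x) (𝓝 l)) {ε : ℝ}
    (hε : 0 < ε) : ∀ᶠ t in 𝓝[≠] x, ∀ᶠ s in 𝓝 t, |g s - g t| < ε := by
  have key : ∀ (S : Set (Icc (0 : ℝ) T)) (l : ℝ), IsOpen S → Tendsto g (𝓝[S] x) (𝓝 l) →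
      ∀ᶠ t in 𝓝[S] x, ∀ᶠ s in 𝓝 t, |g s - g t| < ε := by
    intro S l hS hgl
    have h1 : ∀ᶠ s in 𝓝[S] x, |g s - l| < ε / 2 :=
      hgl.eventually (Metric.ball_mem_nhds l (half_pos hε))
    filter_upwards [eventually_eventually_nhdsWithin.2 h1, h1, self_mem_nhdsWithin] with t ht ht' htS
    rw [hS.nhdsWithin_eq htS] at ht
    filter_upwards [ht] with s hs
    have := abs_sub_le (g s) l (g t)
    rw [abs_sub_comm l] at this
    linarith
  obtain ⟨l, hl⟩ := hl
  rw [← nhdsLT_sup_nhdsGT, eventually_sup]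
  exact ⟨key _ l isOpen_Iio hl, key _ (g x) isOpen_Ioi
    (hr.tendsto.mono_left (nhdsWithin_mono _ Ioi_subset_Ici_self))⟩

/-- By `eventually_nhdsNE_oscillation_lt`, the points where g oscillates by at least a fixed amount
cannot accumulate. By compactness there are finitely many for each threshold 1/(n+1). -/
lemma countable_not_continuousAt {g : Icc (0 : ℝ) T → ℝ}
    (hr : ∀ x, ContinuousWithinAt g (Ici x) x) (hl : ∀ x, ∃ l, Tendsto g (𝓝[<] x) (𝓝 l)) :
    {t | ¬ContinuousAt g t}.Countable := by
  have hsub : {t | ¬ContinuousAt g t} ⊆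
      ⋃ n : ℕ, {t | ¬∀ᶠ s in 𝓝 t, |g s - g t| < 1 / ((n : ℝ) + 1)} := by
    intro t ht
    by_contra hcon
    refine ht (Metric.tendsto_nhds.2 fun ε hε => ?_)
    obtain ⟨n, hn⟩ := exists_nat_one_div_lt hε
    have h1 : ∀ᶠ s in 𝓝 t, |g s - g t| < 1 / ((n : ℝ) + 1) := by
      by_contra h2
      exact hcon (mem_iUnion.2 ⟨n, h2⟩)
    filter_upwards [h1] with s hs
    rw [Real.dist_eq]
    exact hs.trans hn
  refine (countable_iUnion fun n => Set.Finite.countable ?_).mono hsub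
  by_contra hinf
  obtain ⟨x, -, hx⟩ := Set.Infinite.exists_accPt_of_subset_isCompact hinf isCompact_univ
    (subset_univ _)
  have h1 := eventually_nhdsNE_oscillation_lt x (hr x) (hl x)
    (show (0 : ℝ) < 1 / ((n : ℝ) + 1) by positivity)
  obtain ⟨t, ht, ht'⟩ := ((accPt_iff_frequently_nhdsNE.1 hx).and_eventually h1).exists
  exact ht ht'

lemma timeMeasure_apply_countable {S : Set (Icc (0 : ℝ) T)} (hS : S.Countable) :
    timeMeasure T S = 0 := by
  rw [timeMeasure, comap_subtype_coe_apply measurableSet_Icc]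
  exact (hS.image _).measure_zero volume

/-- At a continuity time t of the limiting pairing, evaluate the comparison at σ⁻¹(t), which is
close to t. The exceptional times are countable, hence null. -/
lemma TestedConvergence.ae_tendsto_pairing {η : ℕ → PathSpace d T} {u : PathSpace d T}
    (h : TestedConvergence η u) (φ : C(Torus d, ℝ)) :
    ∀ᵐ t ∂timeMeasure T, Tendsto (fun k => pairing (η k t) φ) atTop (𝓝 (pairing (u t) φ)) := by
  have h0 : timeMeasure T {t | ¬ContinuousAt (fun s => pairing (u s) φ) t} = 0 :=
    timeMeasure_apply_countable (countable_not_continuousAt (continuousWithinAt_pairing u φ)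
      (exists_tendsto_pairing_left u φ))
  have h1 : ∀ᵐ t ∂timeMeasure T, ContinuousAt (fun s => pairing (u s) φ) t := h0
  filter_upwards [h1] with t ht
  rw [Metric.tendsto_nhds]
  intro ε hε
  obtain ⟨δ, hδ, hδ'⟩ := Metric.continuousAt_iff.1 ht (ε / 2) (half_pos hε)
  filter_upwards [h φ (min δ (ε / 2)) (lt_min hδ (half_pos hε))] with k hk
  obtain ⟨σ, hσ, hσ'⟩ := hk
  have e1 := hσ (σ.symm t)
  have e2 := hσ' (σ.symm t)
  rw [OrderIso.apply_symm_apply] at e1 e2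
  have e3 : dist (σ.symm t) t < δ := by
    rw [Subtype.dist_eq, Real.dist_eq, abs_sub_comm]
    exact e1.trans_le (min_le_left _ _)
  have e4 := hδ' e3
  have e5 := e2.trans_le (min_le_right _ _)
  rw [Real.dist_eq] at e4 ⊢
  have := abs_sub_le (pairing (η k t) φ) (pairing (u (σ.symm t)) φ) (pairing (u t) φ)
  rw [abs_sub_comm] at e5
  linarith

lemma abs_pairing_sub_pairing_le (f : L1Pos d) (φ ψ : C(Torus d, ℝ)) :
    |pairing f φ - pairing f ψ| ≤ ‖φ - ψ‖ * ∫ x, f x := by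
  rw [pairing, pairing, ← integral_sub (integrable_continuousMap_mul φ (integrable_coe f))
    (integrable_continuousMap_mul ψ (integrable_coe f)), ← integral_const_mul, ← Real.norm_eq_abs]
  refine norm_integral_le_of_norm_le ((integrable_coe f).const_mul _) ?_
  filter_upwards [coe_nonneg f] with x hx
  rw [← sub_mul, norm_mul, Real.norm_of_nonneg hx]
  exact mul_le_mul_of_nonneg_right ((φ - ψ).norm_coe_le_norm x) hx

lemma tendsto_pairing_of_dense {f : ℕ → L1Pos d} {u : L1Pos d} {M : ℝ}
    (hM : ∀ k, ∫ x, f k x ≤ M) {ψ : ℕ → C(Torus d, ℝ)} (hψ : DenseRange ψ)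
    (h : ∀ j, Tendsto (fun k => pairing (f k) (ψ j)) atTop (𝓝 (pairing u (ψ j))))
    (φ : C(Torus d, ℝ)) : Tendsto (fun k => pairing (f k) φ) atTop (𝓝 (pairing u φ)) := by
  set M' : ℝ := max M (∫ x, u x) with hM'
  have hM0 : 0 ≤ M' := (integral_nonneg_of_ae (coe_nonneg u)).trans (le_max_right _ _)
  rw [Metric.tendsto_nhds]
  intro ε hε
  obtain ⟨j, hj⟩ := hψ.exists_dist_lt φ (show 0 < ε / (3 * (M' + 1)) by positivity)
  rw [dist_eq_norm] at hj
  have hb : ∀ g : L1Pos d, ∫ x, g x ≤ M' → |pairing g φ - pairing g (ψ j)| < ε / 3 := by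
    intro g hg
    have h1 : ‖φ - ψ j‖ * ∫ x, g x ≤ ε / (3 * (M' + 1)) * M' :=
      mul_le_mul hj.le hg (integral_nonneg_of_ae (coe_nonneg g)) (by positivity)
    have h2 : ε / (3 * (M' + 1)) * M' < ε / 3 := by
      rw [div_mul_eq_mul_div, div_lt_div_iff₀ (by positivity) (by positivity)]
      nlinarith
    exact ((abs_pairing_sub_pairing_le g φ (ψ j)).trans h1).trans_lt h2
  filter_upwards [Metric.tendsto_nhds.1 (h j) (ε / 3) (by positivity)] with k hk
  have h1 := hb (f k) ((hM k).trans (le_max_left _ _))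
  have h2 := hb u (le_max_right _ _)
  rw [Real.dist_eq] at hk ⊢
  have e : pairing (f k) φ - pairing u φ = (pairing (f k) φ - pairing (f k) (ψ j)) +
    (pairing (f k) (ψ j) - pairing u (ψ j)) - (pairing u φ - pairing u (ψ j)) := by ring
  rw [abs_lt] at *
  constructor <;> linarith [e]

/-- A countable dense set of test functions makes the null set of times independent of φ; the mass
bound extends convergence to all φ. -/
lemma TestedConvergence.ae_forall_tendsto_pairing {η : ℕ → PathSpace d T} {u : PathSpace d T}
    (h : TestedConvergence η u) {M : ℝ} (hM : ∀ k t, ∫ x, η k t x ≤ M) :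
    ∀ᵐ t ∂timeMeasure T, ∀ φ : C(Torus d, ℝ),
      Tendsto (fun k => pairing (η k t) φ) atTop (𝓝 (pairing (u t) φ)) := by
  filter_upwards [ae_all_iff.2 fun j : ℕ =>
    h.ae_tendsto_pairing (TopologicalSpace.denseSeq C(Torus d, ℝ) j)] with t ht
  exact tendsto_pairing_of_dense (fun k => hM k t) (TopologicalSpace.denseRange_denseSeq _) ht

/-! ### Lattice paths as space-time functions -/

lemma pairing_eq_of_configurations {χ : ℝ} {N : ℕ+} {f : L1Pos d} (hf : f ∈ configurations d χ N)
    (φ : C(Torus d, ℝ)) : pairing f φ = ∫ z, φ z * siteValue N f (index N z) := by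
  refine integral_congr_ae ?_
  filter_upwards [ae_eq_siteValue hf] with z hz
  rw [hz]

lemma index_eq_of_norm_sub_lt (N : ℕ+) (x : Lattice d N) (z : Torus d)
    (h : ‖z - latticePoint N x‖ < 1 / (2 * (N : ℝ))) : index N z = x := by
  rw [← mem_cube_iff]
  intro i
  have h1 : ‖z i - (((x i).val / (N : ℝ) : ℝ) : UnitAddCircle)‖ < 1 / (2 * (N : ℝ)) :=
    (norm_le_pi_norm (z - latticePoint N x) i).trans_lt h
  obtain ⟨s, hs⟩ := QuotientAddGroup.mk_surjective (z i - (((x i).val / (N : ℝ) : ℝ) : UnitAddCircle))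
  change (s : UnitAddCircle) = _ at hs
  rw [← hs, UnitAddCircle.norm_eq, abs_lt] at h1
  refine ⟨s - round s, ⟨h1.1.le, h1.2⟩, ?_⟩
  have h2 : ((round s : ℝ) : UnitAddCircle) = 0 :=
    AddCircle.coe_eq_zero_iff (1 : ℝ) |>.2 ⟨round s, by simp⟩
  rw [AddCircle.coe_add, AddCircle.coe_sub, h2, sub_zero, hs]
  abel

/-- A normalised bump supported in one box expresses the site value as a weak-⋆ continuous
functional, which yields its measurability in time along a path. -/
lemma exists_pairing_eq_siteValue (N : ℕ+) (x : Lattice d N) :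
    ∃ φ : C(Torus d, ℝ), ∀ (χ : ℝ) (f : L1Pos d), f ∈ configurations d χ N →
      pairing f φ = siteValue N f x := by
  have hN : (0 : ℝ) < N := by exact_mod_cast N.pos
  let τ : C(Torus d, ℝ) := ⟨fun z => max 0 (1 / (2 * (N : ℝ)) - ‖z - latticePoint N x‖), by fun_prop⟩
  have hτ0 : ∀ h, 0 ≤ τ h := fun h => le_max_left _ _
  have hpos : 0 < ∫ h, τ h := by
    refine τ.continuous.integral_pos_of_hasCompactSupport_nonneg_nonzero
      (HasCompactSupport.of_compactSpace _) hτ0 (x := latticePoint N x) ?_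
    have : 0 < 1 / (2 * (N : ℝ)) := by positivity
    simp only [τ, ContinuousMap.coe_mk, sub_self, norm_zero, sub_zero]
    exact (lt_max_of_lt_right this).ne'
  refine ⟨(∫ h, τ h)⁻¹ • τ, fun χ f hf => ?_⟩
  rw [pairing_eq_of_configurations hf]
  have h1 : ∀ z, ((∫ h, τ h)⁻¹ • τ) z * siteValue N f (index N z) =
      (∫ h, τ h)⁻¹ * siteValue N f x * τ z := by
    intro z
    simp only [ContinuousMap.smul_apply, smul_eq_mul]
    by_cases h0 : τ z = 0
    · simp [h0]
    · have : index N z = x := by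
        refine index_eq_of_norm_sub_lt N x z ?_
        by_contra hlt
        exact h0 (max_eq_left (by linarith [not_lt.1 hlt]))
      rw [this]
      ring
  simp_rw [h1]
  rw [integral_const_mul]
  field_simp

lemma measurable_siteValue {χ : ℝ} {N : ℕ+} {η : PathSpace d T}
    (hη : η ∈ latticePaths d T χ N) (x : Lattice d N) :
    Measurable fun t => siteValue N (η t) x := by
  obtain ⟨φ, hφ⟩ := exists_pairing_eq_siteValue N x
  simp_rw [← fun t => hφ χ (η t) (hη t)]
  exact measurable_pairing η φ

/-- The lattice path `η` as an everywhere defined function on `[0, T] × 𝕋ᵈ`. -/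
def latticeFun (N : ℕ+) (η : PathSpace d T) (p : Icc (0 : ℝ) T × Torus d) : ℝ :=
  siteValue N (η p.1) (index N p.2)

lemma measurable_latticeFun {χ : ℝ} {N : ℕ+} {η : PathSpace d T}
    (hη : η ∈ latticePaths d T χ N) : Measurable (latticeFun N η) := by
  have h1 : latticeFun N η = fun p =>
      ∑ x, siteValue N (η p.1) x * (if index N p.2 = x then 1 else 0) := by
    funext p
    simp [latticeFun]
  rw [h1]
  refine Finset.measurable_sum _ fun x _ => ?_
  have h2 : Measurable fun z : Torus d => if index N z = x then (1 : ℝ) else 0 :=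
    measurable_comp_index N fun y => if y = x then (1 : ℝ) else 0
  exact ((measurable_siteValue hη x).comp measurable_fst).mul (h2.comp measurable_snd)

lemma latticeFun_nonneg (N : ℕ+) (η : PathSpace d T) (p) : 0 ≤ latticeFun N η p :=
  siteValue_nonneg _ _ _

lemma measurable_discreteDissipation {χ : ℝ} {N : ℕ+} {η : PathSpace d T}
    (hη : η ∈ latticePaths d T χ N) (α : ℝ) :
    Measurable fun t => discreteDissipation α N (η t) := by
  unfold discreteDissipation
  refine Measurable.const_mul (Finset.measurable_sum _ fun x _ => Finset.measurable_sum _ fun y _ =>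
    Measurable.mul_const ?_ _) _
  exact (((measurable_siteValue hη x).pow_const _).sub ((measurable_siteValue hη y).pow_const _)).pow_const 2

lemma timeMeasure_univ (T : ℝ) : timeMeasure T univ = ENNReal.ofReal T := by
  rw [timeMeasure, comap_subtype_coe_apply measurableSet_Icc, image_univ, Subtype.range_coe,
    Real.volume_Icc, sub_zero]

instance (T : ℝ) : IsFiniteMeasure (timeMeasure T) := ⟨by simp [timeMeasure_univ]⟩

instance (d : ℕ) (T : ℝ) : IsFiniteMeasure (spaceTime d T) := by
  unfold spaceTime
  infer_instance

/-! ### Space-time bounds -/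

section Bounds

variable {χ : ℝ} {N : ℕ+} {η : PathSpace d T} {α : ℝ} {z : ℝ≥0}

lemma entropy_le_of_discreteF_le (hF : discreteF α N η ≤ z) (t) : entropy (η t) ≤ z :=
  (le_iSup (fun t => entropy (η t)) t).trans ((le_add_right le_rfl).trans hF)

lemma mass_le_of_discreteF_le (hF : discreteF α N η ≤ z) (t) : ∫ x, η t x ≤ z + 2 :=
  integral_le_of_entropy_le (entropy_le_of_discreteF_le hF t)

lemma mass_siteValue_le (hη : η ∈ latticePaths d T χ N) (hF : discreteF α N η ≤ z) (t) :
    ∫ x : Torus d, siteValue N (η t) (index N x) ≤ z + 2 := by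
  rw [← integral_congr_ae (ae_eq_siteValue (hη t))]
  exact mass_le_of_discreteF_le hF t

lemma dirichletSum_siteValue [NeZero d] (hα : 1 ≤ α) (t) :
    dirichletSum N (fun x => siteValue N (η t) x ^ (α / 2)) =
      α * discreteDissipation α N (η t) := by
  rw [discreteDissipation_eq, mul_inv_cancel_left₀ (by linarith)]

lemma lintegral_one_add_dissipation_le [NeZero d] (hα : 1 ≤ α) (hF : discreteF α N η ≤ z) {C : ℝ}
    (hC : 0 ≤ C) :
    ∫⁻ t, ENNReal.ofReal (C * (1 + dirichletSum N (fun x => siteValue N (η t) x ^ (α / 2))))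
      ∂timeMeasure T ≤ ENNReal.ofReal C * (ENNReal.ofReal T + ENNReal.ofReal α * z) := by
  have h1 : ∀ t, ENNReal.ofReal (C * (1 + dirichletSum N (fun x => siteValue N (η t) x ^ (α / 2)))) ≤
      ENNReal.ofReal C * (1 + ENNReal.ofReal α * ENNReal.ofReal (discreteDissipation α N (η t))) := by
    intro t
    rw [ENNReal.ofReal_mul hC, dirichletSum_siteValue hα]
    refine mul_le_mul' le_rfl (ENNReal.ofReal_add_le.trans ?_)
    rw [ENNReal.ofReal_one, ENNReal.ofReal_mul (by linarith)]
  refine (lintegral_mono h1).trans ?_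
  rw [lintegral_const_mul' _ _ ENNReal.ofReal_ne_top]
  gcongr
  rw [lintegral_add_left measurable_const, lintegral_const_mul' _ _ ENNReal.ofReal_ne_top,
    lintegral_const, timeMeasure_univ, one_mul]
  gcongr
  exact (le_add_left le_rfl).trans hF

lemma lintegral_latticeFun_rpow_le [NeZero d] (hη : η ∈ latticePaths d T χ N) (hα : 1 ≤ α)
    (hF : discreteF α N η ≤ z) {C : ℝ} (hC : 0 ≤ C) {β : ℝ} (hβ : 0 ≤ β)
    (hbd : ∀ t, ∫ x : Torus d, siteValue N (η t) (index N x) ^ β ≤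
      C * (1 + dirichletSum N fun x => siteValue N (η t) x ^ (α / 2))) :
    ∫⁻ p, ‖latticeFun N η p‖ₑ ^ β ∂spaceTime d T ≤
      ENNReal.ofReal C * (ENNReal.ofReal T + ENNReal.ofReal α * z) := by
  rw [spaceTime, lintegral_prod _ ((measurable_latticeFun hη).enorm.pow_const β).aemeasurable]
  refine (lintegral_mono fun t => ?_).trans (lintegral_one_add_dissipation_le hα hF hC)
  refine le_trans (le_of_eq ?_) (ENNReal.ofReal_le_ofReal (hbd t))
  rw [ofReal_integral_eq_lintegral_ofReal (integrable_comp_index N fun x => siteValue N (η t) x ^ β)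
    (Eventually.of_forall fun x => Real.rpow_nonneg (siteValue_nonneg _ _ _) _)]
  refine lintegral_congr fun x => ?_
  rw [← ENNReal.ofReal_rpow_of_nonneg (siteValue_nonneg _ _ _) hβ,
    Real.enorm_of_nonneg (latticeFun_nonneg N η (t, x))]
  rfl

lemma eLpNorm_ofReal {Ω : Type*} [MeasurableSpace Ω] {μ : Measure Ω} (g : Ω → ℝ) {p : ℝ}
    (hp : 0 < p) :
    eLpNorm g (ENNReal.ofReal p) μ = (∫⁻ x, ‖g x‖ₑ ^ p ∂μ) ^ (1 / p) := by
  rw [eLpNorm_eq_lintegral_rpow_enorm_toReal (by simpa using hp) ENNReal.ofReal_ne_top,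
    ENNReal.toReal_ofReal hp.le]

/-- The mollification of the path `u`. -/
def mollPath (ρ : C(Torus d, ℝ)) (u : PathSpace d T) (p : Icc (0 : ℝ) T × Torus d) : ℝ :=
  pairing (u p.1) (shiftTest ρ p.2)

lemma continuous_shiftTest (ρ : C(Torus d, ℝ)) : Continuous (shiftTest ρ) :=
  (ContinuousMap.curry ⟨fun p : Torus d × Torus d => ρ (p.1 - p.2), by fun_prop⟩).continuous

lemma continuous_pairing_right (f : L1Pos d) : Continuous (pairing f) := by
  refine (LipschitzWith.of_dist_le_mul (K := (∫ x, f x).toNNReal) fun φ ψ => ?_).continuous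
  rw [Real.dist_eq, dist_eq_norm, Real.coe_toNNReal _ (integral_nonneg_of_ae (coe_nonneg f)),
    mul_comm]
  exact abs_pairing_sub_pairing_le f φ ψ

/-- A Carathéodory function: continuous in space for each time and measurable in time for each
point. -/
lemma measurable_mollPath (ρ : C(Torus d, ℝ)) (u : PathSpace d T) : Measurable (mollPath ρ u) := by
  have h := measurable_uncurry_of_continuous_of_measurable
    (u := fun (z : Torus d) (t : Icc (0 : ℝ) T) => pairing (u t) (shiftTest ρ z))
    (fun t => (continuous_pairing_right (u t)).comp (continuous_shiftTest ρ))
    (fun z => measurable_pairing u _)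
  exact h.comp measurable_swap

lemma abs_mollPath_le (ρ : C(Torus d, ℝ)) (u : PathSpace d T) {M : ℝ}
    (hM : ∀ t, ∫ x, u t x ≤ M) (p) : |mollPath ρ u p| ≤ ‖ρ‖ * M := by
  have h1 := abs_pairing_sub_pairing_le (u p.1) (shiftTest ρ p.2) 0
  have h2 : pairing (u p.1) 0 = 0 := by simp [pairing]
  rw [h2, sub_zero, sub_zero] at h1
  refine h1.trans (mul_le_mul ?_ (hM _) (integral_nonneg_of_ae (coe_nonneg _)) (norm_nonneg _))
  exact (ContinuousMap.norm_le _ (norm_nonneg _)).2 fun y => ρ.norm_coe_le_norm _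

lemma lintegral_latticeFun_sub_mollPath_le [NeZero d] (hη : η ∈ latticePaths d T χ N) (hα : 1 ≤ α)
    (hF : discreteF α N η ≤ z) {C : ℝ} (hC : 0 ≤ C)
    (hbd : ∀ t, bvSum N (fun x => siteValue N (η t) x ^ α) ≤
      C * (1 + dirichletSum N fun x => siteValue N (η t) x ^ (α / 2)))
    {ρ : C(Torus d, ℝ)} {ε : ℝ} (hε : 0 ≤ ε) (hρ : IsMollifier ρ ε) :
    ∫⁻ p, ‖latticeFun N η p - mollPath ρ η p‖ₑ ^ α ∂spaceTime d T ≤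
      ENNReal.ofReal (ε + 1 / N) *
        (ENNReal.ofReal C * (ENNReal.ofReal T + ENNReal.ofReal α * z)) := by
  have hε' : 0 ≤ ε + 1 / (N : ℝ) := by positivity
  have hmp : Measurable fun p => ‖latticeFun N η p - mollPath ρ η p‖ₑ ^ α :=
    ((measurable_latticeFun hη).sub (measurable_mollPath ρ η)).enorm.pow_const α
  rw [spaceTime, lintegral_prod _ hmp.aemeasurable]
  refine le_trans ?_ (mul_le_mul' le_rfl (lintegral_one_add_dissipation_le hα hF hC))
  rw [← lintegral_const_mul' _ _ ENNReal.ofReal_ne_top]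
  refine lintegral_mono fun t => ?_
  rw [← ENNReal.ofReal_mul hε']
  have h1 := (hρ.integral_abs_sub_rpow_le N (siteValue N (η t)) (siteValue_nonneg _ _) hα).trans
    (mul_le_mul_of_nonneg_left (hbd t) hε')
  refine le_trans (le_of_eq ?_) (ENNReal.ofReal_le_ofReal h1)
  have hconv : ∀ x, mollPath ρ η (t, x) =
      ∫ y, shiftTest ρ x y * siteValue N (η t) (index N y) := fun x =>
    pairing_eq_of_configurations (hη t) _
  simp_rw [← hconv]
  have hm : Measurable fun x : Torus d => |siteValue N (η t) (index N x) - mollPath ρ η (t, x)| ^ α :=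
    (continuous_abs.measurable.comp ((measurable_comp_index N (siteValue N (η t))).sub
      ((measurable_mollPath ρ η).comp measurable_prodMk_left))).pow_const α
  obtain ⟨B, hB⟩ := exists_abs_le_of_finite (siteValue N (η t))
  have hi : Integrable fun x : Torus d =>
      |siteValue N (η t) (index N x) - mollPath ρ η (t, x)| ^ α := by
    refine Integrable.of_bound hm.aestronglyMeasurable ((B + ‖ρ‖ * (z + 2)) ^ α)
      (Eventually.of_forall fun x => ?_)
    rw [Real.norm_of_nonneg (Real.rpow_nonneg (abs_nonneg _) _)]
    refine Real.rpow_le_rpow (abs_nonneg _) ((abs_sub _ _).trans (add_le_add (hB _)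
      (abs_mollPath_le ρ η (mass_le_of_discreteF_le hF) _))) (by linarith)
  rw [ofReal_integral_eq_lintegral_ofReal hi
    (Eventually.of_forall fun x => Real.rpow_nonneg (abs_nonneg _) _)]
  refine lintegral_congr fun x => ?_
  rw [← ENNReal.ofReal_rpow_of_nonneg (abs_nonneg _) (by linarith), ← Real.norm_eq_abs, ofReal_norm]
  rfl

end Bounds

/-! ### Versions -/

lemma ae_eq_of_ae_ae_eq {w w' : Icc (0 : ℝ) T × Torus d → ℝ}
    (hw : AEStronglyMeasurable w (spaceTime d T)) (hw' : AEStronglyMeasurable w' (spaceTime d T))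
    (h : ∀ᵐ t ∂timeMeasure T, ∀ᵐ x, w (t, x) = w' (t, x)) : w =ᵐ[spaceTime d T] w' := by
  have h1 := Measure.ae_ae_of_ae_prod hw.ae_eq_mk
  have h2 := Measure.ae_ae_of_ae_prod hw'.ae_eq_mk
  -- Slicewise equality gives equality almost everywhere on the product only for a measurable set,
  -- hence the measurable modifications.
  have h3 : ∀ᵐ t ∂timeMeasure T, ∀ᵐ x, hw.mk w (t, x) = hw'.mk w' (t, x) := by
    filter_upwards [h, h1, h2] with t ht ht1 ht2
    filter_upwards [ht, ht1, ht2] with x hx hx1 hx2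
    rw [← hx1, ← hx2, hx]
  have h4 : hw.mk w =ᵐ[spaceTime d T] hw'.mk w' :=
    (Measure.ae_prod_iff_ae_ae (measurableSet_eq_fun hw.stronglyMeasurable_mk.measurable
      hw'.stronglyMeasurable_mk.measurable)).2 h3
  exact hw.ae_eq_mk.trans (h4.trans hw'.ae_eq_mk.symm)

lemma IsVersion.eq {α : ℝ} {w w' : SpaceTimeLp d T α} {u : PathSpace d T} (h : IsVersion w u)
    (h' : IsVersion w' u) : w = w' := by
  refine Lp.ext (ae_eq_of_ae_ae_eq (Lp.aestronglyMeasurable w) (Lp.aestronglyMeasurable w') ?_)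
  filter_upwards [h, h'] with t ht ht'
  filter_upwards [ht, ht'] with x hx hx'
  rw [hx, hx']

lemma IsVersion.ae_eq_latticeFun {α χ : ℝ} {N : ℕ+} {w : SpaceTimeLp d T α} {η : PathSpace d T}
    (h : IsVersion w η) (hη : η ∈ latticePaths d T χ N) : w =ᵐ[spaceTime d T] latticeFun N η := by
  refine ae_eq_of_ae_ae_eq (Lp.aestronglyMeasurable w)
    (measurable_latticeFun hη).aestronglyMeasurable ?_
  filter_upwards [h] with t ht
  filter_upwards [ht, ae_eq_siteValue (hη t)] with x hx hx'
  rw [hx, hx', latticeFun]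

lemma exists_eLpNorm_latticeFun_le (d : ℕ) [NeZero d] (T : ℝ) {α : ℝ} (hα : 1 ≤ α) (z : ℝ≥0) :
    ∃ B : ℝ≥0, ∀ (χ : ℝ) (N : ℕ+) (η : PathSpace d T), η ∈ latticePaths d T χ N →
      discreteF α N η ≤ z →
      eLpNorm (latticeFun N η) (ENNReal.ofReal (gainExponent d α)) (spaceTime d T) ≤ B := by
  obtain ⟨C, hC0, hC⟩ := exists_static_bound d hα (z + 2)
  have hβ : 0 < gainExponent d α := by
    unfold gainExponent
    positivity
  set K : ℝ≥0∞ := (ENNReal.ofReal C * (ENNReal.ofReal T + ENNReal.ofReal α * z)) ^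
    (1 / gainExponent d α) with hK
  have hKt : K ≠ ⊤ := ENNReal.rpow_ne_top_of_nonneg (by positivity)
    (ENNReal.mul_ne_top ENNReal.ofReal_ne_top (ENNReal.add_ne_top.2 ⟨ENNReal.ofReal_ne_top,
      ENNReal.mul_ne_top ENNReal.ofReal_ne_top ENNReal.coe_ne_top⟩))
  refine ⟨K.toNNReal, fun χ N η hη hF => ?_⟩
  rw [ENNReal.coe_toNNReal hKt, eLpNorm_ofReal _ hβ, hK]
  refine ENNReal.rpow_le_rpow ?_ (by positivity)
  exact lintegral_latticeFun_rpow_le hη hα hF hC0 hβ.le fun t =>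
    (hC N _ (siteValue_nonneg _ _) (mass_siteValue_le hη hF t)).1

lemma lt_gainExponent (d : ℕ) (α : ℝ) : α < gainExponent d α := by
  have : (0 : ℝ) < 1 / ((d : ℝ) + 1) := by positivity
  unfold gainExponent
  linarith

lemma exists_isVersion [NeZero d] {α χ : ℝ} (hα : 1 ≤ α) {N : ℕ+} {η : PathSpace d T} {z : ℝ≥0}
    (hη : η ∈ latticePaths d T χ N) (hF : discreteF α N η ≤ z) :
    ∃ w : SpaceTimeLp d T α, IsVersion w η := by
  obtain ⟨B, hB⟩ := exists_eLpNorm_latticeFun_le d T hα z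
  have h1 : MemLp (latticeFun N η) (ENNReal.ofReal (gainExponent d α)) (spaceTime d T) :=
    ⟨(measurable_latticeFun hη).aestronglyMeasurable, (hB χ N η hη hF).trans_lt ENNReal.coe_lt_top⟩
  have h2 : MemLp (latticeFun N η) (ENNReal.ofReal α) (spaceTime d T) :=
    h1.mono_exponent (ENNReal.ofReal_le_ofReal (lt_gainExponent d α).le)
  refine ⟨h2.toLp, ?_⟩
  filter_upwards [Measure.ae_ae_of_ae_prod h2.coeFn_toLp] with t ht
  filter_upwards [ht, ae_eq_siteValue (hη t)] with x hx hx'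
  rw [hx, hx', latticeFun]

/-! ### Strong convergence -/

lemma TestedConvergence.mass_le {η : ℕ → PathSpace d T} {u : PathSpace d T}
    (h : TestedConvergence η u) {M : ℝ} (hM : ∀ k t, ∫ x, η k t x ≤ M) (t) :
    ∫ x, u t x ≤ M + 1 := by
  obtain ⟨k, σ, -, hσ⟩ := (h 1 1 one_pos).exists
  have h1 := (abs_lt.1 (hσ t)).2
  have h2 := hM k (σ t)
  simp only [pairing, ContinuousMap.one_apply, one_mul] at h1
  linarith

section Convergence

variable {α : ℝ} {z : ℝ≥0} {χ : ℕ → ℝ} {N : ℕ → ℕ+} {η : ℕ → PathSpace d T} {u : PathSpace d T}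

lemma tendsto_eLpNorm_mollPath_sub (hα : 1 ≤ α)
    (hF : ∀ k, discreteF α (N k) (η k) ≤ z) (hu : TestedConvergence η u) (ρ : C(Torus d, ℝ)) :
    Tendsto (fun k => eLpNorm (fun p => mollPath ρ (η k) p - mollPath ρ u p) (ENNReal.ofReal α)
      (spaceTime d T)) atTop (𝓝 0) := by
  have hα0 : 0 < α := by linarith
  have hM : ∀ k t, ∫ x, η k t x ≤ z + 2 := fun k t => mass_le_of_discreteF_le (hF k) t
  have hMu := hu.mass_le hM
  set B : ℝ := ‖ρ‖ * (z + 2) + ‖ρ‖ * (z + 2 + 1) with hB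
  have hB0 : 0 ≤ B := by positivity
  have hlim : Tendsto (fun k => ∫⁻ p, ‖mollPath ρ (η k) p - mollPath ρ u p‖ₑ ^ α ∂spaceTime d T)
      atTop (𝓝 (∫⁻ _, 0 ∂spaceTime d T)) := by
    refine tendsto_lintegral_of_dominated_convergence (fun _ => ENNReal.ofReal B ^ α)
      (fun k => ((measurable_mollPath ρ (η k)).sub (measurable_mollPath ρ u)).enorm.pow_const α)
      (fun k => Eventually.of_forall fun p => ?_) ?_ ?_
    · refine ENNReal.rpow_le_rpow ?_ hα0.le
      rw [← ofReal_norm]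
      refine ENNReal.ofReal_le_ofReal ((norm_sub_le _ _).trans ?_)
      exact add_le_add (abs_mollPath_le ρ (η k) (hM k) p) (abs_mollPath_le ρ u hMu p)
    · rw [lintegral_const]
      exact ENNReal.mul_ne_top (ENNReal.rpow_ne_top_of_nonneg hα0.le ENNReal.ofReal_ne_top)
        (measure_ne_top _ _)
    · have h1 : ∀ᵐ p ∂spaceTime d T, ∀ φ : C(Torus d, ℝ),
          Tendsto (fun k => pairing (η k p.1) φ) atTop (𝓝 (pairing (u p.1) φ)) :=
        Measure.quasiMeasurePreserving_fst.ae (hu.ae_forall_tendsto_pairing hM)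
      filter_upwards [h1] with p hp
      have h2 : Tendsto (fun k => mollPath ρ (η k) p - mollPath ρ u p) atTop (𝓝 0) := by
        have h3 := (hp (shiftTest ρ p.2)).sub_const (pairing (u p.1) (shiftTest ρ p.2))
        rw [sub_self] at h3
        exact h3
      have h3 := ((ENNReal.continuous_rpow_const (y := α)).tendsto _).comp
        ((continuous_enorm.tendsto (0 : ℝ)).comp h2)
      simpa [ENNReal.zero_rpow_of_pos hα0, Function.comp_def] using h3
  simp_rw [fun k => eLpNorm_ofReal (μ := spaceTime d T)
    (fun p => mollPath ρ (η k) p - mollPath ρ u p) hα0]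
  have h4 := ((ENNReal.continuous_rpow_const (y := 1 / α)).tendsto _).comp hlim
  simpa [ENNReal.zero_rpow_of_pos (show 0 < α⁻¹ by positivity), Function.comp_def] using h4

/-- Both terms are compared with the mollification of u rather than with u itself, which is not yet
known to define an element of L^α. This is why the Cauchy property is proved before the limit is
identified. -/
lemma cauchySeq_of_testedConvergence [NeZero d] [Fact (1 ≤ α)] (hN : Tendsto N atTop atTop)
    (hη : ∀ k, η k ∈ latticePaths d T (χ k) (N k)) (hF : ∀ k, discreteF α (N k) (η k) ≤ z)
    (hu : TestedConvergence η u) {w : ℕ → SpaceTimeLp d T α} (hw : ∀ k, IsVersion (w k) (η k)) :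
    CauchySeq w := by
  have hα : 1 ≤ α := Fact.out
  have hα0 : 0 < α := by linarith
  obtain ⟨C, hC0, hC⟩ := exists_static_bound d hα (z + 2)
  set K : ℝ≥0∞ := ENNReal.ofReal C * (ENNReal.ofReal T + ENNReal.ofReal α * z) with hK
  have hKt : K ≠ ⊤ := ENNReal.mul_ne_top ENNReal.ofReal_ne_top (ENNReal.add_ne_top.2
    ⟨ENNReal.ofReal_ne_top, ENNReal.mul_ne_top ENNReal.ofReal_ne_top ENNReal.coe_ne_top⟩)
  rw [EMetric.cauchySeq_iff]
  intro ε hε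
  have hε4 : 0 < ε / 4 := ENNReal.div_pos hε.ne' (by simp)
  have hsmall : Tendsto (fun δ : ℝ => (ENNReal.ofReal (2 * δ) * K) ^ (1 / α)) (𝓝 0) (𝓝 0) := by
    have h1 : Tendsto (fun δ : ℝ => ENNReal.ofReal (2 * δ) * K) (𝓝 0) (𝓝 0) := by
      have h2 : Tendsto (fun δ : ℝ => ENNReal.ofReal (2 * δ)) (𝓝 0) (𝓝 0) := by
        have h3 : Continuous fun δ : ℝ => ENNReal.ofReal (2 * δ) :=
          ENNReal.continuous_ofReal.comp (continuous_const.mul continuous_id)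
        simpa using h3.tendsto 0
      simpa using ENNReal.Tendsto.mul_const h2 (Or.inr hKt)
    have h2 := ((ENNReal.continuous_rpow_const (y := 1 / α)).tendsto _).comp h1
    simpa [ENNReal.zero_rpow_of_pos (show 0 < α⁻¹ by positivity), Function.comp_def] using h2
  -- The mollification scale δ and the lattice spacing, eventually at most δ, together account for
  -- the factor 2δ.
  obtain ⟨δ, hδ, hδ0⟩ := (((hsmall.mono_left nhdsWithin_le_nhds).eventually
    (gt_mem_nhds hε4)).and (self_mem_nhdsWithin (s := Ioi (0 : ℝ)))).exists
  have hδ0 : 0 < δ := hδ0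
  obtain ⟨ρ, hρ⟩ := exists_isMollifier d hδ0
  have hNδ : ∀ᶠ k in atTop, 1 / (N k : ℝ) ≤ δ := by
    have h1 : Tendsto (fun k => (N k : ℝ)) atTop atTop :=
      tendsto_natCast_atTop_atTop.comp (tendsto_PNat_val_atTop_atTop.comp hN)
    filter_upwards [h1.inv_tendsto_atTop.eventually (gt_mem_nhds hδ0)] with k hk
    simpa using hk.le
  have hmoll := (tendsto_eLpNorm_mollPath_sub hα hF hu ρ).eventually (gt_mem_nhds hε4)
  have hfirst : ∀ k, 1 / (N k : ℝ) ≤ δ →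
      eLpNorm (fun p => latticeFun (N k) (η k) p - mollPath ρ (η k) p) (ENNReal.ofReal α)
        (spaceTime d T) < ε / 4 := by
    intro k hk
    refine lt_of_le_of_lt ?_ hδ
    rw [eLpNorm_ofReal _ hα0]
    refine ENNReal.rpow_le_rpow ?_ (by positivity)
    refine (lintegral_latticeFun_sub_mollPath_le (hη k) hα (hF k) hC0 (fun t =>
      (hC (N k) _ (siteValue_nonneg _ _) (mass_siteValue_le (hη k) (hF k) t)).2.2) hδ0.le hρ).trans ?_
    refine mul_le_mul' (ENNReal.ofReal_le_ofReal ?_) le_rfl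
    linarith
  obtain ⟨k₀, hk₀⟩ := eventually_atTop.1 (hNδ.and hmoll)
  refine ⟨k₀, fun m hm n hn => ?_⟩
  obtain ⟨hm1, hm2⟩ := hk₀ m hm
  obtain ⟨hn1, hn2⟩ := hk₀ n hn
  have hmm := measurable_mollPath (T := T) ρ
  have hml := fun k => measurable_latticeFun (hη k)
  have e1 : ⇑(w m) - ⇑(w n) =ᵐ[spaceTime d T]
      ((fun p => latticeFun (N m) (η m) p - mollPath ρ (η m) p) +
        fun p => mollPath ρ (η m) p - mollPath ρ u p) -
      ((fun p => latticeFun (N n) (η n) p - mollPath ρ (η n) p) +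
        fun p => mollPath ρ (η n) p - mollPath ρ u p) := by
    filter_upwards [(hw m).ae_eq_latticeFun (hη m), (hw n).ae_eq_latticeFun (hη n)] with p h1 h2
    simp only [Pi.sub_apply, Pi.add_apply, h1, h2]
    ring
  have hp : 1 ≤ ENNReal.ofReal α := ENNReal.one_le_ofReal.2 hα
  have hadd : ∀ k, eLpNorm ((fun p => latticeFun (N k) (η k) p - mollPath ρ (η k) p) +
        fun p => mollPath ρ (η k) p - mollPath ρ u p) (ENNReal.ofReal α) (spaceTime d T) ≤
      eLpNorm (fun p => latticeFun (N k) (η k) p - mollPath ρ (η k) p) (ENNReal.ofReal α)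
        (spaceTime d T) +
      eLpNorm (fun p => mollPath ρ (η k) p - mollPath ρ u p) (ENNReal.ofReal α)
        (spaceTime d T) := fun k =>
    eLpNorm_add_le ((hml k).sub (hmm (η k))).aestronglyMeasurable
      ((hmm (η k)).sub (hmm u)).aestronglyMeasurable hp
  rw [Lp.edist_def, eLpNorm_congr_ae e1]
  calc _ ≤ _ := eLpNorm_sub_le
        (((hml m).sub (hmm (η m))).add ((hmm (η m)).sub (hmm u))).aestronglyMeasurable
        (((hml n).sub (hmm (η n))).add ((hmm (η n)).sub (hmm u))).aestronglyMeasurable hp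
    _ ≤ _ := add_le_add (hadd m) (hadd n)
    _ < (ε / 4 + ε / 4) + (ε / 4 + ε / 4) :=
        ENNReal.add_lt_add (ENNReal.add_lt_add (hfirst m hm1) hm2)
          (ENNReal.add_lt_add (hfirst n hn1) hn2)
    _ = ε := by
        have : ε / 4 + ε / 4 = ε / 2 := by
          rw [ENNReal.div_add_div_same, ← two_mul, show (4 : ℝ≥0∞) = 2 * 2 by norm_num,
            ENNReal.mul_div_mul_left _ _ two_ne_zero ENNReal.ofNat_ne_top]
        rw [this, ENNReal.add_halves]

/-- On a finite measure space L^α convergence implies L¹ convergence. Along a subsequence with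
geometrically small distances, the slice distances are summable at almost every time. -/
lemma exists_subseq_tendsto_lintegral [Fact (1 ≤ α)] {w : ℕ → SpaceTimeLp d T α}
    {w' : SpaceTimeLp d T α} (h : Tendsto w atTop (𝓝 w')) :
    ∃ ns : ℕ → ℕ, StrictMono ns ∧ ∀ᵐ t ∂timeMeasure T,
      Tendsto (fun k => ∫⁻ x, ‖w (ns k) (t, x) - w' (t, x)‖ₑ) atTop (𝓝 0) := by
  have hα : 1 ≤ α := Fact.out
  have hα0 : 0 < α := by linarith
  have hp : 1 ≤ ENNReal.ofReal α := ENNReal.one_le_ofReal.2 hα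
  have hm : ∀ k, AEStronglyMeasurable (⇑(w k) - ⇑w') (spaceTime d T) := fun k =>
    (Lp.aestronglyMeasurable _).sub (Lp.aestronglyMeasurable _)
  have h1 : Tendsto (fun k => eLpNorm (⇑(w k) - ⇑w') 1 (spaceTime d T)) atTop (𝓝 0) := by
    have h2 := (Lp.tendsto_Lp_iff_tendsto_eLpNorm' w w').1 h
    set c : ℝ≥0∞ := spaceTime d T univ ^ (1 / (1 : ℝ≥0∞).toReal - 1 / (ENNReal.ofReal α).toReal)
    have hc : c ≠ ⊤ := by
      refine ENNReal.rpow_ne_top_of_nonneg ?_ (measure_ne_top _ _)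
      rw [ENNReal.toReal_ofReal hα0.le, ENNReal.toReal_one, div_one, sub_nonneg, div_le_one hα0]
      exact hα
    have h3 : Tendsto (fun k => eLpNorm (⇑(w k) - ⇑w') (ENNReal.ofReal α) (spaceTime d T) * c)
        atTop (𝓝 0) := by
      simpa using ENNReal.Tendsto.mul_const h2 (Or.inr hc)
    exact tendsto_of_tendsto_of_tendsto_of_le_of_le tendsto_const_nhds h3 (fun _ => zero_le)
      fun k => eLpNorm_le_eLpNorm_mul_rpow_measure_univ hp (hm k)
  have h2 : ∀ k, eLpNorm (⇑(w k) - ⇑w') 1 (spaceTime d T) =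
      ∫⁻ t, (∫⁻ x, ‖w k (t, x) - w' (t, x)‖ₑ) ∂timeMeasure T := by
    intro k
    rw [eLpNorm_one_eq_lintegral_enorm]
    exact lintegral_prod _ (hm k).enorm
  simp_rw [h2] at h1
  obtain ⟨ns, hns, hns'⟩ := extraction_forall_of_eventually
    (P := fun n k => ∫⁻ t, (∫⁻ x, ‖w k (t, x) - w' (t, x)‖ₑ) ∂timeMeasure T < (2⁻¹ : ℝ≥0∞) ^ n)
    fun n => h1.eventually (gt_mem_nhds (ENNReal.pow_pos (by simp) n))
  refine ⟨ns, hns, ?_⟩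
  have hmeas : ∀ k, AEMeasurable (fun t => ∫⁻ x, ‖w k (t, x) - w' (t, x)‖ₑ) (timeMeasure T) :=
    fun k => (hm k).enorm.lintegral_prod_right'
  have hfin : ∫⁻ t, (∑' k, ∫⁻ x, ‖w (ns k) (t, x) - w' (t, x)‖ₑ) ∂timeMeasure T ≠ ⊤ := by
    rw [lintegral_tsum fun k => hmeas (ns k)]
    refine ne_top_of_le_ne_top ?_ (ENNReal.tsum_le_tsum fun k => (hns' k).le)
    rw [ENNReal.tsum_geometric]
    simp
  filter_upwards [ae_lt_top' (AEMeasurable.tsum fun k => hmeas (ns k)) hfin] with t ht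
  exact ENNReal.tendsto_atTop_zero_of_tsum_ne_top ht.ne

lemma ae_integrable_slice [Fact (1 ≤ α)] (w : SpaceTimeLp d T α) :
    ∀ᵐ t ∂timeMeasure T, Integrable fun x => w (t, x) := by
  have h1 : Integrable w (spaceTime d T) :=
    (Lp.memLp w).integrable (ENNReal.one_le_ofReal.2 Fact.out)
  exact h1.prod_right_ae

lemma isVersion_of_tendsto [Fact (1 ≤ α)] (hF : ∀ k, discreteF α (N k) (η k) ≤ z)
    (hu : TestedConvergence η u) {w : ℕ → SpaceTimeLp d T α} {w' : SpaceTimeLp d T α}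
    (hw : ∀ k, IsVersion (w k) (η k)) (h : Tendsto w atTop (𝓝 w')) : IsVersion w' u := by
  obtain ⟨ns, hns, hae⟩ := exists_subseq_tendsto_lintegral h
  filter_upwards [hae, ae_all_iff.2 hw, ae_integrable_slice w',
    hu.ae_forall_tendsto_pairing fun k t => mass_le_of_discreteF_le (hF k) t] with t ht hwt hi hp
  refine ae_eq_of_forall_integral_continuousMap_mul_eq hi (integrable_coe (u t)) fun φ => ?_
  refine tendsto_nhds_unique ?_ ((hp φ).comp hns.tendsto_atTop)
  rw [tendsto_iff_norm_sub_tendsto_zero]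
  -- An infinite slice distance would have `toReal` equal to 0, so that case is kept apart; it does
  -- not occur for large k.
  have h1 : ∀ k, ‖((fun k => pairing (η k t) φ) ∘ ns) k - ∫ x, φ x * w' (t, x)‖ ≤
      (‖φ‖ₑ * ∫⁻ x, ‖w (ns k) (t, x) - w' (t, x)‖ₑ).toReal ∨
      ∫⁻ x, ‖w (ns k) (t, x) - w' (t, x)‖ₑ = ⊤ := by
    intro k
    by_cases htop : ∫⁻ x, ‖w (ns k) (t, x) - w' (t, x)‖ₑ = ⊤
    · exact Or.inr htop
    refine Or.inl ?_
    have hwi : Integrable fun x => w (ns k) (t, x) := (integrable_coe (η (ns k) t)).congr (by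
      filter_upwards [hwt (ns k)] with x hx using hx.symm)
    have e1 : pairing (η (ns k) t) φ = ∫ x, φ x * w (ns k) (t, x) := by
      refine integral_congr_ae ?_
      filter_upwards [hwt (ns k)] with x hx
      rw [hx]
    simp only [Function.comp_apply]
    rw [e1, ← integral_sub (integrable_continuousMap_mul φ hwi) (integrable_continuousMap_mul φ hi)]
    refine (norm_integral_le_lintegral_norm _).trans ?_
    rw [← lintegral_const_mul' _ _ enorm_ne_top]
    refine ENNReal.toReal_mono ?_ (lintegral_mono fun x => ?_)
    · rw [lintegral_const_mul' _ _ enorm_ne_top]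
      exact ENNReal.mul_ne_top enorm_ne_top htop
    · rw [ofReal_norm, ← mul_sub, enorm_mul]
      gcongr
      rw [← ofReal_norm, ← ofReal_norm]
      exact ENNReal.ofReal_le_ofReal (φ.norm_coe_le_norm x)
  have h2 : Tendsto (fun k => (‖φ‖ₑ * ∫⁻ x, ‖w (ns k) (t, x) - w' (t, x)‖ₑ).toReal) atTop (𝓝 0) := by
    have h3 := ENNReal.Tendsto.const_mul ht (Or.inr (enorm_ne_top (x := φ)))
    rw [mul_zero] at h3
    have h4 := (ENNReal.tendsto_toReal ENNReal.zero_ne_top).comp h3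
    rwa [ENNReal.toReal_zero] at h4
  refine squeeze_zero' (Eventually.of_forall fun k => norm_nonneg _) ?_ h2
  filter_upwards [ht.eventually (gt_mem_nhds ENNReal.zero_lt_top)] with k hk
  exact (h1 k).resolve_right hk.ne

theorem exists_tendsto_isVersion [NeZero d] [Fact (1 ≤ α)] (hN : Tendsto N atTop atTop)
    (hη : ∀ k, η k ∈ latticePaths d T (χ k) (N k)) (hF : ∀ k, discreteF α (N k) (η k) ≤ z)
    (hu : TestedConvergence η u) {w : ℕ → SpaceTimeLp d T α} (hw : ∀ k, IsVersion (w k) (η k)) :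
    ∃ w' : SpaceTimeLp d T α, IsVersion w' u ∧ Tendsto w atTop (𝓝 w') := by
  obtain ⟨w', hw'⟩ := cauchySeq_tendsto_of_complete (cauchySeq_of_testedConvergence hN hη hF hu hw)
  exact ⟨w', isVersion_of_tendsto hF hu hw hw', hw'⟩

end Convergence

/-! ### Lower semicontinuity -/

section LowerSemicontinuity

variable {α : ℝ} {z : ℝ≥0} {χ : ℕ → ℝ} {N : ℕ → ℕ+} {η : ℕ → PathSpace d T} {u : PathSpace d T}

lemma TestedConvergence.comp_tendsto (h : TestedConvergence η u) {ns : ℕ → ℕ}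
    (hns : Tendsto ns atTop atTop) : TestedConvergence (fun k => η (ns k)) u := fun φ ε hε =>
  hns.eventually (h φ ε hε)

/-- If the entropies were frequently at most c, the dual inequality at time σ(t) would pass to u at
time t with arbitrarily small error. Because of the supremum over times, this works at every t,
including jump times. -/
lemma TestedConvergence.eventually_lt_iSup_entropy (h : TestedConvergence η u) {c : ℝ≥0}
    {t : Icc (0 : ℝ) T} (hc : c < entropy (u t)) :
    ∀ᶠ k in atTop, (c : ℝ≥0∞) < ⨆ s, entropy (η k s) := by
  by_contra hcon
  rw [not_eventually] at hcon
  refine hc.not_ge ?_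
  rw [← ENNReal.ofReal_coe_nnreal]
  refine entropy_le_of_forall_pairing_le fun φ => le_of_forall_pos_le_add fun ε hε => ?_
  obtain ⟨k, hk, σ, -, hσ⟩ := (hcon.and_eventually (h φ ε hε)).exists
  have h1 : entropy (η k (σ t)) ≤ c :=
    (le_iSup (fun s => entropy (η k s)) (σ t)).trans (not_lt.1 hk)
  have h2 := pairing_sub_integral_exp_le h1 φ
  have h3 := (abs_lt.1 (hσ t)).2
  linarith

lemma half_lintegral_dissipation_le_liminf [NeZero d] [Fact (1 ≤ α)] (hN : Tendsto N atTop atTop)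
    (hη : ∀ k, η k ∈ latticePaths d T (χ k) (N k)) {w : ℕ → SpaceTimeLp d T α}
    {w' : SpaceTimeLp d T α} (hw : ∀ k, IsVersion (w k) (η k)) (hw' : IsVersion w' u)
    (h : ∀ᵐ t ∂timeMeasure T, Tendsto (fun k => ∫⁻ x, ‖w k (t, x) - w' (t, x)‖ₑ) atTop (𝓝 0)) :
    2⁻¹ * ∫⁻ t, dissipation α (u t) ∂timeMeasure T ≤
      liminf (fun k => ∫⁻ t, ENNReal.ofReal (discreteDissipation α (N k) (η k t)) ∂timeMeasure T)
        atTop := by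
  rw [← lintegral_const_mul' _ _ (by simp)]
  refine (lintegral_mono_ae ?_).trans
    (lintegral_liminf_le fun k => (measurable_discreteDissipation (hη k) α).ennreal_ofReal)
  filter_upwards [h, ae_all_iff.2 hw, hw'] with t ht hwt hwt'
  refine half_dissipation_le_liminf Fact.out hN (fun k => hη k t) (ht.congr fun k => ?_)
  refine lintegral_congr_ae ?_
  filter_upwards [hwt k, hwt'] with x hx hx'
  rw [hx, hx']

theorem continuumF_le_of_testedConvergence [NeZero d] [Fact (1 ≤ α)] (hN : Tendsto N atTop atTop)
    (hη : ∀ k, η k ∈ latticePaths d T (χ k) (N k)) (hF : ∀ k, discreteF α (N k) (η k) ≤ z)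
    (hu : TestedConvergence η u) : continuumF α u ≤ z := by
  choose w hw using fun k => exists_isVersion Fact.out (hη k) (hF k)
  obtain ⟨w', hw', hlim⟩ := exists_tendsto_isVersion hN hη hF hu hw
  obtain ⟨ns, hns, hae⟩ := exists_subseq_tendsto_lintegral hlim
  have hD := half_lintegral_dissipation_le_liminf (hN.comp hns.tendsto_atTop)
    (fun k => hη (ns k)) (fun k => hw (ns k)) hw' hae
  have hDz : 2⁻¹ * ∫⁻ t, dissipation α (u t) ∂timeMeasure T ≤ z :=
    hD.trans (liminf_le_of_frequently_le'
      (Frequently.of_forall fun k => le_add_self.trans (hF (ns k))))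
  have hDt : 2⁻¹ * ∫⁻ t, dissipation α (u t) ∂timeMeasure T ≠ ⊤ :=
    ne_top_of_le_ne_top ENNReal.coe_ne_top hDz
  refine add_le_of_le_tsub_right_of_le hDz (iSup_le fun t => ?_)
  -- The sum is bounded jointly: any c below the entropy of the limit is eventually exceeded by the
  -- entropies along the sequence, which leaves at most z - c for their dissipation integrals.
  refine ENNReal.le_of_forall_nnreal_lt fun c hc => ENNReal.le_sub_of_add_le_left hDt ?_
  have hcz : (c : ℝ≥0∞) ≤ z := by
    obtain ⟨k, hk⟩ := (hu.eventually_lt_iSup_entropy hc).exists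
    exact hk.le.trans (le_self_add.trans (hF k))
  refine add_le_of_le_tsub_right_of_le hcz (hD.trans (liminf_le_of_frequently_le' ?_))
  refine (((hu.comp_tendsto hns.tendsto_atTop).eventually_lt_iSup_entropy hc).mono
    fun k hk => ?_).frequently
  refine ENNReal.le_sub_of_add_le_left ENNReal.coe_ne_top ?_
  exact (add_le_add hk.le le_rfl).trans (hF (ns k))

end LowerSemicontinuity

/-! ### Countably many neighbourhoods -/

section Neighbourhoods

/-- The pairs of functions whose pairings with the first `k` members of a dense sequence of
continuous functions, and whose masses, are close. -/
def testEntourage (d k : ℕ) : Set (L1Pos d × L1Pos d) :=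
  {p | |pairing p.1 1 - pairing p.2 1| < 1} ∩
    ⋂ j ∈ Finset.range k, {p | |pairing p.1 (TopologicalSpace.denseSeq C(Torus d, ℝ) j) -
      pairing p.2 (TopologicalSpace.denseSeq C(Torus d, ℝ) j)| < 1 / ((k : ℝ) + 1)}

lemma testEntourage_mem (d k : ℕ) : testEntourage d k ∈ uniformity (L1Pos d) :=
  inter_mem (pairing_entourage_mem 1 one_pos) ((Filter.biInter_finset_mem _).2 fun _ _ =>
    pairing_entourage_mem _ (by positivity))

/-- A sequence of neighbourhoods of `u` which is a base on sets of paths of bounded mass. -/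
def testNhd (u : PathSpace d T) (k : ℕ) : Set (PathSpace d T) :=
  interior (skorokhodBall u (testEntourage d k) (1 / ((k : ℝ) + 1)))

lemma mem_testNhd (u : PathSpace d T) (k : ℕ) : u ∈ testNhd u k :=
  mem_interior_iff_mem_nhds.2 (skorokhodBall_mem_nhds u (testEntourage_mem d k) (by positivity))

/-- The constant test function, present in every entourage, transfers the mass bound to u. With
bounded masses, closeness on the dense sequence extends to every continuous φ. -/
lemma testedConvergence_of_mem_testNhd {η : ℕ → PathSpace d T} {u : PathSpace d T}
    (h : ∀ k, η k ∈ testNhd u k) {M : ℝ} (hM : ∀ k t, ∫ x, η k t x ≤ M) :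
    TestedConvergence η u := by
  have hball := fun k => interior_subset (h k)
  have hMu : ∀ t, ∫ x, u t x ≤ M + 1 := by
    intro t
    obtain ⟨σ, -, hσ⟩ := hball 0
    have h0 : |pairing (u t) 1 - pairing (η 0 (σ t)) 1| < 1 := (hσ t).1
    have h1 := (abs_lt.1 h0).2
    have h2 := hM 0 (σ t)
    simp only [pairing, ContinuousMap.one_apply, one_mul] at h1
    linarith
  intro φ ε hε
  set M' : ℝ := max (M + 1) 0 with hM'
  have hM0 : 0 ≤ M' := le_max_right _ _
  obtain ⟨j, hj⟩ := (TopologicalSpace.denseRange_denseSeq C(Torus d, ℝ)).exists_dist_lt φ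
    (show 0 < ε / (3 * (M' + 1)) by positivity)
  rw [dist_eq_norm] at hj
  set ψ := TopologicalSpace.denseSeq C(Torus d, ℝ) j with hψ
  have hb : ∀ g : L1Pos d, ∫ x, g x ≤ M + 1 → |pairing g φ - pairing g ψ| < ε / 3 := by
    intro g hg
    have h1 : ‖φ - ψ‖ * ∫ x, g x ≤ ε / (3 * (M' + 1)) * M' :=
      mul_le_mul hj.le (hg.trans (le_max_left _ _)) (integral_nonneg_of_ae (coe_nonneg g))
        (by positivity)
    have h2 : ε / (3 * (M' + 1)) * M' < ε / 3 := by
      rw [div_mul_eq_mul_div, div_lt_div_iff₀ (by positivity) (by positivity)]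
      nlinarith
    exact ((abs_pairing_sub_pairing_le g φ ψ).trans h1).trans_lt h2
  have hsmall : ∀ᶠ k : ℕ in atTop, 1 / ((k : ℝ) + 1) < ε / 3 :=
    (tendsto_one_div_add_atTop_nhds_zero_nat (𝕜 := ℝ)).eventually (gt_mem_nhds (by positivity))
  filter_upwards [hsmall, eventually_gt_atTop j] with k hk hkj
  obtain ⟨σ, hσ, hσ'⟩ := hball k
  refine ⟨σ, fun t => (hσ t).trans (by linarith), fun t => ?_⟩
  have h1 := hb (u t) (hMu t)
  have h2 := hb (η k (σ t)) ((hM k (σ t)).trans (by linarith))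
  have h3 : |pairing (u t) ψ - pairing (η k (σ t)) ψ| < 1 / ((k : ℝ) + 1) :=
    mem_iInter₂.1 (hσ' t).2 j (Finset.mem_range.2 hkj)
  rw [abs_lt] at *
  constructor <;> linarith

/-- A property of lattice paths of bounded energy that holds along tested sequences holds in a
neighbourhood, for large `N`. -/
lemma exists_isOpen_eventually {α : ℝ} {l : ℝ≥0} {χ : ℕ+ → ℝ} (u : PathSpace d T)
    {P : ℕ+ → PathSpace d T → Prop}
    (h : ∀ (N : ℕ → ℕ+) (η : ℕ → PathSpace d T), Tendsto N atTop atTop →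
      (∀ k, η k ∈ latticePaths d T (χ (N k)) (N k)) → (∀ k, discreteF α (N k) (η k) ≤ l) →
      TestedConvergence η u → ∃ k, P (N k) (η k)) :
    ∃ U : Set (PathSpace d T), IsOpen U ∧ u ∈ U ∧ ∀ᶠ N in atTop,
      ∀ η ∈ latticePaths d T (χ N) N, discreteF α N η ≤ l → η ∈ U → P N η := by
  -- Otherwise each neighbourhood of the countable family contains a counterexample with N > k, and
  -- these form a tested sequence.
  by_contra! hcon
  have h1 : ∀ k : ℕ, ∃ N : ℕ+, Nat.succPNat k ≤ N ∧ ∃ η ∈ latticePaths d T (χ N) N,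
      discreteF α N η ≤ l ∧ η ∈ testNhd u k ∧ ¬P N η := fun k =>
    frequently_atTop.1 (hcon (testNhd u k) isOpen_interior (mem_testNhd u k)) _
  choose N hN η hη hF hmem hP using h1
  have hNt : Tendsto N atTop atTop := by
    refine tendsto_atTop.2 fun m => ?_
    filter_upwards [eventually_ge_atTop (m : ℕ)] with k hk
    refine le_trans ?_ (hN k)
    exact (PNat.coe_le_coe _ _).1 (hk.trans (Nat.le_succ k))
  obtain ⟨k, hk⟩ := h N η hNt hη hF (testedConvergence_of_mem_testNhd hmem
    fun k t => mass_le_of_discreteF_le (hF k) t)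
  exact hP k hk

end Neighbourhoods

/-! ### Bound on the limit -/

lemma eLpNorm_le_of_tendsto_Lp {Ω : Type*} [MeasurableSpace Ω] {μ : Measure Ω} {p q M : ℝ≥0∞}
    [Fact (1 ≤ p)] {w : ℕ → Lp ℝ p μ} {w' : Lp ℝ p μ} (h : Tendsto w atTop (𝓝 w'))
    (hM : ∀ k, eLpNorm (w k) q μ ≤ M) : eLpNorm w' q μ ≤ M := by
  obtain ⟨ns, -, hns⟩ := (tendstoInMeasure_of_tendsto_Lp h).exists_seq_tendsto_ae
  refine (Lp.eLpNorm_lim_le_liminf_eLpNorm (fun k => Lp.aestronglyMeasurable (w (ns k))) _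
    hns).trans ?_
  exact liminf_le_of_frequently_le' (Frequently.of_forall fun k => hM (ns k))

/-! ### The weak-to-strong principle -/

section Main

variable {α : ℝ} {χ : ℕ+ → ℝ}

lemma exists_versions_tendsto [NeZero d] [Fact (1 ≤ α)] {z : ℝ≥0} {η : ℕ+ → PathSpace d T}
    {u : PathSpace d T} (hη : ∀ N, η N ∈ latticePaths d T (χ N) N)
    (hF : ∀ N, discreteF α N (η N) ≤ z) (hu : Tendsto η atTop (𝓝 u)) :
    ∃ (w : ℕ+ → SpaceTimeLp d T α) (w' : SpaceTimeLp d T α), (∀ N, IsVersion (w N) (η N)) ∧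
      IsVersion w' u ∧
      (∃ M : ℝ≥0, (∀ N, eLpNorm (w N) (ENNReal.ofReal (gainExponent d α)) (spaceTime d T) ≤ M) ∧
        eLpNorm w' (ENNReal.ofReal (gainExponent d α)) (spaceTime d T) ≤ M) ∧
      Tendsto w atTop (𝓝 w') := by
  choose w hw using fun N => exists_isVersion Fact.out (hη N) (hF N)
  have hseq : ∀ x : ℕ → ℕ+, Tendsto x atTop atTop →
      ∃ w' : SpaceTimeLp d T α, IsVersion w' u ∧ Tendsto (w ∘ x) atTop (𝓝 w') := fun x hx =>
    exists_tendsto_isVersion hx (fun k => hη (x k)) (fun k => hF (x k))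
      (TestedConvergence.of_tendsto (hu.comp hx)) fun k => hw (x k)
  have hsucc : Tendsto Nat.succPNat atTop atTop := tendsto_atTop.2 fun m => by
    filter_upwards [eventually_ge_atTop (m : ℕ)] with k hk
    exact (PNat.coe_le_coe _ _).1 (hk.trans (Nat.le_succ k))
  obtain ⟨w', hw', hlim⟩ := hseq _ hsucc
  obtain ⟨M, hM⟩ := exists_eLpNorm_latticeFun_le d T (α := α) Fact.out z
  have hM' : ∀ N, eLpNorm (w N) (ENNReal.ofReal (gainExponent d α)) (spaceTime d T) ≤ M := by
    intro N
    rw [eLpNorm_congr_ae ((hw N).ae_eq_latticeFun (hη N))]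
    exact hM (χ N) N (η N) (hη N) (hF N)
  refine ⟨w, w', hw, hw', ⟨M, hM', eLpNorm_le_of_tendsto_Lp hlim fun k => hM' _⟩, ?_⟩
  -- Along every sequence of indices the limit is a version of u, and versions are unique, so all
  -- these limits coincide.
  refine tendsto_of_seq_tendsto fun x hx => ?_
  obtain ⟨w'', hw'', hlim'⟩ := hseq x hx
  rwa [hw'.eq hw'']

lemma continuumF_le_liminf [NeZero d] [Fact (1 ≤ α)] {η : ℕ+ → PathSpace d T}
    {u : PathSpace d T} (hη : ∀ N, η N ∈ latticePaths d T (χ N) N) (hu : Tendsto η atTop (𝓝 u)) :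
    continuumF α u ≤ liminf (fun N => discreteF α N (η N)) atTop := by
  refine le_of_forall_gt_imp_ge_of_dense fun c hc => ?_
  induction c with
  | top => exact le_top
  | coe c =>
    obtain ⟨x, hx, hxc⟩ := exists_seq_forall_of_frequently
      (frequently_lt_of_liminf_lt (by isBoundedDefault) hc)
    exact continuumF_le_of_testedConvergence hx (fun k => hη (x k)) (fun k => (hxc k).le)
      (TestedConvergence.of_tendsto (hu.comp hx))

lemma exists_isOpen_forall_isVersion [NeZero d] [Fact (1 ≤ α)] {u : PathSpace d T} (l : ℝ≥0)
    {V : Set (SpaceTimeLp d T α)} (hV : IsOpen V) (hu : ∃ w ∈ V, IsVersion w u) :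
    ∃ U : Set (PathSpace d T), IsOpen U ∧ u ∈ U ∧ ∀ᶠ N in atTop,
      ∀ η ∈ latticePaths d T (χ N) N, discreteF α N η ≤ l → η ∈ U →
        ∃ w ∈ V, IsVersion w η := by
  refine exists_isOpen_eventually u fun N η hN hη hF hc => ?_
  choose w hw using fun k => exists_isVersion Fact.out (hη k) (hF k)
  obtain ⟨w', hw', hlim⟩ := exists_tendsto_isVersion hN hη hF hc hw
  obtain ⟨w₀, hw₀, hw₀u⟩ := hu
  rw [hw'.eq hw₀u] at hlim
  obtain ⟨k, hk⟩ := (hlim.eventually (hV.mem_nhds hw₀)).exists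
  exact ⟨k, w k, hk, hw k⟩

lemma exists_isOpen_forall_lt_discreteF [NeZero d] [Fact (1 ≤ α)] {u : PathSpace d T}
    (hu : continuumF α u = ⊤) (l : ℝ≥0) :
    ∃ U : Set (PathSpace d T), IsOpen U ∧ u ∈ U ∧ ∀ᶠ N in atTop,
      ∀ η ∈ latticePaths d T (χ N) N, η ∈ U → (l : ℝ≥0∞) < discreteF α N η := by
  -- With the property `False`, the neighbourhood principle says that paths of energy at most l are
  -- eventually absent near u; a tested sequence of them would force a finite limiting functional.
  obtain ⟨U, hU, huU, h⟩ := exists_isOpen_eventually (α := α) (l := l) (χ := χ) u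
    (P := fun _ _ => False) fun N η hN hη hF hc => by
      have h1 := continuumF_le_of_testedConvergence hN hη hF hc
      rw [hu] at h1
      exact absurd h1 (not_le.2 ENNReal.coe_lt_top)
  refine ⟨U, hU, huU, ?_⟩
  filter_upwards [h] with N hN η hη hηU
  by_contra hcon
  exact hN η hη (not_lt.1 hcon) hηU

end Main

end ZeroRange

end

theorem lemma5p1 (d : ℕ) [NeZero d] (α : ℝ) [Fact (1 ≤ α)] :
    ∃ β : ℝ, α < β ∧ ∀ (T : ℝ) (_ : 0 < T) (χ : ℕ+ → ℝ) (_ : ∀ N, 0 < χ N),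
      -- integrability, strong convergence and the bound on the limit
      (∀ (z : ℝ≥0) (η : ℕ+ → ZeroRange.PathSpace d T) (u : ZeroRange.PathSpace d T),
        (∀ N, η N ∈ ZeroRange.latticePaths d T (χ N) N) →
        (∀ N, ZeroRange.discreteF α N (η N) ≤ z) →
        Tendsto η atTop (𝓝 u) →
        u ∈ ZeroRange.continuousPaths d T →
        (∃ (w : ℕ+ → ZeroRange.SpaceTimeLp d T α) (w' : ZeroRange.SpaceTimeLp d T α),
          (∀ N, ZeroRange.IsVersion (w N) (η N)) ∧ ZeroRange.IsVersion w' u ∧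
          (∃ M : ℝ≥0,
            (∀ N, eLpNorm (w N) (ENNReal.ofReal β) (ZeroRange.spaceTime d T) ≤ M) ∧
            eLpNorm w' (ENNReal.ofReal β) (ZeroRange.spaceTime d T) ≤ M) ∧
          Tendsto w atTop (𝓝 w')) ∧
        ZeroRange.continuumF α u ≤ z) ∧
      -- the Γ-lower bound
      (∀ u ∈ ZeroRange.continuousPaths d T,
        ZeroRange.continuumF α u ≤
          ⨅ (η : ℕ+ → ZeroRange.PathSpace d T)
            (_ : ∀ N, η N ∈ ZeroRange.latticePaths d T (χ N) N)
            (_ : Tendsto η atTop (𝓝 u)),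
            liminf (fun N => ZeroRange.discreteF α N (η N)) atTop) ∧
      -- neighbourhoods of paths in the energy class
      (∀ u ∈ ZeroRange.energyClass d T α, ∀ (l : ℝ≥0) (V : Set (ZeroRange.SpaceTimeLp d T α)),
        IsOpen V → (∃ w ∈ V, ZeroRange.IsVersion w u) →
        ∃ U : Set (ZeroRange.PathSpace d T), IsOpen U ∧ u ∈ U ∧
          ∀ᶠ N in atTop, ∀ η ∈ ZeroRange.latticePaths d T (χ N) N,
            ZeroRange.discreteF α N η ≤ l → η ∈ U →
            ∃ w ∈ V, ZeroRange.IsVersion w η) ∧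
      -- neighbourhoods of paths where the limiting functional is infinite
      (∀ u : ZeroRange.PathSpace d T, ZeroRange.continuumF α u = ⊤ → ∀ l : ℝ≥0,
        ∃ U : Set (ZeroRange.PathSpace d T), IsOpen U ∧ u ∈ U ∧
          ∀ᶠ N in atTop, ∀ η ∈ ZeroRange.latticePaths d T (χ N) N,
            η ∈ U → (l : ℝ≥0∞) < ZeroRange.discreteF α N η) := by
  refine ⟨ZeroRange.gainExponent d α, ZeroRange.lt_gainExponent d α, fun T _ χ _ =>
    ⟨fun z η u hη hF hu _ => ⟨ZeroRange.exists_versions_tendsto hη hF hu, ?_⟩, fun u _ => ?_,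
      fun u _ l V hV hu => ZeroRange.exists_isOpen_forall_isVersion l hV hu,
      fun u hu l => ZeroRange.exists_isOpen_forall_lt_discreteF hu l⟩⟩
  · exact (ZeroRange.continuumF_le_liminf hη hu).trans
      (liminf_le_of_frequently_le' (Frequently.of_forall hF))
  · exact le_iInf fun η => le_iInf fun hη => le_iInf fun hu => ZeroRange.continuumF_le_liminf hη hu
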